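/- **Setting.** Let $f_i,g_i:\mathbb R^d\times\mathbb R^p\to\mathbb R$, $1\le i\le N$ ($N,d,p\ge1$), be the local losses $f_i(x,y)=\mathbb E_{\xi\sim\mathcal D_{f_i}}F(x,y;\xi)$, $g_i(x,y)=\mathbb E_{\zeta\sim\mathcal D_{g_i}}G(x,y;\zeta)$, let $f=\frac1N\sum_i f_i$, $g=\frac1N\sum_i g_i$, $y^\star(x)=\arg\min_y g(x,y)$, $\Phi(x)=f(x,y^\star(x))$. Assume: 1. $\nabla f_i,\nabla g_i,\nabla^2g_i$ are Lipschitz with constants $L_{\nabla f},L_{\nabla g},L_{\nabla^2g}>0$; $\|\nabla_2f_i(x,y^\star(x))\|\le L_f$ for all $x$, with $L_f>0$; $g_i(x,\cdot)$ is $\mu_g$-strongly convex, $\mu_g>0$. Put $\kappa=\max\{L_f,L_{\nabla f},L_{\nabla g},L_{\nabla^2g}\}/\mu_g$. 2. For all $(x,y)$, $\frac1N\sum_i\|\nabla_kf_i-\nabla_kf\|^2\le b_1^2$ for $k=1,2$, and $\frac1N\sum_i\|\nabla_2g_i-\nabla_2g\|^2$, $\frac1N\sum_i\|\nabla_{12}^2g_i-\nabla_{12}^2g\|^2$,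 $\frac1N\sum_i\|\nabla_{22}^2g_i-\nabla_{22}^2g\|^2\le b_2^2$. Put $b=\max\{b_1,b_2\}$. 3. $F(\cdot,\cdot;\xi)$ is differentiable, $G(\cdot,\cdot;\zeta)$ is twice differentiable, and for all $(x,y)$ and $i$ the oracles $\nabla_1F,\nabla_2F$ (with $\xi\sim\mathcal D_{f_i}$) and $\nabla_2G,\nabla_{12}^2G,\nabla_{22}^2G$ (with $\zeta\sim\mathcal D_{g_i}$) are unbiased for the corresponding derivatives of $f_i$, $g_i$, with variance at most $\sigma^2$. 4. $W\in\mathbb R^{N\times N}$ satisfies $\mathbb 1^\top W=\mathbb 1^\top$, $W\mathbb 1=\mathbb 1$ and $\rho=\|W-\mathbb 1\mathbb 1^\top/N\|_2<1$. **Algorithm (D-SOBA).** From deterministic $x_i^{(0)},y_i^{(0)},z_i^{(0)},h_i^{(0)}$, for $t=0,\dots,T-1$ draw $\xi_i^{(t)}\sim\mathcal D_{f_i}$, $\zeta_i^{(t)}\sim\mathcal D_{g_i}$, all independent, and set $$x_i^{(t+1)}=\sum_jw_{ij}(x_j^{(t)}-\tau\alpha h_j^{(t)}),\quad y_i^{(t+1)}=\sum_jw_{ij}(y_j^{(t)}-\beta\nabla_2G(x_j^{(t)},y_j^{(t)};\zeta_j^{(t)})),$$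 $$z_i^{(t+1)}=\sum_jw_{ij}\big(z_j^{(t)}-\gamma(p_{H,j}^{(t)}-\nabla_2F(x_j^{(t)},y_j^{(t)};\xi_j^{(t)}))\big),\quad h_i^{(t+1)}=(1-\theta)h_i^{(t)}+\theta\big(\nabla_1F(x_i^{(t)},y_i^{(t)};\xi_i^{(t)})-p_{J,i}^{(t)}\big),$$ where in the variant D-SOBA-SO $p_{H,i}^{(t)}=\nabla_{22}^2G(x_i^{(t)},y_i^{(t)};\zeta_i^{(t)})z_i^{(t)}$, $p_{J,i}^{(t)}=\nabla_{12}^2G(x_i^{(t)},y_i^{(t)};\zeta_i^{(t)})z_i^{(t)}$, and in the variant D-SOBA-FO $$p_{H,i}^{(t)}=\tfrac1{2\delta_t}\big(\nabla_2G(x_i^{(t)},y_i^{(t)}+\delta_tz_i^{(t)};\zeta_i^{(t)})-\nabla_2G(x_i^{(t)},y_i^{(t)}-\delta_tz_i^{(t)};\zeta_i^{(t)})\big),$$ and $p_{J,i}^{(t)}$ is the same expression with $\nabla_1G$; here $\delta_t>0$ may depend on the samples drawn before iteration $t$. Bars denote averages over the nodes; $\mathbf x^{(t)}$ has rows $x_i^{(t)}$,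 all rows of $\bar{\mathbf x}^{(t)}$ equal $\bar x^{(t)}$, and likewise for $y,z$. **Statement.** For all $L_f,L_{\nabla f},L_{\nabla g},L_{\nabla^2g}>0$ and $0<\tau_1\le\tau_2$ there are $c_1,c_2,c_3>0$ such that for all $\mu_g>0$, $\sigma\ge0$, $R$, $A>0$, $K>0$ there are $\alpha_0,C>0$ with the following property. Let $N,d,p,T\ge1$, let all the above hold, with any $b_1,b_2\ge0$ and $\rho<1$, and let the initialization satisfy $\Phi(\bar x^{(0)})-\inf\Phi\le R$ (so that $\Phi$ is bounded below), $\|\bar y^{(0)}-y^\star(\bar x^{(0)})\|^2\le R$, $\|\bar z^{(0)}\|^2\le R$, $\frac1N\sum_i\|h_i^{(0)}\|^2\le R$ and $\|\mathbf x^{(0)}-\bar{\mathbf x}^{(0)}\|_F^2+\|\mathbf y^{(0)}-\bar{\mathbf y}^{(0)}\|_F^2+\|\mathbf z^{(0)}-\bar{\mathbf z}^{(0)}\|_F^2\le R$. Let $$0<\alpha\le\min\{A\sqrt{N/T},\ \alpha_0(1-\rho)\},\quad\beta=c_1\alpha,\ \gamma=c_2\alpha,\ \theta=c_3\alpha,\quad\tau_1\kappa^{-4}\le\tau\le\tau_2\kappa^{-4}$$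 (so $\alpha=A\sqrt{N/T}$ is allowed as soon as $T\ge A^2N/(\alpha_0(1-\rho))^2$). In the variant D-SOBA-FO let moreover $L_{\nabla^2g}\,\delta_t\|z_i^{(t)}\|^2\le\sqrt3\,\iota$ almost surely for all $i$ and $t<T$, for some $\iota>0$ with $\alpha\iota^2+\frac{\rho^2\alpha^2\iota^2}{(1-\rho)^2}\le\frac K{NT}$. Then, for both variants, the expectations below are finite and $$\frac1T\sum_{t=0}^{T-1}\mathbb E\left[\frac{\|\mathbf x^{(t)}-\bar{\mathbf x}^{(t)}\|_F^2+\|\mathbf y^{(t)}-\bar{\mathbf y}^{(t)}\|_F^2+\|\mathbf z^{(t)}-\bar{\mathbf z}^{(t)}\|_F^2}N\right]\le C\left[\frac NT\left(\frac{b^2}{(1-\rho)^2}+\frac1{1-\rho}\right)+\frac{N^{1/2}}{T^{3/2}(1-\rho)^2}+\frac1{(1-\rho)NT}\right].$$ -/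

import Mathlib

open MeasureTheory ProbabilityTheory

noncomputable section

namespace DSOBA

/-- `ℝⁿ` with the Euclidean norm. -/
abbrev Vec (n : ℕ) : Type := EuclideanSpace ℝ (Fin n)

/-! Partial and full derivatives of a function on `ℝᵈ × ℝᵖ`. -/

section Calculus

variable {d p : ℕ}

/-- `∇₁ f (x, y) ∈ ℝᵈ`. -/
def grad1 (f : Vec d → Vec p → ℝ) (x : Vec d) (y : Vec p) : Vec d :=
  gradient (fun x' => f x' y) x

/-- `∇₂ f (x, y) ∈ ℝᵖ`. -/
def grad2 (f : Vec d → Vec p → ℝ) (x : Vec d) (y : Vec p) : Vec p :=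
  gradient (fun y' => f x y') y

/-- The `d × p` partial Hessian `∇²₁₂ f (x, y)`, as an operator `ℝᵖ → ℝᵈ`; its norm is the
spectral norm. -/
def hess12 (f : Vec d → Vec p → ℝ) (x : Vec d) (y : Vec p) : Vec p →L[ℝ] Vec d :=
  fderiv ℝ (fun y' => grad1 f x y') y

/-- The `p × p` partial Hessian `∇²₂₂ f (x, y)`, as an operator `ℝᵖ → ℝᵖ`. -/
def hess22 (f : Vec d → Vec p → ℝ) (x : Vec d) (y : Vec p) : Vec p →L[ℝ] Vec p :=
  fderiv ℝ (fun y' => grad2 f x y') y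

/-- `f` as a function on `ℝᵈ⁺ᵖ`, that is on `ℝᵈ × ℝᵖ` with the Euclidean (not the sup) norm. -/
def joint (f : Vec d → Vec p → ℝ) (u : WithLp 2 (Vec d × Vec p)) : ℝ := f u.fst u.snd

/-- The full gradient `∇ f`. -/
def fullGrad (f : Vec d → Vec p → ℝ) (u : WithLp 2 (Vec d × Vec p)) :
    WithLp 2 (Vec d × Vec p) :=
  gradient (joint f) u

/-- The full Hessian `∇² f`. -/
def fullHess (f : Vec d → Vec p → ℝ) (u : WithLp 2 (Vec d × Vec p)) :
    WithLp 2 (Vec d × Vec p) →L[ℝ] WithLp 2 (Vec d × Vec p) :=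
  fderiv ℝ (fullGrad f) u

end Calculus

/-! The distributed bilevel problem. -/

section Problem

variable {N d p : ℕ}

/-- The average `(1/N) ∑ᵢ vᵢ` over the nodes. -/
def nodeAvg {V : Type*} [AddCommGroup V] [Module ℝ V] (v : Fin N → V) : V :=
  (N : ℝ)⁻¹ • ∑ i, v i

/-- The local loss `(x, y) ↦ 𝔼_{s ∼ Dᵢ} F(x, y; s)` of node `i`. -/
def localLoss {S : Type*} [MeasurableSpace S] (D : Fin N → Measure S)
    (F : S → Vec d → Vec p → ℝ) (i : Fin N) (x : Vec d) (y : Vec p) : ℝ :=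
  ∫ s, F s x y ∂(D i)

/-- The global loss `(1/N) ∑ᵢ fᵢ`. -/
def globalLoss (f : Fin N → Vec d → Vec p → ℝ) (x : Vec d) (y : Vec p) : ℝ :=
  nodeAvg fun i => f i x y

/-- `y⋆(x)`, the minimizer of `g(x, ·)`. -/
def lowerSol (g : Vec d → Vec p → ℝ) (x : Vec d) : Vec p :=
  Classical.epsilon fun y => IsMinOn (g x) Set.univ y

/-- The upper-level objective `Φ(x) = f(x, y⋆(x))`. -/
def hyperObj (f g : Vec d → Vec p → ℝ) (x : Vec d) : ℝ := f x (lowerSol g x)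

/-- Smoothness: `∇fᵢ`, `∇gᵢ`, `∇²gᵢ` are Lipschitz with constants `Lgf`, `Lgg`, `Lhg`;
`‖∇₂fᵢ(x, y⋆(x))‖ ≤ Lf`; and `gᵢ(x, ·)` is `μ`-strongly convex. -/
structure Smoothness (f g : Fin N → Vec d → Vec p → ℝ) (Lgf Lgg Lhg Lf μ : ℝ) : Prop where
  diff_f : ∀ i, Differentiable ℝ (joint (f i))
  diff_g : ∀ i, Differentiable ℝ (joint (g i))
  diff_grad_g : ∀ i, Differentiable ℝ (fullGrad (g i))
  lip_grad_f : ∀ i u v, ‖fullGrad (f i) u - fullGrad (f i) v‖ ≤ Lgf * ‖u - v‖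
  lip_grad_g : ∀ i u v, ‖fullGrad (g i) u - fullGrad (g i) v‖ ≤ Lgg * ‖u - v‖
  lip_hess_g : ∀ i u v, ‖fullHess (g i) u - fullHess (g i) v‖ ≤ Lhg * ‖u - v‖
  bound_grad2_f : ∀ i x, ‖grad2 (f i) x (lowerSol (globalLoss g) x)‖ ≤ Lf
  strong_convex : ∀ i x, StrongConvexOn Set.univ μ (g i x)

/-- Bounded gradient dissimilarity across the nodes. -/
structure Dissimilarity (f g : Fin N → Vec d → Vec p → ℝ) (b₁ b₂ : ℝ) : Prop where
  grad1_f : ∀ x y, nodeAvg (fun i => ‖grad1 (f i) x y - grad1 (globalLoss f) x y‖ ^ 2) ≤ b₁ ^ 2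
  grad2_f : ∀ x y, nodeAvg (fun i => ‖grad2 (f i) x y - grad2 (globalLoss f) x y‖ ^ 2) ≤ b₁ ^ 2
  grad2_g : ∀ x y, nodeAvg (fun i => ‖grad2 (g i) x y - grad2 (globalLoss g) x y‖ ^ 2) ≤ b₂ ^ 2
  hess12_g : ∀ x y,
    nodeAvg (fun i => ‖hess12 (g i) x y - hess12 (globalLoss g) x y‖ ^ 2) ≤ b₂ ^ 2
  hess22_g : ∀ x y,
    nodeAvg (fun i => ‖hess22 (g i) x y - hess22 (globalLoss g) x y‖ ^ 2) ≤ b₂ ^ 2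

/-- `o(s)`, `s ∼ D`, is an unbiased estimate of `v` with variance at most `σ²`. -/
def UnbiasedOracle {S V : Type*} [MeasurableSpace S] [NormedAddCommGroup V] [NormedSpace ℝ V]
    (D : Measure S) (o : S → V) (v : V) (σ : ℝ) : Prop :=
  Integrable o D ∧ ∫ s, o s ∂D = v ∧
    Integrable (fun s => ‖o s - v‖ ^ 2) D ∧ ∫ s, ‖o s - v‖ ^ 2 ∂D ≤ σ ^ 2

/-- Stochasticity: `F(·, ·; ξ)` is differentiable, `G(·, ·; ζ)` is twice differentiable, the local
losses are finite expectations, and the gradient and Hessian oracles are unbiased with variance at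
most `σ²`. -/
structure Stochasticity {S Z : Type*} [MeasurableSpace S] [MeasurableSpace Z]
    (Df : Fin N → Measure S) (Dg : Fin N → Measure Z)
    (F : S → Vec d → Vec p → ℝ) (G : Z → Vec d → Vec p → ℝ) (σ : ℝ) : Prop where
  prob_f : ∀ i, IsProbabilityMeasure (Df i)
  prob_g : ∀ i, IsProbabilityMeasure (Dg i)
  integrable_F : ∀ i x y, Integrable (fun s => F s x y) (Df i)
  integrable_G : ∀ i x y, Integrable (fun s => G s x y) (Dg i)
  diff_F : ∀ s, Differentiable ℝ (joint (F s))
  diff_G : ∀ s, Differentiable ℝ (joint (G s))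
  diff_grad_G : ∀ s, Differentiable ℝ (fullGrad (G s))
  meas_grad1_F : Measurable fun q : S × Vec d × Vec p => grad1 (F q.1) q.2.1 q.2.2
  meas_grad2_F : Measurable fun q : S × Vec d × Vec p => grad2 (F q.1) q.2.1 q.2.2
  meas_grad1_G : Measurable fun q : Z × Vec d × Vec p => grad1 (G q.1) q.2.1 q.2.2
  meas_grad2_G : Measurable fun q : Z × Vec d × Vec p => grad2 (G q.1) q.2.1 q.2.2
  meas_hess12_G : Measurable fun q : Z × Vec d × Vec p => hess12 (G q.1) q.2.1 q.2.2
  meas_hess22_G : Measurable fun q : Z × Vec d × Vec p => hess22 (G q.1) q.2.1 q.2.2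
  grad1_F : ∀ i x y,
    UnbiasedOracle (Df i) (fun s => grad1 (F s) x y) (grad1 (localLoss Df F i) x y) σ
  grad2_F : ∀ i x y,
    UnbiasedOracle (Df i) (fun s => grad2 (F s) x y) (grad2 (localLoss Df F i) x y) σ
  grad2_G : ∀ i x y,
    UnbiasedOracle (Dg i) (fun s => grad2 (G s) x y) (grad2 (localLoss Dg G i) x y) σ
  hess12_G : ∀ i x y,
    UnbiasedOracle (Dg i) (fun s => hess12 (G s) x y) (hess12 (localLoss Dg G i) x y) σ
  hess22_G : ∀ i x y,
    UnbiasedOracle (Dg i) (fun s => hess22 (G s) x y) (hess22 (localLoss Dg G i) x y) σ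

/-- `ρ = ‖W - 𝟙𝟙ᵀ/N‖₂`, the spectral norm. -/
def mixRate (W : Matrix (Fin N) (Fin N) ℝ) : ℝ :=
  ‖Matrix.toEuclideanCLM (𝕜 := ℝ) (n := Fin N) (W - Matrix.of fun _ _ => (N : ℝ)⁻¹)‖

/-- The mixing matrix satisfies `𝟙ᵀW = 𝟙ᵀ`, `W𝟙 = 𝟙` and `ρ < 1`. -/
structure Mixing (W : Matrix (Fin N) (Fin N) ℝ) : Prop where
  col_sum : ∀ j, ∑ i, W i j = 1
  row_sum : ∀ i, ∑ j, W i j = 1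
  rate_lt_one : mixRate W < 1

end Problem

/-! The algorithm. -/

section Algorithm

/-- The two variants: second-order and fully first-order. -/
inductive Variant
  | SO
  | FO

/-- The local variables `xᵢ, yᵢ, zᵢ, hᵢ` of all nodes. -/
structure State (N d p : ℕ) where
  x : Fin N → Vec d
  y : Fin N → Vec p
  z : Fin N → Vec p
  h : Fin N → Vec d

/-- The step sizes `α_t, β_t, γ_t, θ_t` and the scaling parameter `τ`. -/
structure StepSizes where
  α : ℕ → ℝ
  β : ℕ → ℝ
  γ : ℕ → ℝ
  θ : ℕ → ℝ
  τ : ℝ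

variable {N d p : ℕ} {S Z : Type*}

/-- The stochastic Hessian-vector product `p_H` at `(x, y)` in the direction `z`. -/
def pH (v : Variant) (G : Vec d → Vec p → ℝ) (δ : ℝ) (x : Vec d) (y z : Vec p) : Vec p :=
  match v with
  | .SO => hess22 G x y z
  | .FO => (2 * δ)⁻¹ • (grad2 G x (y + δ • z) - grad2 G x (y - δ • z))

/-- The stochastic Jacobian-vector product `p_J` at `(x, y)` in the direction `z`. -/
def pJ (v : Variant) (G : Vec d → Vec p → ℝ) (δ : ℝ) (x : Vec d) (y z : Vec p) : Vec d :=
  match v with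
  | .SO => hess12 G x y z
  | .FO => (2 * δ)⁻¹ • (grad1 G x (y + δ • z) - grad1 G x (y - δ • z))

/-- One iteration, with samples `ξᵢ`, `ζᵢ` and perturbation `δ`. The sums over the neighbours of
`i` are written as sums over all nodes, because `W i j = 0` when `j` is not a neighbour of `i`. -/
def step (v : Variant) (F : S → Vec d → Vec p → ℝ) (G : Z → Vec d → Vec p → ℝ)
    (W : Matrix (Fin N) (Fin N) ℝ) (α β γ θ τ δ : ℝ) (ξ : Fin N → S) (ζ : Fin N → Z)
    (s : State N d p) : State N d p where
  x i := ∑ j, W i j • (s.x j - (τ * α) • s.h j)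
  y i := ∑ j, W i j • (s.y j - β • grad2 (G (ζ j)) (s.x j) (s.y j))
  z i := ∑ j, W i j • (s.z j -
    γ • (pH v (G (ζ j)) δ (s.x j) (s.y j) (s.z j) - grad2 (F (ξ j)) (s.x j) (s.y j)))
  h i := (1 - θ) • s.h i +
    θ • (grad1 (F (ξ i)) (s.x i) (s.y i) - pJ v (G (ζ i)) δ (s.x i) (s.y i) (s.z i))

/-- The iterates of D-SOBA along one realization of the samples and perturbations. -/
def iterate (v : Variant) (F : S → Vec d → Vec p → ℝ) (G : Z → Vec d → Vec p → ℝ)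
    (W : Matrix (Fin N) (Fin N) ℝ) (η : StepSizes) (s₀ : State N d p)
    (δ : ℕ → ℝ) (ξ : ℕ → Fin N → S) (ζ : ℕ → Fin N → Z) : ℕ → State N d p
  | 0 => s₀
  | t + 1 => step v F G W (η.α t) (η.β t) (η.γ t) (η.θ t) η.τ (δ t) (ξ t) (ζ t)
      (iterate v F G W η s₀ δ ξ ζ t)

/-- `‖𝐯 - 𝐯̄‖_F²`, where `𝐯` has rows `vᵢ` and all rows of `𝐯̄` are the average of the `vᵢ`. -/
def dispersion {n : ℕ} (v : Fin N → Vec n) : ℝ := ∑ i, ‖v i - nodeAvg v‖ ^ 2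

/-- `(‖𝐱 - 𝐱̄‖_F² + ‖𝐲 - 𝐲̄‖_F² + ‖𝐳 - 𝐳̄‖_F²) / N`. -/
def consensusError (s : State N d p) : ℝ :=
  (dispersion s.x + dispersion s.y + dispersion s.z) / N

/-- The quantities of the initialization that the constant in the bound may depend on are at most
`R`: the gap `Φ(x̄⁰) - inf Φ` (in particular `Φ` is bounded below), `‖ȳ⁰ - y⋆(x̄⁰)‖²`, `‖z̄⁰‖²`,
the mean of the `‖hᵢ⁰‖²`, and the total initial dispersion of `x, y, z`. -/
structure InitBound (f g : Vec d → Vec p → ℝ) (s₀ : State N d p) (R : ℝ) : Prop where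
  gap : ∀ x, hyperObj f g (nodeAvg s₀.x) - hyperObj f g x ≤ R
  lower : ‖nodeAvg s₀.y - lowerSol g (nodeAvg s₀.x)‖ ^ 2 ≤ R
  aux : ‖nodeAvg s₀.z‖ ^ 2 ≤ R
  momentum : nodeAvg (fun i => ‖s₀.h i‖ ^ 2) ≤ R
  consensus : dispersion s₀.x + dispersion s₀.y + dispersion s₀.z ≤ R

end Algorithm

/-! Sampling. -/

section Sampling

variable {N : ℕ} {Ω S Z : Type*} [MeasurableSpace Ω] [mS : MeasurableSpace S]
  [mZ : MeasurableSpace Z]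

/-- During the first `T` iterations, the samples `ξᵢᵗ ∼ Df i`, `ζᵢᵗ ∼ Dg i` are independent of each
other and over all nodes and iterations. -/
structure Sampling (P : Measure Ω) (T : ℕ) (Df : Fin N → Measure S) (Dg : Fin N → Measure Z)
    (ξ : ℕ → Fin N → Ω → S) (ζ : ℕ → Fin N → Ω → Z) : Prop where
  meas_ξ : ∀ t i, Measurable (ξ t i)
  meas_ζ : ∀ t i, Measurable (ζ t i)
  law : ∀ t < T, ∀ i, P.map (fun ω => (ξ t i ω, ζ t i ω)) = (Df i).prod (Dg i)
  indep : iIndepFun (fun (q : Fin T × Fin N) ω => (ξ q.1 q.2 ω, ζ q.1 q.2 ω)) P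

/-- The `σ`-algebra generated by the samples of the iterations before `t`. -/
abbrev past (ξ : ℕ → Fin N → Ω → S) (ζ : ℕ → Fin N → Ω → Z) (t : ℕ) : MeasurableSpace Ω :=
  ⨆ s : Fin t, ⨆ i : Fin N, mS.comap (ξ s i) ⊔ mZ.comap (ζ s i)

end Sampling

end DSOBA

end

/-! The proof closes a linear system of recursions for six expected errors: the squared distances Y,
Z, H of the averages ȳ, z̄, h̄ from y⋆(x̄), z⋆(x̄), ∇Φ(x̄), the spread S of h over the nodes, the
consensus error D, and B = 𝔼‖h̄‖², which measures how fast x̄ moves. Here z⋆(x) solves ∇²₂₂g z = ∇₂f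
at (x, y⋆(x)), and ∇Φ stands for ∇₁f - ∇²₁₂g z⋆ at that point.

Geometry. The maps y⋆, z⋆, ∇Φ are Lipschitz with constants κ, 4κ³, 8Lκ³, where L is the largest
smoothness constant, and Φ satisfies a descent inequality along ∇Φ (`BilevelRegular.descent`). All
that the algorithm's analysis needs is collected in `Landscape`, which `Smoothness.landscape`
constructs.

One step. Mixing preserves averages and contracts deviations from them by ρ (`spread_mix`). Given
the past, ȳ and z̄ make a noisy step of a strongly monotone Lipschitz operator, h̄ makes a convex
combination, and the targets drift by a multiple of τα‖h̄‖ (`errY_update_le`, `errZ_update_le`,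
`errH_update_le`). The consensus error contracts, up to the spread of the update directions, which
the heterogeneity b and the other errors control (`consensusError_update_le`). The finite
differences of the first-order variant enter only as a bias at most ι, with the same variance bound
as a Hessian-vector product (`hasMeanVar_centralDiff`). Independence of fresh samples from the past
turns these bounds into recursions for expectations (`IsRun.errorRecursion`).

Summation. Summing over t bounds ΣY, ΣZ, ΣH by multiples of E = 1/α + ΣD + ι²T + αT plus small
multiples of ΣB, while the summed descent inequality bounds ΣB by a multiple of 1/α plus 2ΣH. The
constants in β, γ, θ are so large against τ that this loop has gain at most 1/2, so everything is
controlled by E (`exists_sum_le_consensus`).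

Rate. The consensus recursion then gives (1-ρ)ΣD ≲ 1/N + α²(E + b²T)/(1-ρ) + α²T. Since α ≤ α₀(1-ρ),
the ΣD inside E is absorbed on the left; α ≤ A√(N/T) turns the rest into the claimed rate
(`exists_consensus_rate`). -/

set_option linter.unusedSectionVars false

namespace DSOBA

/-! ### Averages over the nodes and the spread around them -/

section NodeAvg

variable {N : ℕ} {V : Type*}

section Module
variable [AddCommGroup V] [Module ℝ V]

theorem nodeAvg_add (v w : Fin N → V) :
    nodeAvg (fun i => v i + w i) = nodeAvg v + nodeAvg w := by
  simp [nodeAvg, Finset.sum_add_distrib]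

theorem nodeAvg_sub (v w : Fin N → V) :
    nodeAvg (fun i => v i - w i) = nodeAvg v - nodeAvg w := by
  simp [nodeAvg, Finset.sum_sub_distrib, smul_sub]

theorem nodeAvg_smul (r : ℝ) (v : Fin N → V) :
    nodeAvg (fun i => r • v i) = r • nodeAvg v := by
  simp only [nodeAvg, ← Finset.smul_sum]; rw [smul_comm]

theorem nodeAvg_const (hN : 1 ≤ N) (c : V) : nodeAvg (fun _ : Fin N => c) = c := by
  have : (N : ℝ) ≠ 0 := by positivity
  simp only [nodeAvg, Finset.sum_const, Finset.card_univ, Fintype.card_fin]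
  rw [← Nat.cast_smul_eq_nsmul ℝ, smul_smul, inv_mul_cancel₀ this, one_smul]

theorem map_nodeAvg {W : Type*} [AddCommGroup W] [Module ℝ W] (f : V →ₗ[ℝ] W) (v : Fin N → V) :
    f (nodeAvg v) = nodeAvg fun i => f (v i) := by
  simp [nodeAvg, map_sum]

end Module

theorem nodeAvg_mul (r : ℝ) (v : Fin N → ℝ) : nodeAvg (fun i => r * v i) = r * nodeAvg v :=
  nodeAvg_smul r v

theorem nodeAvg_mono {v w : Fin N → ℝ} (h : ∀ i, v i ≤ w i) : nodeAvg v ≤ nodeAvg w := by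
  simp only [nodeAvg, smul_eq_mul]
  exact mul_le_mul_of_nonneg_left (Finset.sum_le_sum fun i _ => h i) (by positivity)

theorem nodeAvg_nonneg {v : Fin N → ℝ} (h : ∀ i, 0 ≤ v i) : 0 ≤ nodeAvg v := by
  simp only [nodeAvg, smul_eq_mul]
  exact mul_nonneg (by positivity) (Finset.sum_nonneg fun i _ => h i)

theorem nodeAvg_le_const (hN : 1 ≤ N) {v : Fin N → ℝ} {c : ℝ} (h : ∀ i, v i ≤ c) :
    nodeAvg v ≤ c := (nodeAvg_mono h).trans_eq (nodeAvg_const hN c)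

theorem const_le_nodeAvg (hN : 1 ≤ N) {v : Fin N → ℝ} {c : ℝ} (h : ∀ i, c ≤ v i) :
    c ≤ nodeAvg v := (nodeAvg_const hN c).symm.le.trans (nodeAvg_mono h)

section Inner
variable [NormedAddCommGroup V] [InnerProductSpace ℝ V]

theorem norm_add_sq_le_two (a b : V) : ‖a + b‖ ^ 2 ≤ 2 * ‖a‖ ^ 2 + 2 * ‖b‖ ^ 2 := by
  have := norm_add_le a b
  nlinarith [sq_nonneg (‖a‖ - ‖b‖), norm_nonneg (a + b), norm_nonneg a, norm_nonneg b]

theorem norm_sub_sq_le_two (a b : V) : ‖a - b‖ ^ 2 ≤ 2 * ‖a‖ ^ 2 + 2 * ‖b‖ ^ 2 := by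
  simpa [sub_eq_add_neg] using norm_add_sq_le_two a (-b)

/-- The mean square distance to `c` is the spread plus the square distance of the mean to `c`. -/
theorem nodeAvg_norm_sub_sq (hN : 1 ≤ N) (v : Fin N → V) (c : V) :
    nodeAvg (fun i => ‖v i - c‖ ^ 2) =
      nodeAvg (fun i => ‖v i - nodeAvg v‖ ^ 2) + ‖nodeAvg v - c‖ ^ 2 := by
  have h : ∀ i, ‖v i - c‖ ^ 2 = ‖v i - nodeAvg v‖ ^ 2 +
      2 * inner ℝ (nodeAvg v - c) (v i - nodeAvg v) + ‖nodeAvg v - c‖ ^ 2 := by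
    intro i
    have : v i - c = (v i - nodeAvg v) + (nodeAvg v - c) := by abel
    rw [this, norm_add_sq_real, real_inner_comm]
  simp only [h]
  rw [nodeAvg_add, nodeAvg_add, nodeAvg_const hN, nodeAvg_mul]
  have h0 : nodeAvg (fun i => inner ℝ (nodeAvg v - c) (v i - nodeAvg v)) = 0 := by
    have := map_nodeAvg (innerₛₗ ℝ (nodeAvg v - c)) (fun i => v i - nodeAvg v)
    rw [nodeAvg_sub, nodeAvg_const hN, sub_self, map_zero] at this
    exact this.symm
  rw [h0]; ring

theorem norm_nodeAvg_sq_le (hN : 1 ≤ N) (v : Fin N → V) :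
    ‖nodeAvg v‖ ^ 2 ≤ nodeAvg (fun i => ‖v i‖ ^ 2) := by
  have := nodeAvg_norm_sub_sq hN v 0
  simp only [sub_zero] at this
  rw [this]
  have : 0 ≤ nodeAvg (fun i => ‖v i - nodeAvg v‖ ^ 2) := nodeAvg_nonneg fun i => by positivity
  linarith

/-- The mean square distance of the rows of `v` to their average. -/
noncomputable def spread (v : Fin N → V) : ℝ := nodeAvg fun i => ‖v i - nodeAvg v‖ ^ 2

theorem spread_nonneg (v : Fin N → V) : 0 ≤ spread v := nodeAvg_nonneg fun i => by positivity

theorem spread_le (hN : 1 ≤ N) (v : Fin N → V) (c : V) :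
    spread v ≤ nodeAvg fun i => ‖v i - c‖ ^ 2 := by
  rw [nodeAvg_norm_sub_sq hN v c]; unfold spread; nlinarith [norm_nonneg (nodeAvg v - c)]

theorem spread_smul (r : ℝ) (v : Fin N → V) : spread (fun i => r • v i) = r ^ 2 * spread v := by
  unfold spread
  rw [← nodeAvg_mul]
  congr 1; funext i
  rw [nodeAvg_smul, ← smul_sub, norm_smul, mul_pow, Real.norm_eq_abs, sq_abs]

/-- Young's inequality (x + y)² ≤ x²/ρ + y²/(1-ρ) multiplied by ρ², in a form that allows ρ = 0. One
factor ρ survives on `a`, so the recursion for the consensus error still contracts at rate ρ. -/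
theorem weighted_norm_sub_sq {ρ : ℝ} (h0 : 0 ≤ ρ) (h1 : ρ < 1) (a b : V) :
    ρ ^ 2 * ‖a - b‖ ^ 2 ≤ ρ * ‖a‖ ^ 2 + (1 - ρ)⁻¹ * ‖b‖ ^ 2 := by
  have hq : 0 < 1 - ρ := by linarith
  have hi : (1 - ρ)⁻¹ * (1 - ρ) = 1 := inv_mul_cancel₀ hq.ne'
  have hp : 0 < (1 - ρ)⁻¹ := by positivity
  have htri := norm_sub_le a b
  have h2 : ‖a - b‖ ^ 2 ≤ (‖a‖ + ‖b‖) ^ 2 := pow_le_pow_left₀ (norm_nonneg _) htri 2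
  set x := ‖a‖
  set y := ‖b‖
  have h3 : ρ * (x + y) ^ 2 ≤ x ^ 2 + (1 - ρ)⁻¹ * y ^ 2 := by
    -- Completing the square with `(1 - ρ)⁻¹` kept as an atom. `ring` does not cancel it against `1
    -- - ρ`, so correction terms are carried along; `hi` and `h5` then evaluate them.
    have : x ^ 2 + (1 - ρ)⁻¹ * y ^ 2 - ρ * (x + y) ^ 2 =
        (1 - ρ)⁻¹ * (((1 - ρ) * x - ρ * y) ^ 2 + (1 - ρ) * (1 + ρ ) * y ^ 2 * (1 - ρ)
          - 0) + ((1 - ρ)⁻¹ * (1 - ρ) - 1) * 0 + (1 - (1 - ρ)⁻¹ * (1 - ρ)) *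
            ((1 - ρ) * x ^ 2 - 2 * ρ * x * y + (1 + ρ) * (1 - ρ) * y ^ 2)
          + y ^ 2 * ((1 - ρ)⁻¹ - ρ - (1 - ρ)⁻¹ * ρ ^ 2 - (1 + ρ) * (1 - ρ))
          + x ^ 2 * 0 := by
      ring
    have h4 : (1 - ρ)⁻¹ - (1 - ρ)⁻¹ * ρ ^ 2 = 1 + ρ := by
      have : (1 - ρ)⁻¹ - (1 - ρ)⁻¹ * ρ ^ 2 = ((1 - ρ)⁻¹ * (1 - ρ)) * (1 + ρ) := by ring
      rw [this, hi, one_mul]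
    have h5 : y ^ 2 * ((1 - ρ)⁻¹ - ρ - (1 - ρ)⁻¹ * ρ ^ 2 - (1 + ρ) * (1 - ρ)) = y ^ 2 * ρ ^ 2 := by
      rw [show (1 - ρ)⁻¹ - ρ - (1 - ρ)⁻¹ * ρ ^ 2 - (1 + ρ) * (1 - ρ) =
        ((1 - ρ)⁻¹ - (1 - ρ)⁻¹ * ρ ^ 2) - ρ - (1 + ρ) * (1 - ρ) by ring, h4]; ring
    rw [h5, hi] at this
    have h6 : 0 ≤ (1 - ρ)⁻¹ * (((1 - ρ) * x - ρ * y) ^ 2 + (1 - ρ) * (1 + ρ ) * y ^ 2 * (1 - ρ)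
          - 0) := by
      have : 0 ≤ 1 + ρ := by linarith
      have : 0 ≤ (1 - ρ) * (1 + ρ ) * y ^ 2 * (1 - ρ) := by positivity
      rw [sub_zero]; positivity
    nlinarith [mul_nonneg (sq_nonneg y) (sq_nonneg ρ)]
  calc ρ ^ 2 * ‖a - b‖ ^ 2 ≤ ρ ^ 2 * (x + y) ^ 2 := by gcongr
    _ = ρ * (ρ * (x + y) ^ 2) := by ring
    _ ≤ ρ * (x ^ 2 + (1 - ρ)⁻¹ * y ^ 2) := by gcongr
    _ ≤ ρ * x ^ 2 + (1 - ρ)⁻¹ * y ^ 2 := by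
      have : ρ * ((1 - ρ)⁻¹ * y ^ 2) ≤ 1 * ((1 - ρ)⁻¹ * y ^ 2) := by gcongr
      linarith

theorem weighted_spread_sub {ρ : ℝ} (h0 : 0 ≤ ρ) (h1 : ρ < 1) (v w : Fin N → V) :
    ρ ^ 2 * spread (fun i => v i - w i) ≤ ρ * spread v + (1 - ρ)⁻¹ * spread w := by
  unfold spread
  simp only [← nodeAvg_mul]
  rw [← nodeAvg_add]
  refine nodeAvg_mono fun i => ?_
  have : v i - w i - nodeAvg (fun i => v i - w i) =
      (v i - nodeAvg v) - (w i - nodeAvg w) := by rw [nodeAvg_sub]; abel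
  rw [this]
  exact weighted_norm_sub_sq h0 h1 _ _

end Inner

theorem spread_eq_dispersion {n : ℕ} (v : Fin N → Vec n) : spread v = dispersion v / N := by
  simp [spread, dispersion, nodeAvg, div_eq_inv_mul]

theorem consensusError_eq {d p : ℕ} (s : State N d p) :
    consensusError s = spread s.x + spread s.y + spread s.z := by
  simp only [spread_eq_dispersion, consensusError]; ring

end NodeAvg

/-! ### Contraction by the mixing matrix -/

section Mix

variable {N n : ℕ} {W : Matrix (Fin N) (Fin N) ℝ}

theorem nodeAvg_mix (hW : Mixing W) (v : Fin N → Vec n) :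
    nodeAvg (fun i => ∑ j, W i j • v j) = nodeAvg v := by
  unfold nodeAvg
  rw [Finset.sum_comm]
  congr 1
  refine Finset.sum_congr rfl fun j _ => ?_
  rw [← Finset.sum_smul, hW.col_sum, one_smul]

theorem mixRate_nonneg (W : Matrix (Fin N) (Fin N) ℝ) : 0 ≤ mixRate W := norm_nonneg _

/-- The deviations from the average sum to zero, so W acts on them as W - 𝟙𝟙ᵀ/N, whose spectral norm
is ρ. This is applied to each coordinate separately, as the vector over the nodes of the k-th
coordinates. -/
theorem spread_mix (hN : 1 ≤ N) (hW : Mixing W) (v : Fin N → Vec n) :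
    spread (fun i => ∑ j, W i j • v j) ≤ mixRate W ^ 2 * spread v := by
  unfold spread
  rw [nodeAvg_mix hW, ← nodeAvg_mul]
  simp only [nodeAvg, smul_eq_mul]
  refine mul_le_mul_of_nonneg_left ?_ (by positivity)
  rw [← Finset.mul_sum]
  change ∑ i, ‖_ - nodeAvg v‖ ^ 2 ≤ _ * ∑ i, ‖v i - nodeAvg v‖ ^ 2
  simp only [EuclideanSpace.norm_sq_eq]
  rw [Finset.sum_comm, Finset.sum_comm (s := Finset.univ (α := Fin N)), Finset.mul_sum]
  refine Finset.sum_le_sum fun k _ => ?_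
  set M := W - Matrix.of fun _ _ : Fin N => (N : ℝ)⁻¹
  set c : EuclideanSpace ℝ (Fin N) := WithLp.toLp 2 fun i => (v i - nodeAvg v) k
  have h := (Matrix.toEuclideanCLM (𝕜 := ℝ) (n := Fin N) M).le_opNorm c
  have h2 := pow_le_pow_left₀ (norm_nonneg _) h 2
  rw [mul_pow, EuclideanSpace.norm_sq_eq, EuclideanSpace.norm_sq_eq] at h2
  refine le_trans (le_of_eq ?_) h2
  refine Finset.sum_congr rfl fun i _ => ?_
  congr 2
  rw [Matrix.toEuclideanCLM_toLp]
  have hsum0 : ∑ j, (v j - nodeAvg v) = 0 := by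
    have h := nodeAvg_sub v (fun _ => nodeAvg v)
    rw [nodeAvg_const hN, sub_self] at h
    have hN' : (N : ℝ)⁻¹ ≠ 0 := by positivity
    exact (smul_eq_zero.1 h).resolve_left hN'
  have hsum : ∑ j, (v j - nodeAvg v) k = 0 := by
    have := congrArg (fun u : Vec n => u k) hsum0
    simpa using this
  have e : (∑ j, W i j • v j - nodeAvg v : Vec n) k = ∑ j, W i j * (v j - nodeAvg v) k := by
    have : (nodeAvg v : Vec n) = ∑ j, W i j • nodeAvg v := by
      rw [← Finset.sum_smul, hW.row_sum, one_smul]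
    conv_lhs => rw [this]
    rw [← Finset.sum_sub_distrib]
    simp [mul_sub]
  rw [e]
  simp only [M, Matrix.mulVec, dotProduct, Matrix.sub_apply, Matrix.of_apply, sub_mul,
    Finset.sum_sub_distrib, ← Finset.mul_sum, hsum, mul_zero, sub_zero]

end Mix

/-! ### Random vectors with given mean and bounded variance -/

section MeanVar

variable {Ω V : Type*} [MeasurableSpace Ω] {Q : Measure Ω} [IsProbabilityMeasure Q]
  [NormedAddCommGroup V] [InnerProductSpace ℝ V] [CompleteSpace V]

theorem integrable_nodeAvg {W : Type*} [NormedAddCommGroup W] [NormedSpace ℝ W] {N : ℕ}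
    {X : Fin N → Ω → W} (h : ∀ i, Integrable (X i) Q) :
    Integrable (fun ω => nodeAvg fun i => X i ω) Q :=
  (integrable_finsetSum Finset.univ fun i _ => h i).smul (N : ℝ)⁻¹

theorem integral_nodeAvg {W : Type*} [NormedAddCommGroup W] [NormedSpace ℝ W] {N : ℕ}
    {X : Fin N → Ω → W} (h : ∀ i, Integrable (X i) Q) :
    ∫ ω, (nodeAvg fun i => X i ω) ∂Q = nodeAvg fun i => ∫ ω, X i ω ∂Q := by
  unfold nodeAvg
  rw [integral_smul, integral_finsetSum _ fun i _ => h i]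

/-- `X` has mean `m` and (total) variance at most `v`. -/
structure HasMeanVar (Q : Measure Ω) (X : Ω → V) (m : V) (v : ℝ) : Prop where
  int : Integrable X Q
  mean : ∫ ω, X ω ∂Q = m
  int_sq : Integrable (fun ω => ‖X ω - m‖ ^ 2) Q
  var_le : ∫ ω, ‖X ω - m‖ ^ 2 ∂Q ≤ v

namespace HasMeanVar

variable {X Y : Ω → V} {m n : V} {v w : ℝ}

theorem smul (h : HasMeanVar Q X m v) (r : ℝ) :
    HasMeanVar Q (fun ω => r • X ω) (r • m) (r ^ 2 * v) := by
  have e : ∀ ω, ‖r • X ω - r • m‖ ^ 2 = r ^ 2 * ‖X ω - m‖ ^ 2 := fun ω => by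
    rw [← smul_sub, norm_smul, mul_pow, Real.norm_eq_abs, sq_abs]
  refine ⟨h.int.smul r, by rw [integral_smul, h.mean], ?_, ?_⟩
  · simp only [e]; exact h.int_sq.const_mul _
  · simp only [e]; rw [integral_const_mul]
    exact mul_le_mul_of_nonneg_left h.var_le (sq_nonneg r)

theorem const_add (h : HasMeanVar Q X m v) (c : V) :
    HasMeanVar Q (fun ω => c + X ω) (c + m) v := by
  refine ⟨(integrable_const c).add h.int, ?_, ?_, ?_⟩
  · rw [integral_add (integrable_const _) h.int, h.mean]; simp
  · simpa using h.int_sq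
  · simpa using h.var_le

theorem const_sub (h : HasMeanVar Q X m v) (c : V) :
    HasMeanVar Q (fun ω => c - X ω) (c - m) v := by
  have := (h.smul (-1)).const_add c
  simpa [sub_eq_add_neg] using this

/-- No independence of the summands is assumed, hence the factors 2. -/
theorem add (h : HasMeanVar Q X m v) (h' : HasMeanVar Q Y n w) :
    HasMeanVar Q (fun ω => X ω + Y ω) (m + n) (2 * v + 2 * w) := by
  have e : ∀ ω, ‖X ω + Y ω - (m + n)‖ ^ 2 ≤ 2 * ‖X ω - m‖ ^ 2 + 2 * ‖Y ω - n‖ ^ 2 := fun ω => by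
    rw [add_sub_add_comm]; exact norm_add_sq_le_two _ _
  have hi : Integrable (fun ω => 2 * ‖X ω - m‖ ^ 2 + 2 * ‖Y ω - n‖ ^ 2) Q :=
    (h.int_sq.const_mul 2).add (h'.int_sq.const_mul 2)
  have hj : Integrable (fun ω => ‖X ω + Y ω - (m + n)‖ ^ 2) Q := by
    refine hi.mono' ?_ (Filter.Eventually.of_forall fun ω => ?_)
    · exact (((h.int.add h'.int).aestronglyMeasurable.sub aestronglyMeasurable_const).norm.pow 2)
    · rw [Real.norm_of_nonneg (by positivity)]; exact e ω
  refine ⟨h.int.add h'.int, by rw [integral_add h.int h'.int, h.mean, h'.mean], hj, ?_⟩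
  calc _ ≤ ∫ ω, (2 * ‖X ω - m‖ ^ 2 + 2 * ‖Y ω - n‖ ^ 2) ∂Q := integral_mono hj hi e
    _ = 2 * ∫ ω, ‖X ω - m‖ ^ 2 ∂Q + 2 * ∫ ω, ‖Y ω - n‖ ^ 2 ∂Q := by
      rw [integral_add (h.int_sq.const_mul 2) (h'.int_sq.const_mul 2), integral_const_mul,
        integral_const_mul]
    _ ≤ _ := by linarith [h.var_le, h'.var_le]

theorem sub (h : HasMeanVar Q X m v) (h' : HasMeanVar Q Y n w) :
    HasMeanVar Q (fun ω => X ω - Y ω) (m - n) (2 * v + 2 * w) := by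
  simpa [sub_eq_add_neg] using h.add (h'.smul (-1))

/-- Convexity of the squared norm suffices. The joint law over the nodes plays no role, and the
variance is not divided by N: the bound on the consensus error needs no such gain. -/
theorem nodeAvg {N : ℕ} (hN : 1 ≤ N) {X : Fin N → Ω → V} {m : Fin N → V} {v : Fin N → ℝ}
    (h : ∀ i, HasMeanVar Q (X i) (m i) (v i)) :
    HasMeanVar Q (fun ω => nodeAvg fun i => X i ω) (nodeAvg m) (nodeAvg v) := by
  have hX := integrable_nodeAvg fun i => (h i).int
  have hi := integrable_nodeAvg fun i => (h i).int_sq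
  have e : ∀ ω, ‖(DSOBA.nodeAvg fun i => X i ω) - DSOBA.nodeAvg m‖ ^ 2 ≤
      DSOBA.nodeAvg fun i => ‖X i ω - m i‖ ^ 2 := fun ω => by
    rw [← nodeAvg_sub]; exact norm_nodeAvg_sq_le hN _
  have hj : Integrable (fun ω => ‖(DSOBA.nodeAvg fun i => X i ω) - DSOBA.nodeAvg m‖ ^ 2) Q := by
    refine hi.mono' ?_ (Filter.Eventually.of_forall fun ω => ?_)
    · exact (hX.aestronglyMeasurable.sub aestronglyMeasurable_const).norm.pow 2
    · rw [Real.norm_of_nonneg (by positivity)]; exact e ω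
  refine ⟨hX, ?_, hj, ?_⟩
  · rw [integral_nodeAvg fun i => (h i).int]; simp only [(h _).mean]
  · refine (integral_mono hj hi e).trans ?_
    rw [integral_nodeAvg fun i => (h i).int_sq]
    exact nodeAvg_mono fun i => (h i).var_le

theorem norm_sq_eq (h : HasMeanVar Q X m v) :
    Integrable (fun ω => ‖X ω‖ ^ 2) Q ∧
      ∫ ω, ‖X ω‖ ^ 2 ∂Q = ‖m‖ ^ 2 + ∫ ω, ‖X ω - m‖ ^ 2 ∂Q := by
  have e : ∀ ω, ‖X ω‖ ^ 2 = ‖X ω - m‖ ^ 2 + (2 * inner ℝ m (X ω - m) + ‖m‖ ^ 2) := fun ω => by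
    have : X ω = (X ω - m) + m := by abel
    conv_lhs => rw [this, norm_add_sq_real, real_inner_comm]
    ring
  have hc : Integrable (fun ω => X ω - m) Q := h.int.sub (integrable_const m)
  have hin : Integrable (fun ω => inner ℝ m (X ω - m)) Q := hc.const_inner m
  have hr : Integrable (fun ω => 2 * inner ℝ m (X ω - m) + ‖m‖ ^ 2) Q :=
    (hin.const_mul 2).add (integrable_const _)
  constructor
  · simp only [e]; exact h.int_sq.add hr
  · simp only [e]
    rw [integral_add h.int_sq hr, integral_add (hin.const_mul 2) (integrable_const _),
      integral_const_mul, integral_inner hc, integral_sub h.int (integrable_const m), h.mean]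
    simp [add_comm]

theorem norm_sq_le (h : HasMeanVar Q X m v) :
    Integrable (fun ω => ‖X ω‖ ^ 2) Q ∧ ∫ ω, ‖X ω‖ ^ 2 ∂Q ≤ ‖m‖ ^ 2 + v :=
  ⟨h.norm_sq_eq.1, h.norm_sq_eq.2.le.trans (by linarith [h.var_le])⟩

/-- Each deviation X i - X̄ has mean m i - m̄. The bias-variance identity at every node gives 𝔼
spread X = spread m + 𝔼 spread (X - m), and a spread is at most the mean square. The mean of the
oracles is thereby separated from their noise with constant 1. -/
theorem spread_le {N : ℕ} (hN : 1 ≤ N) {X : Fin N → Ω → V} {m : Fin N → V} {v : Fin N → ℝ}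
    (h : ∀ i, HasMeanVar Q (X i) (m i) (v i)) :
    Integrable (fun ω => spread fun i => X i ω) Q ∧
      ∫ ω, (spread fun i => X i ω) ∂Q ≤ spread m + DSOBA.nodeAvg v := by
  have h1 : ∀ i, HasMeanVar Q (fun ω => X i ω - DSOBA.nodeAvg fun i => X i ω)
      (m i - DSOBA.nodeAvg m) (∫ ω, ‖X i ω - (DSOBA.nodeAvg fun i => X i ω) -
        (m i - DSOBA.nodeAvg m)‖ ^ 2 ∂Q) := fun i =>
    let g := (h i).sub (HasMeanVar.nodeAvg hN h)
    ⟨g.int, g.mean, g.int_sq, le_rfl⟩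
  have hi := integrable_nodeAvg fun i => (h i).int_sq
  refine ⟨integrable_nodeAvg fun i => (h1 i).norm_sq_eq.1, ?_⟩
  calc ∫ ω, (spread fun i => X i ω) ∂Q
      = DSOBA.nodeAvg fun i => ∫ ω, ‖X i ω - DSOBA.nodeAvg fun i => X i ω‖ ^ 2 ∂Q :=
        integral_nodeAvg fun i => (h1 i).norm_sq_eq.1
    _ = spread m + DSOBA.nodeAvg fun i => ∫ ω, ‖X i ω - (DSOBA.nodeAvg fun i => X i ω) -
          (m i - DSOBA.nodeAvg m)‖ ^ 2 ∂Q := by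
        simp only [(h1 _).norm_sq_eq.2, nodeAvg_add, spread]
    _ = spread m + ∫ ω, (spread fun i => X i ω - m i) ∂Q := by
        rw [← integral_nodeAvg fun i => (h1 i).int_sq]
        simp only [spread, nodeAvg_sub, sub_sub_sub_comm]
    _ ≤ spread m + ∫ ω, (DSOBA.nodeAvg fun i => ‖X i ω - m i‖ ^ 2) ∂Q := by
        refine add_le_add le_rfl (integral_mono_of_nonneg
          (Filter.Eventually.of_forall fun ω => spread_nonneg _) hi
          (Filter.Eventually.of_forall fun ω => ?_))
        simpa using DSOBA.spread_le hN (fun i => X i ω - m i) 0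
    _ ≤ spread m + DSOBA.nodeAvg v := by
        rw [integral_nodeAvg fun i => (h i).int_sq]
        gcongr
        exact nodeAvg_mono fun i => (h i).var_le

end HasMeanVar

end MeanVar

/-! ### The bilevel problem as seen by the algorithm -/

/-- The properties of the bilevel problem that the analysis uses. The fields `a₁, a₂, g₂, J, H`
stand for `∇₁fᵢ, ∇₂fᵢ, ∇₂gᵢ, ∇²₁₂gᵢ, ∇²₂₂gᵢ`, then follow `y⋆(x)`, the solution `z⋆(x)` of the
linear system `∇²₂₂g z = ∇₂f` at `(x, y⋆(x))`, the objective `Φ` and its gradient. All smoothness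
constants are at most `L`, the strong convexity parameter is `L / κ`. -/
structure Landscape (N d p : ℕ) (L κ b : ℝ) where
  a₁ : Fin N → Vec d → Vec p → Vec d
  a₂ : Fin N → Vec d → Vec p → Vec p
  g₂ : Fin N → Vec d → Vec p → Vec p
  J : Fin N → Vec d → Vec p → Vec p →L[ℝ] Vec d
  H : Fin N → Vec d → Vec p → Vec p →L[ℝ] Vec p
  yStar : Vec d → Vec p
  zStar : Vec d → Vec p
  obj : Vec d → ℝ
  objGrad : Vec d → Vec d
  lip_a₁ : ∀ i x y x' y', ‖a₁ i x y - a₁ i x' y'‖ ^ 2 ≤ L ^ 2 * (‖x - x'‖ ^ 2 + ‖y - y'‖ ^ 2)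
  lip_a₂ : ∀ i x y x' y', ‖a₂ i x y - a₂ i x' y'‖ ^ 2 ≤ L ^ 2 * (‖x - x'‖ ^ 2 + ‖y - y'‖ ^ 2)
  lip_g₂ : ∀ i x y x' y', ‖g₂ i x y - g₂ i x' y'‖ ^ 2 ≤ L ^ 2 * (‖x - x'‖ ^ 2 + ‖y - y'‖ ^ 2)
  lip_J : ∀ i x y x' y', ‖J i x y - J i x' y'‖ ^ 2 ≤ L ^ 2 * (‖x - x'‖ ^ 2 + ‖y - y'‖ ^ 2)
  lip_H : ∀ i x y x' y', ‖H i x y - H i x' y'‖ ^ 2 ≤ L ^ 2 * (‖x - x'‖ ^ 2 + ‖y - y'‖ ^ 2)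
  norm_J : ∀ i x y, ‖J i x y‖ ≤ L
  norm_H : ∀ i x y, ‖H i x y‖ ≤ L
  coercive_H : ∀ i x y z, L / κ * ‖z‖ ^ 2 ≤ inner ℝ z (H i x y z)
  mono_g₂ : ∀ i x y y', L / κ * ‖y - y'‖ ^ 2 ≤ inner ℝ (y - y') (g₂ i x y - g₂ i x y')
  g₂_yStar : ∀ x, nodeAvg (fun i => g₂ i x (yStar x)) = 0
  H_zStar : ∀ x, nodeAvg (fun i => H i x (yStar x) (zStar x) - a₂ i x (yStar x)) = 0
  objGrad_eq : ∀ x, objGrad x = nodeAvg fun i => a₁ i x (yStar x) - J i x (yStar x) (zStar x)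
  norm_zStar : ∀ x, ‖zStar x‖ ≤ κ
  lip_yStar : ∀ x x', ‖yStar x - yStar x'‖ ≤ κ * ‖x - x'‖
  lip_zStar : ∀ x x', ‖zStar x - zStar x'‖ ≤ 4 * κ ^ 3 * ‖x - x'‖
  lip_objGrad : ∀ x x', ‖objGrad x - objGrad x'‖ ≤ 8 * L * κ ^ 3 * ‖x - x'‖
  descent : ∀ x x', obj x' ≤ obj x + inner ℝ (objGrad x) (x' - x) + 4 * L * κ ^ 3 * ‖x' - x‖ ^ 2
  cont_obj : Continuous obj
  het_g₂ : ∀ x, nodeAvg (fun i => ‖g₂ i x (yStar x)‖ ^ 2) ≤ b ^ 2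
  het_aux : ∀ x, nodeAvg (fun i => ‖H i x (yStar x) (zStar x) - a₂ i x (yStar x)‖ ^ 2) ≤
    4 * κ ^ 2 * b ^ 2
  het_obj : ∀ x, nodeAvg (fun i => ‖a₁ i x (yStar x) - J i x (yStar x) (zStar x) - objGrad x‖ ^ 2)
    ≤ 4 * κ ^ 2 * b ^ 2

/-! ### Inequalities in inner product spaces -/

section Auxiliary

variable {V : Type*} [NormedAddCommGroup V] [InnerProductSpace ℝ V]

/-- Young's inequality with weight q/2: half of the contraction pays for the perturbation, since (1
+ q/2)(1 - q) ≤ 1 - q/2 and 1 + 2/q ≤ 3/q. -/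
theorem norm_add_sq_le_of_contraction {a r : V} {q e : ℝ} (hq : 0 < q) (hq1 : q ≤ 1)
    (ha : ‖a‖ ^ 2 ≤ (1 - q) * e) (he : 0 ≤ e) :
    ‖a + r‖ ^ 2 ≤ (1 - q / 2) * e + 3 / q * ‖r‖ ^ 2 := by
  have h1 : ‖a + r‖ ^ 2 ≤ (1 + q / 2) * ‖a‖ ^ 2 + (1 + 2 / q) * ‖r‖ ^ 2 := by
    have h2 : ‖a + r‖ ^ 2 ≤ (‖a‖ + ‖r‖) ^ 2 := pow_le_pow_left₀ (norm_nonneg _) (norm_add_le a r) 2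
    have h3 : 0 ≤ (q / 2 * ‖a‖ - ‖r‖) ^ 2 * (2 / q) := by positivity
    have h4 : (q / 2 * ‖a‖ - ‖r‖) ^ 2 * (2 / q) =
        q / 2 * ‖a‖ ^ 2 - 2 * ‖a‖ * ‖r‖ + 2 / q * ‖r‖ ^ 2 := by field_simp; ring
    nlinarith
  have h5 : (1 + q / 2) * ‖a‖ ^ 2 ≤ (1 + q / 2) * ((1 - q) * e) := by gcongr
  have h6 : (1 + q / 2) * ((1 - q) * e) ≤ (1 - q / 2) * e := by nlinarith [mul_nonneg hq.le he]
  have h7 : 1 + 2 / q ≤ 3 / q := by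
    rw [show (3 : ℝ) / q = 1 / q + 2 / q by ring]
    gcongr; rw [le_div_iff₀ hq]; linarith
  have h8 : (1 + 2 / q) * ‖r‖ ^ 2 ≤ 3 / q * ‖r‖ ^ 2 := by gcongr
  linarith

/-- One step of a strongly monotone Lipschitz operator. The cross term gains 2βμ and the quadratic
term loses β²L² ≤ βμ. -/
theorem norm_sub_smul_sq_le {v G : V} {μ L β : ℝ} (hβ : 0 ≤ β) (hμ : μ * ‖v‖ ^ 2 ≤ inner ℝ v G)
    (hL : ‖G‖ ^ 2 ≤ L ^ 2 * ‖v‖ ^ 2) (hβL : β * L ^ 2 ≤ μ) :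
    ‖v - β • G‖ ^ 2 ≤ (1 - β * μ) * ‖v‖ ^ 2 := by
  rw [norm_sub_sq_real, inner_smul_right, norm_smul, mul_pow, Real.norm_eq_abs, sq_abs]
  have h1 : β ^ 2 * ‖G‖ ^ 2 ≤ β * μ * ‖v‖ ^ 2 := by
    calc β ^ 2 * ‖G‖ ^ 2 ≤ β ^ 2 * (L ^ 2 * ‖v‖ ^ 2) := by gcongr
      _ = β * (β * L ^ 2) * ‖v‖ ^ 2 := by ring
      _ ≤ β * μ * ‖v‖ ^ 2 := by gcongr
  nlinarith [mul_le_mul_of_nonneg_left hμ hβ]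

theorem norm_convex_comb_sq_le {θ : ℝ} (h0 : 0 ≤ θ) (h1 : θ ≤ 1) (a u : V) :
    ‖(1 - θ) • a + θ • u‖ ^ 2 ≤ (1 - θ) * ‖a‖ ^ 2 + θ * ‖u‖ ^ 2 := by
  have h2 : ‖(1 - θ) • a + θ • u‖ ≤ (1 - θ) * ‖a‖ + θ * ‖u‖ := by
    refine (norm_add_le _ _).trans_eq ?_
    rw [norm_smul, norm_smul, Real.norm_of_nonneg h0, Real.norm_of_nonneg (by linarith)]
  have h3 := pow_le_pow_left₀ (norm_nonneg _) h2 2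
  nlinarith [mul_nonneg (mul_nonneg h0 (sub_nonneg.2 h1)) (sq_nonneg (‖a‖ - ‖u‖))]

theorem norm_add_add_sq_le (a b c : V) :
    ‖a + b + c‖ ^ 2 ≤ 3 * (‖a‖ ^ 2 + ‖b‖ ^ 2 + ‖c‖ ^ 2) := by
  have h : ‖a + b + c‖ ≤ ‖a‖ + ‖b‖ + ‖c‖ := norm_add₃_le
  have := pow_le_pow_left₀ (norm_nonneg _) h 2
  nlinarith [sq_nonneg (‖a‖ - ‖b‖), sq_nonneg (‖b‖ - ‖c‖), sq_nonneg (‖a‖ - ‖c‖)]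

theorem norm_sub_sq_le_two_add (a b c : V) :
    ‖a - c‖ ^ 2 ≤ 2 * ‖a - b‖ ^ 2 + 2 * ‖b - c‖ ^ 2 := by
  simpa using norm_add_sq_le_two (a - b) (b - c)

theorem spread_convex_comb_le {N : ℕ} {θ : ℝ} (h0 : 0 ≤ θ) (h1 : θ ≤ 1) (v w : Fin N → V) :
    spread (fun i => (1 - θ) • v i + θ • w i) ≤ (1 - θ) * spread v + θ * spread w := by
  unfold spread
  rw [← nodeAvg_mul, ← nodeAvg_mul, ← nodeAvg_add]
  refine nodeAvg_mono fun i => ?_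
  rw [nodeAvg_add, nodeAvg_smul, nodeAvg_smul]
  have : (1 - θ) • v i + θ • w i - ((1 - θ) • nodeAvg v + θ • nodeAvg w) =
      (1 - θ) • (v i - nodeAvg v) + θ • (w i - nodeAvg w) := by
    rw [smul_sub, smul_sub]; abel
  rw [this]
  exact norm_convex_comb_sq_le h0 h1 _ _

theorem inner_nodeAvg {N : ℕ} (v : V) (w : Fin N → V) :
    inner ℝ v (nodeAvg w) = nodeAvg fun i => inner ℝ v (w i) :=
  map_nodeAvg (innerₛₗ ℝ v) w

/-- The error of `m - a ≈ K z - a` as an approximation of `K' z' - a'`, after the contribution of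
`w - z'` has been split off. -/
theorem norm_oracle_error_sq_le {p : ℕ} {K K' : Vec p →L[ℝ] V} {a a' m : V} {z w z' : Vec p}
    {L κ D ι : ℝ} (hκ : 1 ≤ κ) (hK : ‖K - K'‖ ^ 2 ≤ L ^ 2 * D)
    (ha : ‖a - a'‖ ^ 2 ≤ L ^ 2 * D) (hKL : ‖K‖ ≤ L) (hz' : ‖z'‖ ≤ κ) (hm : ‖m - K z‖ ≤ ι) :
    ‖m - a - K (w - z') - (K' z' - a')‖ ^ 2 ≤
      3 * (4 * L ^ 2 * κ ^ 2 * D + L ^ 2 * ‖z - w‖ ^ 2 + ι ^ 2) := by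
  -- Three sources of error: the change of the operator and of the right-hand side, tested on the
  -- bounded vector z'; the deviation of z from w; the bias of m.
  have e : m - a - K (w - z') - (K' z' - a') =
      ((K - K') z' - (a - a')) + K (z - w) + (m - K z) := by
    simp only [map_sub, sub_apply]; abel
  rw [e]
  have h1 : ‖(K - K') z' - (a - a')‖ ^ 2 ≤ 4 * L ^ 2 * κ ^ 2 * D := by
    have h2 : ‖(K - K') z'‖ ^ 2 ≤ L ^ 2 * D * κ ^ 2 := by
      calc ‖(K - K') z'‖ ^ 2 ≤ (‖K - K'‖ * ‖z'‖) ^ 2 := by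
            gcongr; exact (K - K').le_opNorm z'
        _ = ‖K - K'‖ ^ 2 * ‖z'‖ ^ 2 := mul_pow _ _ _
        _ ≤ L ^ 2 * D * κ ^ 2 := by
            have := (sq_nonneg _).trans hK
            gcongr
    have h3 : L ^ 2 * D ≤ L ^ 2 * D * κ ^ 2 :=
      le_mul_of_one_le_right ((sq_nonneg _).trans hK) (one_le_pow₀ hκ)
    linarith [norm_sub_sq_le_two ((K - K') z') (a - a')]
  have h4 : ‖K (z - w)‖ ^ 2 ≤ L ^ 2 * ‖z - w‖ ^ 2 := by
    rw [← mul_pow]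
    gcongr
    exact (K.le_opNorm _).trans (by gcongr)
  have h5 : ‖m - K z‖ ^ 2 ≤ ι ^ 2 := by gcongr
  linarith [norm_add_add_sq_le ((K - K') z' - (a - a')) (K (z - w)) (m - K z)]

end Auxiliary

/-! ### Conditional bounds for one iteration -/

section Step

variable {N d p : ℕ} {L κ b : ℝ}

/-- One iteration with given values of the gradient and Hessian-vector product oracles. -/
def update (W : Matrix (Fin N) (Fin N) ℝ) (α β γ θ τ : ℝ) (s : State N d p)
    (a₁ : Fin N → Vec d) (a₂ g₂ pH : Fin N → Vec p) (pJ : Fin N → Vec d) : State N d p where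
  x i := ∑ j, W i j • (s.x j - (τ * α) • s.h j)
  y i := ∑ j, W i j • (s.y j - β • g₂ j)
  z i := ∑ j, W i j • (s.z j - γ • (pH j - a₂ j))
  h i := (1 - θ) • s.h i + θ • (a₁ i - pJ i)

namespace Landscape

variable (M : Landscape N d p L κ b) (s : State N d p)

/-- The square error of `ȳ`. -/
noncomputable def errY : ℝ := ‖nodeAvg s.y - M.yStar (nodeAvg s.x)‖ ^ 2

/-- The square error of `z̄`. -/
noncomputable def errZ : ℝ := ‖nodeAvg s.z - M.zStar (nodeAvg s.x)‖ ^ 2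

/-- The square error of `h̄`. -/
noncomputable def errH : ℝ := ‖nodeAvg s.h - M.objGrad (nodeAvg s.x)‖ ^ 2

theorem errY_nonneg : 0 ≤ M.errY s := sq_nonneg _
theorem errZ_nonneg : 0 ≤ M.errZ s := sq_nonneg _
theorem errH_nonneg : 0 ≤ M.errH s := sq_nonneg _

/-- The mean square error, over the nodes, of the expected direction of the `h`-update. -/
noncomputable def bias (ι : ℝ) : ℝ :=
  4 * L ^ 2 * κ ^ 2 * (consensusError s + M.errY s) + L ^ 2 * M.errZ s + ι ^ 2

/-- The noise level of the updates of `z` and `h`. -/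
noncomputable def noise (σ : ℝ) : ℝ :=
  2 * σ ^ 2 * (1 + 2 * κ ^ 2 + 2 * (consensusError s + M.errZ s))

theorem nodeAvg_dist_target (hN : 1 ≤ N) :
    nodeAvg (fun i => ‖s.x i - nodeAvg s.x‖ ^ 2 + ‖s.y i - M.yStar (nodeAvg s.x)‖ ^ 2) =
      spread s.x + spread s.y + M.errY s := by
  rw [nodeAvg_add, nodeAvg_norm_sub_sq hN s.y]; simp only [spread, errY]; ring

theorem nodeAvg_dist_zStar (hN : 1 ≤ N) :
    nodeAvg (fun i => ‖s.z i - M.zStar (nodeAvg s.x)‖ ^ 2) = spread s.z + M.errZ s :=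
  nodeAvg_norm_sub_sq hN s.z _

variable {M s}

theorem nodeAvg_norm_z_sq_le (hN : 1 ≤ N) (M : Landscape N d p L κ b) (s : State N d p) :
    nodeAvg (fun i => ‖s.z i‖ ^ 2) ≤ 2 * κ ^ 2 + 2 * (consensusError s + M.errZ s) := by
  have h : ∀ i, ‖s.z i‖ ^ 2 ≤ 2 * ‖s.z i - M.zStar (nodeAvg s.x)‖ ^ 2 + 2 * κ ^ 2 := fun i => by
    have h1 := norm_add_sq_le_two (s.z i - M.zStar (nodeAvg s.x)) (M.zStar (nodeAvg s.x))
    rw [sub_add_cancel] at h1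
    have h2 : ‖M.zStar (nodeAvg s.x)‖ ^ 2 ≤ κ ^ 2 := by gcongr; exact M.norm_zStar _
    linarith
  refine (nodeAvg_mono h).trans ?_
  rw [nodeAvg_add, nodeAvg_mul, nodeAvg_const hN, M.nodeAvg_dist_zStar s hN, consensusError_eq]
  linarith [spread_nonneg s.x, spread_nonneg s.y]

/-- The random oracles at the state `s` are unbiased, up to `ι` for the Hessian-vector products,
with variance controlled by `σ`. -/
structure NoisyOracles {Ω : Type*} [MeasurableSpace Ω] (M : Landscape N d p L κ b)
    (s : State N d p) (σ ι : ℝ) (Q : Measure Ω) (A₁ : Fin N → Ω → Vec d)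
    (A₂ G₂ PH : Fin N → Ω → Vec p) (PJ : Fin N → Ω → Vec d) : Prop where
  a₁ : ∀ i, HasMeanVar Q (A₁ i) (M.a₁ i (s.x i) (s.y i)) (σ ^ 2)
  a₂ : ∀ i, HasMeanVar Q (A₂ i) (M.a₂ i (s.x i) (s.y i)) (σ ^ 2)
  g₂ : ∀ i, HasMeanVar Q (G₂ i) (M.g₂ i (s.x i) (s.y i)) (σ ^ 2)
  pH : ∀ i, ∃ m, ‖m - M.H i (s.x i) (s.y i) (s.z i)‖ ≤ ι ∧
    HasMeanVar Q (PH i) m (σ ^ 2 * ‖s.z i‖ ^ 2)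
  pJ : ∀ i, ∃ m, ‖m - M.J i (s.x i) (s.y i) (s.z i)‖ ≤ ι ∧
    HasMeanVar Q (PJ i) m (σ ^ 2 * ‖s.z i‖ ^ 2)

theorem nodeAvg_noise_le (hN : 1 ≤ N) (M : Landscape N d p L κ b) (s : State N d p) (σ : ℝ) :
    nodeAvg (fun i => 2 * (σ ^ 2 * ‖s.z i‖ ^ 2) + 2 * σ ^ 2) ≤ M.noise s σ := by
  rw [nodeAvg_add, nodeAvg_const hN, nodeAvg_mul, nodeAvg_mul]
  have := mul_le_mul_of_nonneg_left (nodeAvg_norm_z_sq_le hN M s) (sq_nonneg σ)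
  unfold noise
  linarith

/-- Here w = z̄: the term H i (z̄ - z⋆) is split off because it is what makes z̄ contract. The
remaining deviation of z i from z̄ is part of the consensus error, so the error of z̄ does not occur
on the right. -/
theorem nodeAvg_aux_error_le (hN : 1 ≤ N) (hκ : 1 ≤ κ) {m : Fin N → Vec p} {ι : ℝ}
    (hm : ∀ i, ‖m i - M.H i (s.x i) (s.y i) (s.z i)‖ ≤ ι) :
    nodeAvg (fun i => ‖m i - M.a₂ i (s.x i) (s.y i) -
      M.H i (s.x i) (s.y i) (nodeAvg s.z - M.zStar (nodeAvg s.x)) -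
      (M.H i (nodeAvg s.x) (M.yStar (nodeAvg s.x)) (M.zStar (nodeAvg s.x)) -
        M.a₂ i (nodeAvg s.x) (M.yStar (nodeAvg s.x)))‖ ^ 2) ≤
      3 * (4 * L ^ 2 * κ ^ 2 * (consensusError s + M.errY s) + ι ^ 2) := by
  refine (nodeAvg_mono fun i => norm_oracle_error_sq_le hκ (M.lip_H i _ _ _ _)
    (M.lip_a₂ i _ _ _ _) (M.norm_H i _ _) (M.norm_zStar _) (hm i)).trans ?_
  rw [nodeAvg_mul, nodeAvg_add, nodeAvg_add, nodeAvg_const hN, nodeAvg_mul, nodeAvg_mul,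
    M.nodeAvg_dist_target s hN, consensusError_eq]
  change 3 * (_ + L ^ 2 * spread s.z + _) ≤ _
  have : L ^ 2 * spread s.z ≤ 4 * L ^ 2 * κ ^ 2 * spread s.z := by
    have h1 : L ^ 2 ≤ L ^ 2 * κ ^ 2 := le_mul_of_one_le_right (sq_nonneg L) (one_le_pow₀ hκ)
    have := spread_nonneg s.z
    gcongr
    linarith [mul_nonneg (sq_nonneg L) (sq_nonneg κ)]
  linarith

theorem bias_sum_le (hN : 1 ≤ N) (hκ : 1 ≤ κ) (M : Landscape N d p L κ b) (s : State N d p)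
    (ι : ℝ) :
    nodeAvg (fun i => 3 * (4 * L ^ 2 * κ ^ 2 * (‖s.x i - nodeAvg s.x‖ ^ 2 +
      ‖s.y i - M.yStar (nodeAvg s.x)‖ ^ 2) + L ^ 2 * ‖s.z i - M.zStar (nodeAvg s.x)‖ ^ 2 + ι ^ 2))
      ≤ 3 * M.bias s ι := by
  rw [nodeAvg_mul, nodeAvg_add, nodeAvg_add, nodeAvg_const hN, nodeAvg_mul, nodeAvg_mul,
    M.nodeAvg_dist_target s hN, M.nodeAvg_dist_zStar s hN, bias, consensusError_eq]
  have : L ^ 2 * spread s.z ≤ 4 * L ^ 2 * κ ^ 2 * spread s.z := by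
    have h1 : L ^ 2 ≤ L ^ 2 * κ ^ 2 := le_mul_of_one_le_right (sq_nonneg L) (one_le_pow₀ hκ)
    have := spread_nonneg s.z
    gcongr
    linarith [mul_nonneg (sq_nonneg L) (sq_nonneg κ)]
  linarith

/-- Here w = z⋆, so nothing is split off. For the spread of the update directions no contraction is
to be saved, and the error of z̄ may enter through `bias`. -/
theorem nodeAvg_aux_error_le' (hN : 1 ≤ N) (hκ : 1 ≤ κ) {m : Fin N → Vec p} {ι : ℝ}
    (hm : ∀ i, ‖m i - M.H i (s.x i) (s.y i) (s.z i)‖ ≤ ι) :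
    nodeAvg (fun i => ‖m i - M.a₂ i (s.x i) (s.y i) -
      (M.H i (nodeAvg s.x) (M.yStar (nodeAvg s.x)) (M.zStar (nodeAvg s.x)) -
        M.a₂ i (nodeAvg s.x) (M.yStar (nodeAvg s.x)))‖ ^ 2) ≤ 3 * M.bias s ι := by
  refine (nodeAvg_mono fun i => ?_).trans (bias_sum_le hN hκ M s ι)
  simpa using norm_oracle_error_sq_le (w := M.zStar (nodeAvg s.x)) hκ
    (M.lip_H i (s.x i) (s.y i) (nodeAvg s.x) (M.yStar (nodeAvg s.x)))
    (M.lip_a₂ i (s.x i) (s.y i) (nodeAvg s.x) (M.yStar (nodeAvg s.x)))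
    (M.norm_H i _ _) (M.norm_zStar (nodeAvg s.x)) (hm i)

theorem nodeAvg_obj_error_le (hN : 1 ≤ N) (hκ : 1 ≤ κ) {m : Fin N → Vec d} {ι : ℝ}
    (hm : ∀ i, ‖m i - M.J i (s.x i) (s.y i) (s.z i)‖ ≤ ι) :
    nodeAvg (fun i => ‖M.a₁ i (s.x i) (s.y i) - m i -
      (M.a₁ i (nodeAvg s.x) (M.yStar (nodeAvg s.x)) -
        M.J i (nodeAvg s.x) (M.yStar (nodeAvg s.x)) (M.zStar (nodeAvg s.x)))‖ ^ 2) ≤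
      3 * M.bias s ι := by
  refine (nodeAvg_mono fun i => ?_).trans (bias_sum_le hN hκ M s ι)
  have := norm_oracle_error_sq_le (w := M.zStar (nodeAvg s.x)) hκ
    (M.lip_J i (s.x i) (s.y i) (nodeAvg s.x) (M.yStar (nodeAvg s.x)))
    (M.lip_a₁ i (s.x i) (s.y i) (nodeAvg s.x) (M.yStar (nodeAvg s.x)))
    (M.norm_J i _ _) (M.norm_zStar (nodeAvg s.x)) (hm i)
  rw [sub_self, map_zero, sub_zero, ← norm_neg] at this
  refine le_trans (le_of_eq ?_) this
  congr 2
  abel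

variable {W : Matrix (Fin N) (Fin N) ℝ} {α β γ θ τ σ ι : ℝ}

theorem nodeAvg_update_x (hW : Mixing W) {a₁ : Fin N → Vec d} {a₂ g₂ pH : Fin N → Vec p}
    {pJ : Fin N → Vec d} :
    nodeAvg (update W α β γ θ τ s a₁ a₂ g₂ pH pJ).x = nodeAvg s.x - (τ * α) • nodeAvg s.h := by
  simp only [update]
  rw [nodeAvg_mix hW, nodeAvg_sub, nodeAvg_smul]

/-- Polarization writes -⟨∇Φ, h̄⟩ as (‖∇Φ - h̄‖² - ‖∇Φ‖² - ‖h̄‖²)/2. The second-order term of the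
descent inequality uses up half of the resulting -τα/2 ‖h̄‖², and -‖∇Φ‖² is dropped. -/
theorem obj_update_le (hτα : 0 ≤ τ * α)
    (hsmall : 16 * L * κ ^ 3 * (τ * α) ≤ 1) :
    M.obj (nodeAvg s.x - (τ * α) • nodeAvg s.h) ≤ M.obj (nodeAvg s.x) -
      τ * α / 4 * ‖nodeAvg s.h‖ ^ 2 + τ * α / 2 * M.errH s := by
  have h := M.descent (nodeAvg s.x) (nodeAvg s.x - (τ * α) • nodeAvg s.h)
  rw [sub_sub_cancel_left, inner_neg_right, inner_smul_right, norm_neg, norm_smul, mul_pow,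
    Real.norm_eq_abs, sq_abs] at h
  have h1 : M.errH s = ‖nodeAvg s.h‖ ^ 2 - 2 * inner ℝ (M.objGrad (nodeAvg s.x)) (nodeAvg s.h) +
      ‖M.objGrad (nodeAvg s.x)‖ ^ 2 := by
    rw [errH, norm_sub_sq_real, real_inner_comm]
  have h2 : 4 * L * κ ^ 3 * ((τ * α) ^ 2 * ‖nodeAvg s.h‖ ^ 2) ≤
      τ * α / 4 * ‖nodeAvg s.h‖ ^ 2 := by
    have := mul_le_mul_of_nonneg_right hsmall (mul_nonneg hτα (sq_nonneg ‖nodeAvg s.h‖))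
    linarith
  rw [h1]
  nlinarith [mul_nonneg hτα (sq_nonneg ‖M.objGrad (nodeAvg s.x)‖)]

variable {Ω : Type*} [MeasurableSpace Ω] {Q : Measure Ω} [IsProbabilityMeasure Q]
  {A₁ : Fin N → Ω → Vec d} {A₂ G₂ PH : Fin N → Ω → Vec p} {PJ : Fin N → Ω → Vec d}

theorem errY_update_le (hN : 1 ≤ N) (hL : 0 < L) (hκ : 1 ≤ κ) (hW : Mixing W) (hβ : 0 < β)
    (hβL : β * L ^ 2 ≤ L / κ) (hτα : 0 ≤ τ * α) (hO : NoisyOracles M s σ ι Q A₁ A₂ G₂ PH PJ) :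
    Integrable (fun ω => M.errY (update W α β γ θ τ s (A₁ · ω) (A₂ · ω) (G₂ · ω) (PH · ω)
      (PJ · ω))) Q ∧
    ∫ ω, M.errY (update W α β γ θ τ s (A₁ · ω) (A₂ · ω) (G₂ · ω) (PH · ω) (PJ · ω)) ∂Q ≤
      (1 - β * (L / κ) / 2) * M.errY s + 6 * β * L ^ 2 / (L / κ) * consensusError s +
      6 * κ ^ 2 * (τ * α) ^ 2 / (β * (L / κ)) * ‖nodeAvg s.h‖ ^ 2 + β ^ 2 * σ ^ 2 := by
  have hμ : 0 < L / κ := by positivity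
  set μ := L / κ
  have hμL : μ ≤ L := div_le_self hL.le hκ
  set x' := nodeAvg s.x - (τ * α) • nodeAvg s.h with hx'
  have hmv : HasMeanVar Q (fun ω => (nodeAvg s.y - M.yStar x') - β • nodeAvg fun i => G₂ i ω) _ _ :=
    ((HasMeanVar.nodeAvg hN hO.g₂).smul β).const_sub (nodeAvg s.y - M.yStar x')
  rw [nodeAvg_const hN] at hmv
  have key := hmv.norm_sq_le
  have e : ∀ ω, M.errY (update W α β γ θ τ s (A₁ · ω) (A₂ · ω) (G₂ · ω) (PH · ω) (PJ · ω)) =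
      ‖(nodeAvg s.y - M.yStar x') - β • nodeAvg fun i => G₂ i ω‖ ^ 2 := fun ω => by
    rw [errY, nodeAvg_update_x hW, ← hx']
    simp only [update]
    rw [nodeAvg_mix hW, nodeAvg_sub, nodeAvg_smul, sub_right_comm]
  simp only [e]
  refine ⟨key.1, key.2.trans ?_⟩
  clear key hmv e
  set ys := M.yStar (nodeAvg s.x)
  set G := nodeAvg fun i => M.g₂ i (nodeAvg s.x) (nodeAvg s.y) with hG
  have hG' : G = nodeAvg fun i => M.g₂ i (nodeAvg s.x) (nodeAvg s.y) - M.g₂ i (nodeAvg s.x) ys := by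
    rw [nodeAvg_sub, M.g₂_yStar, sub_zero]
  have ha : ‖nodeAvg s.y - ys - β • G‖ ^ 2 ≤ (1 - β * μ) * M.errY s := by
    refine norm_sub_smul_sq_le hβ.le ?_ ?_ hβL
    · rw [hG', inner_nodeAvg]
      exact const_le_nodeAvg hN fun i => M.mono_g₂ i _ _ _
    · rw [hG']
      refine (norm_nodeAvg_sq_le hN _).trans (nodeAvg_le_const hN fun i => ?_)
      simpa using M.lip_g₂ i (nodeAvg s.x) (nodeAvg s.y) (nodeAvg s.x) ys
  set u := nodeAvg fun i => M.g₂ i (s.x i) (s.y i) - M.g₂ i (nodeAvg s.x) (nodeAvg s.y)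
  have hu : ‖u‖ ^ 2 ≤ L ^ 2 * consensusError s := by
    refine (norm_nodeAvg_sq_le hN _).trans ((nodeAvg_mono fun i => M.lip_g₂ i _ _ _ _).trans ?_)
    rw [nodeAvg_mul, nodeAvg_add, consensusError_eq]
    change L ^ 2 * (spread s.x + spread s.y) ≤ _
    exact mul_le_mul_of_nonneg_left (by linarith [spread_nonneg s.z]) (sq_nonneg L)
  have hw : ‖ys - M.yStar x'‖ ^ 2 ≤ κ ^ 2 * ((τ * α) ^ 2 * ‖nodeAvg s.h‖ ^ 2) := by
    have h := M.lip_yStar (nodeAvg s.x) x'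
    rw [hx', sub_sub_cancel, norm_smul, Real.norm_of_nonneg hτα] at h
    calc _ ≤ (κ * (τ * α * ‖nodeAvg s.h‖)) ^ 2 := by gcongr
      _ = _ := by ring
  -- A gradient step at the averaged point, which contracts towards y⋆(x̄), plus the drift of y⋆ and
  -- the effect of evaluating the gradients at the local points.
  have hdec : nodeAvg s.y - M.yStar x' - β • nodeAvg (fun i => M.g₂ i (s.x i) (s.y i)) =
      (nodeAvg s.y - ys - β • G) + ((ys - M.yStar x') - β • u) := by
    have : u = nodeAvg (fun i => M.g₂ i (s.x i) (s.y i)) - G := nodeAvg_sub _ _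
    rw [this, smul_sub]; abel
  rw [hdec]
  have hq1 : β * μ ≤ 1 := by
    have h1 : β * (L * μ) ≤ μ := by
      refine le_trans ?_ hβL
      rw [sq]; gcongr
    have h2 : β * L ≤ 1 := by
      rw [← mul_assoc] at h1
      exact le_of_mul_le_mul_right (by linarith) hμ
    exact (mul_le_mul_of_nonneg_left hμL hβ.le).trans h2
  have hr : ‖(ys - M.yStar x') - β • u‖ ^ 2 ≤
      2 * (κ ^ 2 * ((τ * α) ^ 2 * ‖nodeAvg s.h‖ ^ 2)) + 2 * (β ^ 2 * (L ^ 2 * consensusError s)) := by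
    have h1 := norm_sub_sq_le_two (ys - M.yStar x') (β • u)
    rw [norm_smul, mul_pow, Real.norm_eq_abs, sq_abs] at h1
    have := mul_le_mul_of_nonneg_left hu (sq_nonneg β)
    linarith
  have h := norm_add_sq_le_of_contraction (r := (ys - M.yStar x') - β • u) (by positivity) hq1 ha
    (M.errY_nonneg s)
  have h3 : 3 / (β * μ) * ‖(ys - M.yStar x') - β • u‖ ^ 2 ≤ 3 / (β * μ) *
      (2 * (κ ^ 2 * ((τ * α) ^ 2 * ‖nodeAvg s.h‖ ^ 2)) +
        2 * (β ^ 2 * (L ^ 2 * consensusError s))) := by gcongr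
  have h4 : 3 / (β * μ) * (2 * (κ ^ 2 * ((τ * α) ^ 2 * ‖nodeAvg s.h‖ ^ 2)) +
        2 * (β ^ 2 * (L ^ 2 * consensusError s))) = 6 * β * L ^ 2 / μ * consensusError s +
      6 * κ ^ 2 * (τ * α) ^ 2 / (β * μ) * ‖nodeAvg s.h‖ ^ 2 := by
    field_simp; ring
  linarith

/-- The contraction comes from the average of the operators H i at the local points, each of them
coercive and bounded. The averaged equation at z⋆ cancels the constant part, leaving the oracle
error and the drift of z⋆. -/
theorem errZ_update_le (hN : 1 ≤ N) (hL : 0 < L) (hκ : 1 ≤ κ) (hW : Mixing W) (hγ : 0 < γ)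
    (hγL : γ * L ^ 2 ≤ L / κ) (hτα : 0 ≤ τ * α) (hO : NoisyOracles M s σ ι Q A₁ A₂ G₂ PH PJ) :
    Integrable (fun ω => M.errZ (update W α β γ θ τ s (A₁ · ω) (A₂ · ω) (G₂ · ω) (PH · ω)
      (PJ · ω))) Q ∧
    ∫ ω, M.errZ (update W α β γ θ τ s (A₁ · ω) (A₂ · ω) (G₂ · ω) (PH · ω) (PJ · ω)) ∂Q ≤
      (1 - γ * (L / κ) / 2) * M.errZ s +
      18 * γ / (L / κ) * (4 * L ^ 2 * κ ^ 2 * (consensusError s + M.errY s) + ι ^ 2) +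
      96 * κ ^ 6 * (τ * α) ^ 2 / (γ * (L / κ)) * ‖nodeAvg s.h‖ ^ 2 + γ ^ 2 * M.noise s σ := by
  have hμ : 0 < L / κ := by positivity
  set μ := L / κ
  have hμL : μ ≤ L := div_le_self hL.le hκ
  set x' := nodeAvg s.x - (τ * α) • nodeAvg s.h with hx'
  choose m hm hPH using hO.pH
  have hmv : HasMeanVar Q
      (fun ω => (nodeAvg s.z - M.zStar x') - γ • nodeAvg fun i => (PH i ω - A₂ i ω)) _ _ :=
    ((HasMeanVar.nodeAvg hN fun i => (hPH i).sub (hO.a₂ i)).smul γ).const_sub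
      (nodeAvg s.z - M.zStar x')
  have key := hmv.norm_sq_le
  have e : ∀ ω, M.errZ (update W α β γ θ τ s (A₁ · ω) (A₂ · ω) (G₂ · ω) (PH · ω) (PJ · ω)) =
      ‖(nodeAvg s.z - M.zStar x') - γ • nodeAvg fun i => (PH i ω - A₂ i ω)‖ ^ 2 := fun ω => by
    rw [errZ, nodeAvg_update_x hW, ← hx']
    simp only [update]
    rw [nodeAvg_mix hW, nodeAvg_sub, nodeAvg_smul, sub_right_comm]
  simp only [e]
  refine ⟨key.1, key.2.trans ?_⟩
  clear key hmv e
  have hnoise := mul_le_mul_of_nonneg_left (nodeAvg_noise_le hN M s σ) (sq_nonneg γ)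
  set zs := M.zStar (nodeAvg s.x) with hzs
  set G := nodeAvg fun i => M.H i (s.x i) (s.y i) (nodeAvg s.z - zs) with hG
  have ha : ‖nodeAvg s.z - zs - γ • G‖ ^ 2 ≤ (1 - γ * μ) * M.errZ s := by
    refine norm_sub_smul_sq_le hγ.le ?_ ?_ hγL
    · rw [hG, inner_nodeAvg]
      exact const_le_nodeAvg hN fun i => M.coercive_H i _ _ _
    · rw [hG]
      refine (norm_nodeAvg_sq_le hN _).trans (nodeAvg_le_const hN fun i => ?_)
      rw [← mul_pow]
      gcongr
      exact ((M.H i _ _).le_opNorm _).trans (by gcongr; exact M.norm_H i _ _)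
  set u := nodeAvg fun i => m i - M.a₂ i (s.x i) (s.y i) -
      M.H i (s.x i) (s.y i) (nodeAvg s.z - zs) -
      (M.H i (nodeAvg s.x) (M.yStar (nodeAvg s.x)) zs -
        M.a₂ i (nodeAvg s.x) (M.yStar (nodeAvg s.x))) with hu_def
  have hu : ‖u‖ ^ 2 ≤ 3 * (4 * L ^ 2 * κ ^ 2 * (consensusError s + M.errY s) + ι ^ 2) :=
    (norm_nodeAvg_sq_le hN _).trans (nodeAvg_aux_error_le hN hκ hm)
  have hw : ‖zs - M.zStar x'‖ ^ 2 ≤ 16 * κ ^ 6 * ((τ * α) ^ 2 * ‖nodeAvg s.h‖ ^ 2) := by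
    have h := M.lip_zStar (nodeAvg s.x) x'
    rw [hx', sub_sub_cancel, norm_smul, Real.norm_of_nonneg hτα] at h
    calc _ ≤ (4 * κ ^ 3 * (τ * α * ‖nodeAvg s.h‖)) ^ 2 := by gcongr
      _ = _ := by ring
  have hdec : nodeAvg s.z - M.zStar x' - γ • nodeAvg (fun i => m i - M.a₂ i (s.x i) (s.y i)) =
      (nodeAvg s.z - zs - γ • G) + ((zs - M.zStar x') - γ • u) := by
    have : u = nodeAvg (fun i => m i - M.a₂ i (s.x i) (s.y i)) - G := by
      rw [hu_def, nodeAvg_sub, nodeAvg_sub, M.H_zStar, sub_zero]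
    rw [this, smul_sub]; abel
  rw [hdec]
  have hq1 : γ * μ ≤ 1 := by
    have h1 : γ * (L * μ) ≤ μ := by
      refine le_trans ?_ hγL
      rw [sq]; gcongr
    have h2 : γ * L ≤ 1 := by
      rw [← mul_assoc] at h1
      exact le_of_mul_le_mul_right (by linarith) hμ
    exact (mul_le_mul_of_nonneg_left hμL hγ.le).trans h2
  set B := 4 * L ^ 2 * κ ^ 2 * (consensusError s + M.errY s) + ι ^ 2
  have hr : ‖(zs - M.zStar x') - γ • u‖ ^ 2 ≤
      2 * (16 * κ ^ 6 * ((τ * α) ^ 2 * ‖nodeAvg s.h‖ ^ 2)) + 2 * (γ ^ 2 * (3 * B)) := by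
    have h1 := norm_sub_sq_le_two (zs - M.zStar x') (γ • u)
    rw [norm_smul, mul_pow, Real.norm_eq_abs, sq_abs] at h1
    have := mul_le_mul_of_nonneg_left hu (sq_nonneg γ)
    linarith
  have h := norm_add_sq_le_of_contraction (r := (zs - M.zStar x') - γ • u) (by positivity) hq1 ha
    (M.errZ_nonneg s)
  have h3 : 3 / (γ * μ) * ‖(zs - M.zStar x') - γ • u‖ ^ 2 ≤ 3 / (γ * μ) *
      (2 * (16 * κ ^ 6 * ((τ * α) ^ 2 * ‖nodeAvg s.h‖ ^ 2)) + 2 * (γ ^ 2 * (3 * B))) := by gcongr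
  have h4 : 3 / (γ * μ) * (2 * (16 * κ ^ 6 * ((τ * α) ^ 2 * ‖nodeAvg s.h‖ ^ 2)) +
      2 * (γ ^ 2 * (3 * B))) = 18 * γ / μ * B +
      96 * κ ^ 6 * (τ * α) ^ 2 / (γ * μ) * ‖nodeAvg s.h‖ ^ 2 := by
    field_simp; ring
  linarith

theorem errH_update_le (hN : 1 ≤ N) (hκ : 1 ≤ κ) (hW : Mixing W) (hθ : 0 < θ)
    (hθ1 : θ ≤ 1) (hτα : 0 ≤ τ * α) (hO : NoisyOracles M s σ ι Q A₁ A₂ G₂ PH PJ) :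
    Integrable (fun ω => M.errH (update W α β γ θ τ s (A₁ · ω) (A₂ · ω) (G₂ · ω) (PH · ω)
      (PJ · ω))) Q ∧
    ∫ ω, M.errH (update W α β γ θ τ s (A₁ · ω) (A₂ · ω) (G₂ · ω) (PH · ω) (PJ · ω)) ∂Q ≤
      (1 - θ) * M.errH s + 6 * θ * M.bias s ι +
      128 * L ^ 2 * κ ^ 6 * (τ * α) ^ 2 / θ * ‖nodeAvg s.h‖ ^ 2 + θ ^ 2 * M.noise s σ := by
  set x' := nodeAvg s.x - (τ * α) • nodeAvg s.h with hx'
  choose m hm hPJ using hO.pJ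
  have hmv : HasMeanVar Q (fun ω => ((1 - θ) • nodeAvg s.h - M.objGrad x') +
      θ • nodeAvg fun i => (A₁ i ω - PJ i ω)) _ _ :=
    ((HasMeanVar.nodeAvg hN fun i => (hO.a₁ i).sub (hPJ i)).smul θ).const_add _
  have key := hmv.norm_sq_le
  have e : ∀ ω, M.errH (update W α β γ θ τ s (A₁ · ω) (A₂ · ω) (G₂ · ω) (PH · ω) (PJ · ω)) =
      ‖((1 - θ) • nodeAvg s.h - M.objGrad x') +
        θ • nodeAvg fun i => (A₁ i ω - PJ i ω)‖ ^ 2 := fun ω => by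
    rw [errH, nodeAvg_update_x hW, ← hx']
    simp only [update]
    rw [nodeAvg_add, nodeAvg_smul, nodeAvg_smul, add_sub_right_comm]
  simp only [e]
  refine ⟨key.1, key.2.trans ?_⟩
  clear key hmv e
  have hnoise := mul_le_mul_of_nonneg_left (nodeAvg_noise_le hN M s σ) (sq_nonneg θ)
  simp only [add_comm (2 * σ ^ 2)]
  set g := M.objGrad (nodeAvg s.x)
  set u := nodeAvg (fun i => M.a₁ i (s.x i) (s.y i) - m i -
      (M.a₁ i (nodeAvg s.x) (M.yStar (nodeAvg s.x)) -
        M.J i (nodeAvg s.x) (M.yStar (nodeAvg s.x)) (M.zStar (nodeAvg s.x)))) with hu_def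
  have hu : ‖u‖ ^ 2 ≤ 3 * M.bias s ι :=
    (norm_nodeAvg_sq_le hN _).trans (nodeAvg_obj_error_le hN hκ hm)
  have hu' : u = nodeAvg (fun i => M.a₁ i (s.x i) (s.y i) - m i) - g := by
    rw [hu_def, nodeAvg_sub]; congr 1; exact (M.objGrad_eq _).symm
  have hw : ‖g - M.objGrad x'‖ ^ 2 ≤
      64 * L ^ 2 * κ ^ 6 * ((τ * α) ^ 2 * ‖nodeAvg s.h‖ ^ 2) := by
    have h := M.lip_objGrad (nodeAvg s.x) x'
    rw [hx', sub_sub_cancel, norm_smul, Real.norm_of_nonneg hτα] at h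
    calc _ ≤ (8 * L * κ ^ 3 * (τ * α * ‖nodeAvg s.h‖)) ^ 2 := by gcongr
      _ = _ := by ring
  -- The drift of ∇Φ is put inside the θ-part, at the price of the factor θ⁻¹, so that convexity
  -- keeps the coefficient 1 - θ of the old error exact.
  have hdec : (1 - θ) • nodeAvg s.h - M.objGrad x' +
      θ • nodeAvg (fun i => M.a₁ i (s.x i) (s.y i) - m i) =
      (1 - θ) • (nodeAvg s.h - g) + θ • (u + θ⁻¹ • (g - M.objGrad x')) := by
    rw [hu', smul_add, smul_smul, mul_inv_cancel₀ hθ.ne', one_smul, smul_sub, smul_sub, sub_smul,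
      sub_smul, one_smul, one_smul]
    abel
  rw [hdec]
  have h1 := norm_convex_comb_sq_le hθ.le hθ1 (nodeAvg s.h - g) (u + θ⁻¹ • (g - M.objGrad x'))
  have h2 := norm_add_sq_le_two u (θ⁻¹ • (g - M.objGrad x'))
  rw [norm_smul, mul_pow, Real.norm_eq_abs, sq_abs] at h2
  have h3 := mul_le_mul_of_nonneg_left hw (sq_nonneg θ⁻¹)
  have h4 : θ * ‖u + θ⁻¹ • (g - M.objGrad x')‖ ^ 2 ≤ θ * (2 * (3 * M.bias s ι) +
      2 * (θ⁻¹ ^ 2 * (64 * L ^ 2 * κ ^ 6 * ((τ * α) ^ 2 * ‖nodeAvg s.h‖ ^ 2)))) := by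
    gcongr; linarith
  have h5 : θ * (2 * (3 * M.bias s ι) +
      2 * (θ⁻¹ ^ 2 * (64 * L ^ 2 * κ ^ 6 * ((τ * α) ^ 2 * ‖nodeAvg s.h‖ ^ 2)))) =
      6 * θ * M.bias s ι + 128 * L ^ 2 * κ ^ 6 * (τ * α) ^ 2 / θ * ‖nodeAvg s.h‖ ^ 2 := by
    field_simp; ring
  change _ ≤ (1 - θ) * ‖nodeAvg s.h - g‖ ^ 2 + _ + _ + _
  linarith

/-- The directions are compared with the common vector ∇Φ(x̄). Their distance to it is the oracle
error plus the heterogeneity of the local hypergradients at (x̄, y⋆, z⋆). -/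
theorem spread_h_update_le (hN : 1 ≤ N) (hκ : 1 ≤ κ) (hθ : 0 < θ)
    (hθ1 : θ ≤ 1) (hO : NoisyOracles M s σ ι Q A₁ A₂ G₂ PH PJ) :
    Integrable (fun ω => spread (update W α β γ θ τ s (A₁ · ω) (A₂ · ω) (G₂ · ω) (PH · ω)
      (PJ · ω)).h) Q ∧
    ∫ ω, spread (update W α β γ θ τ s (A₁ · ω) (A₂ · ω) (G₂ · ω) (PH · ω) (PJ · ω)).h ∂Q ≤
      (1 - θ) * spread s.h + θ * (6 * M.bias s ι + 8 * κ ^ 2 * b ^ 2) +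
      θ ^ 2 * M.noise s σ := by
  choose m hm hPJ using hO.pJ
  have key := HasMeanVar.spread_le hN (X := fun i ω => (1 - θ) • s.h i + θ • (A₁ i ω - PJ i ω))
    fun i => (((hO.a₁ i).sub (hPJ i)).smul θ).const_add ((1 - θ) • s.h i)
  refine ⟨key.1, key.2.trans ?_⟩
  rw [nodeAvg_mul]
  simp only [add_comm (2 * σ ^ 2)]
  have hnoise := mul_le_mul_of_nonneg_left (nodeAvg_noise_le hN M s σ) (sq_nonneg θ)
  have h1 := spread_convex_comb_le hθ.le hθ1 s.h (fun i => M.a₁ i (s.x i) (s.y i) - m i)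
  have h2 : spread (fun i => M.a₁ i (s.x i) (s.y i) - m i) ≤
      6 * M.bias s ι + 8 * κ ^ 2 * b ^ 2 := by
    refine (spread_le hN _ (M.objGrad (nodeAvg s.x))).trans ?_
    refine (nodeAvg_mono fun i => norm_sub_sq_le_two_add _
      (M.a₁ i (nodeAvg s.x) (M.yStar (nodeAvg s.x)) -
        M.J i (nodeAvg s.x) (M.yStar (nodeAvg s.x)) (M.zStar (nodeAvg s.x))) _).trans ?_
    rw [nodeAvg_add, nodeAvg_mul, nodeAvg_mul]
    linarith [nodeAvg_obj_error_le (M := M) hN hκ hm, M.het_obj (nodeAvg s.x)]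
  have h4 := mul_le_mul_of_nonneg_left h2 hθ.le
  linarith

theorem spread_mix_sub_smul_le {n : ℕ} (hW : Mixing W) (v w : Fin N → Vec n) (r : ℝ) :
    mixRate W ^ 2 * spread (fun j => v j - r • w j) ≤
      mixRate W * spread v + (1 - mixRate W)⁻¹ * (r ^ 2 * spread w) := by
  have h := weighted_spread_sub (mixRate_nonneg W) hW.rate_lt_one v (fun i => r • w i)
  rwa [spread_smul] at h

/-- The noise is separated from the mean before Young's inequality is applied, so only the mean of
the directions is multiplied by (1 - ρ)⁻¹. After summation the noise thus costs a single factor 1/(1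
- ρ). -/
theorem spread_random_mix_le {n : ℕ} (hN : 1 ≤ N) (hW : Mixing W) {v : Fin N → Vec n} {r : ℝ}
    {X : Fin N → Ω → Vec n} {m : Fin N → Vec n} {w : Fin N → ℝ} {e c : ℝ}
    (hX : ∀ i, HasMeanVar Q (X i) (m i) (w i)) (hm : spread m ≤ e) (hw : nodeAvg w ≤ c) :
    Integrable (fun ω => spread fun i => ∑ j, W i j • (v j - r • X j ω)) Q ∧
    ∫ ω, (spread fun i => ∑ j, W i j • (v j - r • X j ω)) ∂Q ≤
      mixRate W * spread v + (1 - mixRate W)⁻¹ * (r ^ 2 * e) + r ^ 2 * c := by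
  have hX' : ∀ i, HasMeanVar Q (fun ω => v i - r • X i ω) (v i - r • m i) (r ^ 2 * w i) :=
    fun i => ((hX i).smul r).const_sub (v i)
  have key := HasMeanVar.spread_le hN hX'
  have h0 := mixRate_nonneg W
  have h1 := hW.rate_lt_one
  have hint2 := key.1.const_mul (mixRate W ^ 2)
  have hmeas : AEStronglyMeasurable (fun ω => spread fun i => ∑ j, W i j • (v j - r • X j ω)) Q := by
    have hX2 : ∀ j, AEStronglyMeasurable (X j) Q := fun j => (hX j).int.aestronglyMeasurable
    unfold spread nodeAvg
    fun_prop
  have hpt : ∀ ω, (spread fun i => ∑ j, W i j • (v j - r • X j ω)) ≤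
      mixRate W ^ 2 * spread (fun j => v j - r • X j ω) := fun ω => spread_mix hN hW _
  have hint : Integrable (fun ω => spread fun i => ∑ j, W i j • (v j - r • X j ω)) Q := by
    refine hint2.mono' hmeas (Filter.Eventually.of_forall fun ω => ?_)
    rw [Real.norm_of_nonneg (spread_nonneg _)]
    exact hpt ω
  refine ⟨hint, (integral_mono hint hint2 hpt).trans ?_⟩
  rw [integral_const_mul]
  have h2 : mixRate W ^ 2 ≤ 1 := pow_le_one₀ h0 h1.le
  have h3 := spread_mix_sub_smul_le hW v m r
  have hi : 0 ≤ (1 - mixRate W)⁻¹ := inv_nonneg.2 (by linarith)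
  have hwn : 0 ≤ nodeAvg w := nodeAvg_nonneg fun i =>
    (integral_nonneg fun ω => by positivity).trans (hX i).var_le
  calc mixRate W ^ 2 * ∫ ω, spread (fun j => v j - r • X j ω) ∂Q
      ≤ mixRate W ^ 2 * (spread (fun i => v i - r • m i) + nodeAvg fun i => r ^ 2 * w i) := by
        gcongr; exact key.2
    _ = mixRate W ^ 2 * spread (fun i => v i - r • m i) + mixRate W ^ 2 * (r ^ 2 * nodeAvg w) := by
        rw [nodeAvg_mul]; ring
    _ ≤ (mixRate W * spread v + (1 - mixRate W)⁻¹ * (r ^ 2 * spread m)) +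
        1 * (r ^ 2 * nodeAvg w) := by gcongr
    _ ≤ _ := by rw [one_mul]; gcongr

/-- The y- and z-directions have zero average at (x̄, y⋆, z⋆), so their spread is estimated around
0: Lipschitz continuity up to that point, heterogeneity b at it. The x-direction h is deterministic
given the state and contributes its own spread. -/
theorem consensusError_update_le (hN : 1 ≤ N) (hκ : 1 ≤ κ) (hW : Mixing W)
    (hO : NoisyOracles M s σ ι Q A₁ A₂ G₂ PH PJ) :
    Integrable (fun ω => consensusError (update W α β γ θ τ s (A₁ · ω) (A₂ · ω) (G₂ · ω) (PH · ω)
      (PJ · ω))) Q ∧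
    ∫ ω, consensusError (update W α β γ θ τ s (A₁ · ω) (A₂ · ω) (G₂ · ω) (PH · ω) (PJ · ω)) ∂Q ≤
      mixRate W * consensusError s + (1 - mixRate W)⁻¹ * ((τ * α) ^ 2 * spread s.h +
        β ^ 2 * (2 * L ^ 2 * (consensusError s + M.errY s) + 2 * b ^ 2) +
        γ ^ 2 * (6 * M.bias s ι + 8 * κ ^ 2 * b ^ 2)) + β ^ 2 * σ ^ 2 + γ ^ 2 * M.noise s σ := by
  choose m hm hPH using hO.pH
  have hy : spread (fun i => M.g₂ i (s.x i) (s.y i)) ≤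
      2 * L ^ 2 * (consensusError s + M.errY s) + 2 * b ^ 2 := by
    refine (spread_le hN _ 0).trans ?_
    have h3 : ∀ i, ‖M.g₂ i (s.x i) (s.y i) - 0‖ ^ 2 ≤ 2 * (L ^ 2 * (‖s.x i - nodeAvg s.x‖ ^ 2 +
        ‖s.y i - M.yStar (nodeAvg s.x)‖ ^ 2)) +
        2 * ‖M.g₂ i (nodeAvg s.x) (M.yStar (nodeAvg s.x))‖ ^ 2 := fun i => by
      have := norm_add_sq_le_two (M.g₂ i (s.x i) (s.y i) -
        M.g₂ i (nodeAvg s.x) (M.yStar (nodeAvg s.x)))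
        (M.g₂ i (nodeAvg s.x) (M.yStar (nodeAvg s.x)))
      rw [sub_add_cancel] at this
      rw [sub_zero]
      linarith [M.lip_g₂ i (s.x i) (s.y i) (nodeAvg s.x) (M.yStar (nodeAvg s.x))]
    refine (nodeAvg_mono h3).trans ?_
    rw [nodeAvg_add, nodeAvg_mul, nodeAvg_mul, nodeAvg_mul, M.nodeAvg_dist_target s hN,
      consensusError_eq]
    have := mul_nonneg (sq_nonneg L) (spread_nonneg s.z)
    linarith [M.het_g₂ (nodeAvg s.x)]
  have hz : spread (fun i => m i - M.a₂ i (s.x i) (s.y i)) ≤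
      6 * M.bias s ι + 8 * κ ^ 2 * b ^ 2 := by
    refine (spread_le hN _ 0).trans ?_
    refine (nodeAvg_mono fun i => norm_sub_sq_le_two_add _
      (M.H i (nodeAvg s.x) (M.yStar (nodeAvg s.x)) (M.zStar (nodeAvg s.x)) -
        M.a₂ i (nodeAvg s.x) (M.yStar (nodeAvg s.x))) 0).trans ?_
    simp only [sub_zero]
    rw [nodeAvg_add, nodeAvg_mul, nodeAvg_mul]
    linarith [nodeAvg_aux_error_le' (M := M) hN hκ hm, M.het_aux (nodeAvg s.x)]
  have kx : spread (fun i => ∑ j, W i j • (s.x j - (τ * α) • s.h j)) ≤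
      mixRate W * spread s.x + (1 - mixRate W)⁻¹ * ((τ * α) ^ 2 * spread s.h) :=
    (spread_mix hN hW _).trans (spread_mix_sub_smul_le hW _ _ _)
  have ky := spread_random_mix_le (v := s.y) (r := β) hN hW hO.g₂ hy (nodeAvg_const hN _).le
  have kz := spread_random_mix_le (v := s.z) (r := γ) hN hW
    (fun i => (hPH i).sub (hO.a₂ i)) hz (nodeAvg_noise_le hN M s σ)
  have e : ∀ ω, consensusError (update W α β γ θ τ s (A₁ · ω) (A₂ · ω) (G₂ · ω) (PH · ω)
      (PJ · ω)) = spread (fun i => ∑ j, W i j • (s.x j - (τ * α) • s.h j)) +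
      (spread fun i => ∑ j, W i j • (s.y j - β • G₂ j ω)) +
      spread fun i => ∑ j, W i j • (s.z j - γ • (PH j ω - A₂ j ω)) :=
    fun ω => consensusError_eq _
  simp only [e]
  refine ⟨((integrable_const _).add ky.1).add kz.1, ?_⟩
  rw [integral_add (by exact (integrable_const _).add ky.1) kz.1,
    integral_add (integrable_const _) ky.1, integral_const, probReal_univ, one_smul]
  rw [consensusError_eq] at hy ky ⊢
  linarith [ky.2, kz.2]

end Landscape

end Step

/-! ### Partial derivatives as components of the full derivatives -/

section PartialDerivatives

variable {d p : ℕ}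

/-- The point `(x, y)` of `ℝᵈ⁺ᵖ`. -/
abbrev pt (x : Vec d) (y : Vec p) : WithLp 2 (Vec d × Vec p) := WithLp.toLp 2 (x, y)

theorem norm_pt_sq (x : Vec d) (y : Vec p) : ‖pt x y‖ ^ 2 = ‖x‖ ^ 2 + ‖y‖ ^ 2 :=
  WithLp.prod_norm_sq_eq_of_L2 _

theorem pt_sub (x x' : Vec d) (y y' : Vec p) : pt x y - pt x' y' = pt (x - x') (y - y') := rfl

theorem norm_pt_sub_sq (x x' : Vec d) (y y' : Vec p) :
    ‖pt x y - pt x' y'‖ ^ 2 = ‖x - x'‖ ^ 2 + ‖y - y'‖ ^ 2 := by rw [pt_sub, norm_pt_sq]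

theorem inner_pt (x x' : Vec d) (y y' : Vec p) :
    inner ℝ (pt x y) (pt x' y') = inner ℝ x x' + inner ℝ y y' :=
  WithLp.prod_inner_apply _ _

/-- The embedding `y ↦ (0, y)`. -/
noncomputable def inrL (d p : ℕ) : Vec p →L[ℝ] WithLp 2 (Vec d × Vec p) :=
  ((WithLp.prodContinuousLinearEquiv 2 ℝ (Vec d) (Vec p)).symm :
    (Vec d × Vec p) →L[ℝ] WithLp 2 (Vec d × Vec p)) ∘L ContinuousLinearMap.inr ℝ (Vec d) (Vec p)

/-- The embedding `x ↦ (x, 0)`. -/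
noncomputable def inlL (d p : ℕ) : Vec d →L[ℝ] WithLp 2 (Vec d × Vec p) :=
  ((WithLp.prodContinuousLinearEquiv 2 ℝ (Vec d) (Vec p)).symm :
    (Vec d × Vec p) →L[ℝ] WithLp 2 (Vec d × Vec p)) ∘L ContinuousLinearMap.inl ℝ (Vec d) (Vec p)

theorem inrL_apply (y : Vec p) : inrL d p y = pt 0 y := rfl

theorem norm_inrL_apply (y : Vec p) : ‖inrL d p y‖ = ‖y‖ := by
  rw [inrL_apply]
  simp

theorem hasFDerivAt_pt_right (x : Vec d) (y : Vec p) : HasFDerivAt (pt x) (inrL d p) y :=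
  (WithLp.prodContinuousLinearEquiv 2 ℝ (Vec d) (Vec p)).symm.hasFDerivAt.comp y
    (hasFDerivAt_prodMk_right x y)

theorem hasFDerivAt_pt_left (x : Vec d) (y : Vec p) :
    HasFDerivAt (fun x => pt x y) (inlL d p) x :=
  (WithLp.prodContinuousLinearEquiv 2 ℝ (Vec d) (Vec p)).symm.hasFDerivAt.comp x
    (hasFDerivAt_prodMk_left x y)

variable {f : Vec d → Vec p → ℝ}

theorem hasGradientAt_joint (hf : Differentiable ℝ (joint f)) (u : WithLp 2 (Vec d × Vec p)) :
    HasGradientAt (joint f) (fullGrad f u) u := (hf u).hasGradientAt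

theorem hasGradientAt_snd (hf : Differentiable ℝ (joint f)) (x : Vec d) (y : Vec p) :
    HasGradientAt (f x) (fullGrad f (pt x y)).snd y := by
  rw [hasGradientAt_iff_hasFDerivAt]
  have h := (hasGradientAt_joint hf (pt x y)).hasFDerivAt.comp y (hasFDerivAt_pt_right x y)
  refine h.congr_fderiv ?_
  ext v
  change inner ℝ (fullGrad f (pt x y)) (pt 0 v) = inner ℝ (fullGrad f (pt x y)).snd v
  refine (WithLp.prod_inner_apply _ _).trans ?_
  change inner ℝ _ (0 : Vec d) + _ = _
  rw [inner_zero_right, zero_add]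
  rfl

theorem hasGradientAt_fst (hf : Differentiable ℝ (joint f)) (x : Vec d) (y : Vec p) :
    HasGradientAt (fun x => f x y) (fullGrad f (pt x y)).fst x := by
  rw [hasGradientAt_iff_hasFDerivAt]
  have h := (hasGradientAt_joint hf (pt x y)).hasFDerivAt.comp x (hasFDerivAt_pt_left x y)
  refine h.congr_fderiv ?_
  ext v
  change inner ℝ (fullGrad f (pt x y)) (pt v 0) = inner ℝ (fullGrad f (pt x y)).fst v
  refine (WithLp.prod_inner_apply _ _).trans ?_
  change _ + inner ℝ _ (0 : Vec p) = _
  rw [inner_zero_right, add_zero]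
  rfl

theorem grad2_eq (hf : Differentiable ℝ (joint f)) (x : Vec d) (y : Vec p) :
    grad2 f x y = (fullGrad f (pt x y)).snd := (hasGradientAt_snd hf x y).gradient

theorem grad1_eq (hf : Differentiable ℝ (joint f)) (x : Vec d) (y : Vec p) :
    grad1 f x y = (fullGrad f (pt x y)).fst := (hasGradientAt_fst hf x y).gradient

theorem pt_grad (hf : Differentiable ℝ (joint f)) (x : Vec d) (y : Vec p) :
    pt (grad1 f x y) (grad2 f x y) = fullGrad f (pt x y) := by
  rw [grad1_eq hf, grad2_eq hf]
  rfl

theorem hasFDerivAt_grad1 (hf : Differentiable ℝ (joint f)) (hf' : Differentiable ℝ (fullGrad f))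
    (x : Vec d) (y : Vec p) : HasFDerivAt (grad1 f x)
      (WithLp.fstL 2 ℝ (Vec d) (Vec p) ∘L fullHess f (pt x y) ∘L inrL d p) y := by
  have e : grad1 f x = fun y => WithLp.fstL 2 ℝ (Vec d) (Vec p) (fullGrad f (pt x y)) :=
    funext fun y => grad1_eq hf x y
  rw [e]
  exact (WithLp.fstL 2 ℝ (Vec d) (Vec p)).hasFDerivAt.comp y
    ((hf' (pt x y)).hasFDerivAt.comp y (hasFDerivAt_pt_right x y))

theorem hasFDerivAt_grad2 (hf : Differentiable ℝ (joint f)) (hf' : Differentiable ℝ (fullGrad f))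
    (x : Vec d) (y : Vec p) : HasFDerivAt (grad2 f x)
      (WithLp.sndL 2 ℝ (Vec d) (Vec p) ∘L fullHess f (pt x y) ∘L inrL d p) y := by
  have e : grad2 f x = fun y => WithLp.sndL 2 ℝ (Vec d) (Vec p) (fullGrad f (pt x y)) :=
    funext fun y => grad2_eq hf x y
  rw [e]
  exact (WithLp.sndL 2 ℝ (Vec d) (Vec p)).hasFDerivAt.comp y
    ((hf' (pt x y)).hasFDerivAt.comp y (hasFDerivAt_pt_right x y))

theorem hess12_eq (hf : Differentiable ℝ (joint f)) (hf' : Differentiable ℝ (fullGrad f))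
    (x : Vec d) (y : Vec p) : hess12 f x y =
      WithLp.fstL 2 ℝ (Vec d) (Vec p) ∘L fullHess f (pt x y) ∘L inrL d p :=
  (hasFDerivAt_grad1 hf hf' x y).fderiv

theorem hess22_eq (hf : Differentiable ℝ (joint f)) (hf' : Differentiable ℝ (fullGrad f))
    (x : Vec d) (y : Vec p) : hess22 f x y =
      WithLp.sndL 2 ℝ (Vec d) (Vec p) ∘L fullHess f (pt x y) ∘L inrL d p :=
  (hasFDerivAt_grad2 hf hf' x y).fderiv

theorem fullHess_inrL (hf : Differentiable ℝ (joint f)) (hf' : Differentiable ℝ (fullGrad f))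
    (x : Vec d) (y z : Vec p) :
    fullHess f (pt x y) (pt 0 z) = pt (hess12 f x y z) (hess22 f x y z) := by
  rw [hess12_eq hf hf', hess22_eq hf hf']; rfl

theorem norm_fst_comp_inrL_le (A : WithLp 2 (Vec d × Vec p) →L[ℝ] WithLp 2 (Vec d × Vec p)) :
    ‖WithLp.fstL 2 ℝ (Vec d) (Vec p) ∘L A ∘L inrL d p‖ ≤ ‖A‖ := by
  refine ContinuousLinearMap.opNorm_le_bound _ (norm_nonneg _) fun z => ?_
  calc _ ≤ ‖A (inrL d p z)‖ := WithLp.norm_fst_le _ _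
    _ ≤ ‖A‖ * ‖z‖ := by rw [← norm_inrL_apply (d := d) z]; exact A.le_opNorm _

theorem norm_snd_comp_inrL_le (A : WithLp 2 (Vec d × Vec p) →L[ℝ] WithLp 2 (Vec d × Vec p)) :
    ‖WithLp.sndL 2 ℝ (Vec d) (Vec p) ∘L A ∘L inrL d p‖ ≤ ‖A‖ := by
  refine ContinuousLinearMap.opNorm_le_bound _ (norm_nonneg _) fun z => ?_
  calc _ ≤ ‖A (inrL d p z)‖ := WithLp.norm_snd_le _ _
    _ ≤ ‖A‖ * ‖z‖ := by rw [← norm_inrL_apply (d := d) z]; exact A.le_opNorm _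

theorem norm_hess12_sub_le (hf : Differentiable ℝ (joint f)) (hf' : Differentiable ℝ (fullGrad f))
    (x x' : Vec d) (y y' : Vec p) :
    ‖hess12 f x y - hess12 f x' y'‖ ≤ ‖fullHess f (pt x y) - fullHess f (pt x' y')‖ := by
  rw [hess12_eq hf hf', hess12_eq hf hf', ← ContinuousLinearMap.comp_sub,
    ← ContinuousLinearMap.sub_comp]
  exact norm_fst_comp_inrL_le _

theorem norm_hess22_sub_le (hf : Differentiable ℝ (joint f)) (hf' : Differentiable ℝ (fullGrad f))
    (x x' : Vec d) (y y' : Vec p) :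
    ‖hess22 f x y - hess22 f x' y'‖ ≤ ‖fullHess f (pt x y) - fullHess f (pt x' y')‖ := by
  rw [hess22_eq hf hf', hess22_eq hf hf', ← ContinuousLinearMap.comp_sub,
    ← ContinuousLinearMap.sub_comp]
  exact norm_snd_comp_inrL_le _

theorem norm_fullHess_le {L : ℝ} (hL : 0 ≤ L)
    (h : ∀ u v, ‖fullGrad f u - fullGrad f v‖ ≤ L * ‖u - v‖) (u : WithLp 2 (Vec d × Vec p)) :
    ‖fullHess f u‖ ≤ L :=
  norm_fderiv_le_of_lip' ℝ hL (Filter.Eventually.of_forall fun v => h v u)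

theorem fullHess_symm (hf : Differentiable ℝ (joint f)) (hf' : Differentiable ℝ (fullGrad f))
    (u v w : WithLp 2 (Vec d × Vec p)) :
    inner ℝ (fullHess f u v) w = inner ℝ v (fullHess f u w) := by
  let T : WithLp 2 (Vec d × Vec p) →L[ℝ] WithLp 2 (Vec d × Vec p) →L[ℝ] ℝ := innerSL ℝ
  have h := second_derivative_symmetric (𝕜 := ℝ) (f' := fun y => T (fullGrad f y))
    (fun y => (hasGradientAt_joint hf y).hasFDerivAt)
    (T.hasFDerivAt.comp u (hf' u).hasFDerivAt) v w
  change inner ℝ (fullHess f u v) w = inner ℝ (fullHess f u w) v at h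
  rw [h, real_inner_comm]

/-- `Differentiable.continuous`, stated for normed spaces to spare the instance search on `WithLp`
the passage through topological vector spaces. -/
theorem continuous_of_differentiable {E F : Type*} [NormedAddCommGroup E] [NormedSpace ℝ E]
    [NormedAddCommGroup F] [NormedSpace ℝ F] {k : E → F} (h : Differentiable ℝ k) :
    Continuous k := h.continuous

/-- Second-order Taylor estimate for a map with Lipschitz derivative. -/
theorem norm_taylor_le {E F : Type*} [NormedAddCommGroup E] [NormedSpace ℝ E]
    [NormedAddCommGroup F] [NormedSpace ℝ F] {k : E → F} {k' : E → E →L[ℝ] F} {L : ℝ}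
    (hL : 0 ≤ L) (hk : ∀ u, HasFDerivAt k (k' u) u) (hlip : ∀ u v, ‖k' u - k' v‖ ≤ L * ‖u - v‖)
    (u v : E) : ‖k v - k u - k' u (v - u)‖ ≤ L * ‖v - u‖ ^ 2 := by
  have h := Convex.norm_image_sub_le_of_norm_hasFDerivWithin_le' (𝕜 := ℝ) (f := k) (f' := k')
    (s := segment ℝ u v) (φ := k' u) (C := L * ‖v - u‖)
    (fun x _ => (hk x).hasFDerivWithinAt)
    (fun x hx => (hlip x u).trans (by gcongr; exact norm_sub_le_of_mem_segment hx))
    (convex_segment u v) (left_mem_segment ℝ u v) (right_mem_segment ℝ u v)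
  rw [sq, ← mul_assoc]; exact h

end PartialDerivatives

/-! ### Strong convexity -/

section StrongConvexity

variable {E : Type*} [NormedAddCommGroup E] [InnerProductSpace ℝ E] [CompleteSpace E]
  {h : E → ℝ} {μ : ℝ}

theorem add_le_of_strongConvexOn (hc : StrongConvexOn Set.univ μ h) {y g : E}
    (hg : HasGradientAt h g y) (y' : E) :
    h y + inner ℝ g (y' - y) + μ / 2 * ‖y' - y‖ ^ 2 ≤ h y' := by
  have hl : HasDerivAt (fun t : ℝ => h (y + t • (y' - y))) (inner ℝ g (y' - y)) 0 := by
    have h1 : HasDerivAt (fun t : ℝ => y + t • (y' - y)) (y' - y) 0 := by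
      simpa using ((hasDerivAt_id (0 : ℝ)).smul_const (y' - y)).const_add y
    have h2 : HasFDerivAt h (InnerProductSpace.toDual ℝ E g) (y + (0 : ℝ) • (y' - y)) := by
      simpa using hg.hasFDerivAt
    exact h2.comp_hasDerivAt (0 : ℝ) h1
  have ht := hl.tendsto_slope_zero_right
  -- For t in (0, 1), strong convexity on the segment bounds the difference quotient by this
  -- function of t; the claim is the limit t → 0+.
  have ht2 : Filter.Tendsto (fun t : ℝ => h y' - h y - (1 - t) * (μ / 2 * ‖y' - y‖ ^ 2))
      (nhdsWithin 0 (Set.Ioi 0)) (nhds (h y' - h y - (1 - 0) * (μ / 2 * ‖y' - y‖ ^ 2))) := by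
    refine (Continuous.tendsto ?_ 0).mono_left nhdsWithin_le_nhds
    fun_prop
  have := le_of_tendsto_of_tendsto ht ht2 ?_
  · linarith
  · filter_upwards [Ioo_mem_nhdsGT (zero_lt_one' ℝ)] with t ht
    have hcv := hc.2 (Set.mem_univ y) (Set.mem_univ y') (by linarith [ht.2] : 0 ≤ 1 - t)
      ht.1.le (by ring)
    have e : (1 - t) • y + t • y' = y + (0 + t) • (y' - y) := by
      rw [zero_add, smul_sub, sub_smul, one_smul]; abel
    rw [e, norm_sub_rev] at hcv
    simp only [smul_eq_mul, zero_smul, add_zero] at hcv ⊢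
    rw [inv_mul_le_iff₀ ht.1]
    linarith

theorem inner_sub_of_strongConvexOn (hc : StrongConvexOn Set.univ μ h) {y y' g g' : E}
    (hg : HasGradientAt h g y) (hg' : HasGradientAt h g' y') :
    μ * ‖y - y'‖ ^ 2 ≤ inner ℝ (y - y') (g - g') := by
  have h1 := add_le_of_strongConvexOn hc hg y'
  have h2 := add_le_of_strongConvexOn hc hg' y
  rw [← neg_sub y y', inner_neg_right, norm_neg] at h1
  rw [inner_sub_right, real_inner_comm, real_inner_comm g']
  linarith

theorem exists_isMinOn_of_strongConvexOn [FiniteDimensional ℝ E] (hμ : 0 < μ)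
    (hc : StrongConvexOn Set.univ μ h) (hd : Differentiable ℝ h) :
    ∃ y, IsMinOn h Set.univ y := by
  obtain ⟨y, hy⟩ := hd.continuous.exists_forall_le' (0 : E) (by
    have hb := add_le_of_strongConvexOn hc (hd 0).hasGradientAt
    set g := gradient h 0
    -- Beyond this radius the quadratic term dominates the linear one, so h y ≥ h 0 outside a
    -- compact set.
    have hlarge : ∀ᶠ y in Filter.cocompact E, 2 / μ * ‖g‖ ≤ ‖y‖ :=
      (tendsto_norm_cocompact_atTop (E := E)).eventually_ge_atTop _
    filter_upwards [hlarge] with y hy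
    have h1 := hb y
    rw [sub_zero] at h1
    have h2 : -(‖g‖ * ‖y‖) ≤ inner ℝ g y := neg_le_of_abs_le (abs_real_inner_le_norm g y)
    have h3 : ‖g‖ ≤ μ / 2 * ‖y‖ := by
      rw [div_mul_eq_mul_div, div_le_iff₀ hμ] at hy
      linarith
    have h4 := mul_le_mul_of_nonneg_right h3 (norm_nonneg y)
    linarith)
  exact ⟨y, fun z _ => hy z⟩

/-- Monotonicity between y and y + tz, divided by t² with t → 0+. -/
theorem inner_fderiv_of_monotone {g : E → E} {H : E →L[ℝ] E} {y : E} (hH : HasFDerivAt g H y)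
    (hm : ∀ y', μ * ‖y' - y‖ ^ 2 ≤ inner ℝ (y' - y) (g y' - g y)) (z : E) :
    μ * ‖z‖ ^ 2 ≤ inner ℝ z (H z) := by
  have hl : HasDerivAt (fun t : ℝ => inner ℝ z (g (y + t • z))) (inner ℝ z (H z)) 0 := by
    have h1 : HasDerivAt (fun t : ℝ => y + t • z) z 0 := by
      simpa using ((hasDerivAt_id (0 : ℝ)).smul_const z).const_add y
    have h2 : HasFDerivAt g H (y + (0 : ℝ) • z) := by simpa using hH
    have h3 := h2.comp_hasDerivAt (0 : ℝ) h1
    exact (innerSL ℝ z).hasFDerivAt.comp_hasDerivAt (0 : ℝ) h3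
  refine ge_of_tendsto hl.tendsto_slope_zero_right ?_
  filter_upwards [self_mem_nhdsWithin] with t ht
  have ht : 0 < t := ht
  have h1 := hm (y + t • z)
  rw [add_sub_cancel_left, norm_smul, mul_pow, Real.norm_eq_abs, sq_abs, real_inner_smul_left,
    inner_sub_right] at h1
  simp only [zero_add, zero_smul, add_zero, smul_eq_mul]
  rw [le_inv_mul_iff₀ ht]
  refine le_of_mul_le_mul_left ?_ ht
  linarith

end StrongConvexity

/-! ### Regularity of y⋆, z⋆ and the upper-level objective -/

section Bilevel

variable {d p : ℕ}

/-- Smoothness of a bilevel problem with a single node. -/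
structure BilevelRegular (f g : Vec d → Vec p → ℝ) (L μ : ℝ) : Prop where
  diff_f : Differentiable ℝ (joint f)
  diff_g : Differentiable ℝ (joint g)
  diff_grad_g : Differentiable ℝ (fullGrad g)
  lip_grad_f : ∀ u v, ‖fullGrad f u - fullGrad f v‖ ≤ L * ‖u - v‖
  lip_grad_g : ∀ u v, ‖fullGrad g u - fullGrad g v‖ ≤ L * ‖u - v‖
  lip_hess_g : ∀ u v, ‖fullHess g u - fullHess g v‖ ≤ L * ‖u - v‖
  strong_convex : ∀ x, StrongConvexOn Set.univ μ (g x)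

theorem sq_le_of_le_mul_norm_pt {a L : ℝ} {x x' : Vec d} {y y' : Vec p} (ha : 0 ≤ a)
    (h : a ≤ L * ‖pt x y - pt x' y'‖) : a ^ 2 ≤ L ^ 2 * (‖x - x'‖ ^ 2 + ‖y - y'‖ ^ 2) := by
  rw [← norm_pt_sub_sq, ← mul_pow]
  exact pow_le_pow_left₀ ha h 2

theorem norm_grad1_sub_le {f : Vec d → Vec p → ℝ} (hf : Differentiable ℝ (joint f))
    (x x' : Vec d) (y y' : Vec p) :
    ‖grad1 f x y - grad1 f x' y'‖ ≤ ‖fullGrad f (pt x y) - fullGrad f (pt x' y')‖ := by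
  rw [grad1_eq hf, grad1_eq hf]
  exact WithLp.norm_fst_le _ (fullGrad f (pt x y) - fullGrad f (pt x' y'))

theorem norm_grad2_sub_le {f : Vec d → Vec p → ℝ} (hf : Differentiable ℝ (joint f))
    (x x' : Vec d) (y y' : Vec p) :
    ‖grad2 f x y - grad2 f x' y'‖ ≤ ‖fullGrad f (pt x y) - fullGrad f (pt x' y')‖ := by
  rw [grad2_eq hf, grad2_eq hf]
  exact WithLp.norm_snd_le _ (fullGrad f (pt x y) - fullGrad f (pt x' y'))

namespace BilevelRegular

variable {f g : Vec d → Vec p → ℝ} {L μ κ : ℝ}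

theorem hasGradientAt_g (h : BilevelRegular f g L μ) (x : Vec d) (y : Vec p) :
    HasGradientAt (g x) (grad2 g x y) y := by
  rw [grad2_eq h.diff_g]; exact hasGradientAt_snd h.diff_g x y

theorem mono (h : BilevelRegular f g L μ) (x : Vec d) (y y' : Vec p) :
    μ * ‖y - y'‖ ^ 2 ≤ inner ℝ (y - y') (grad2 g x y - grad2 g x y') :=
  inner_sub_of_strongConvexOn (h.strong_convex x) (h.hasGradientAt_g x y) (h.hasGradientAt_g x y')

theorem coercive (h : BilevelRegular f g L μ) (x : Vec d) (y z : Vec p) :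
    μ * ‖z‖ ^ 2 ≤ inner ℝ z (hess22 g x y z) := by
  rw [hess22_eq h.diff_g h.diff_grad_g]
  exact inner_fderiv_of_monotone (hasFDerivAt_grad2 h.diff_g h.diff_grad_g x y)
    (fun y' => h.mono x y' y) z

/-- This is κ ≥ 1. It needs a nonzero vector, hence `1 ≤ p`. -/
theorem le_lip (h : BilevelRegular f g L μ) (hp : 1 ≤ p) : μ ≤ L := by
  have : Nontrivial (Vec p) := by
    have : Nonempty (Fin p) := ⟨⟨0, hp⟩⟩
    infer_instance
  obtain ⟨z, hz⟩ := exists_ne (0 : Vec p)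
  have h1 := h.mono 0 z 0
  have h2 := (norm_grad2_sub_le h.diff_g 0 0 z 0).trans (h.lip_grad_g _ _)
  have h3 : ‖pt (0 : Vec d) z - pt 0 0‖ = ‖z‖ := by
    rw [pt_sub]; simp
  rw [h3] at h2
  rw [sub_zero] at h1
  have h4 := (real_inner_le_norm _ _).trans (mul_le_mul_of_nonneg_left h2 (norm_nonneg z))
  have h5 : 0 < ‖z‖ := norm_pos_iff.2 hz
  have h6 : μ * ‖z‖ ^ 2 ≤ L * ‖z‖ ^ 2 := by linarith
  exact le_of_mul_le_mul_right h6 (by positivity)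

theorem grad2_lowerSol (h : BilevelRegular f g L μ) (hμ : 0 < μ) (x : Vec d) :
    grad2 g x (lowerSol g x) = 0 := by
  have hmin : IsMinOn (g x) Set.univ (lowerSol g x) :=
    Classical.epsilon_spec (exists_isMinOn_of_strongConvexOn hμ (h.strong_convex x)
      fun y => (h.hasGradientAt_g x y).differentiableAt)
  have h0 := (hmin.isLocalMin Filter.univ_mem).hasFDerivAt_eq_zero
    (h.hasGradientAt_g x _).hasFDerivAt
  simpa using h0

theorem exists_linear_solution (h : BilevelRegular f g L μ) (hμ : 0 < μ) (x : Vec d)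
    (y v : Vec p) : ∃ z, hess22 g x y z = v := by
  have hinj : Function.Injective (hess22 g x y : Vec p →ₗ[ℝ] Vec p) := by
    refine (injective_iff_map_eq_zero _).2 fun z hz => ?_
    have h1 := h.coercive x y z
    have hz' : hess22 g x y z = 0 := hz
    rw [hz', inner_zero_right] at h1
    have : ‖z‖ ^ 2 ≤ 0 := by
      by_contra hc
      push Not at hc
      linarith [mul_pos hμ hc]
    exact norm_eq_zero.1 (pow_eq_zero_iff two_ne_zero |>.1 (le_antisymm this (sq_nonneg _)))
  exact LinearMap.surjective_of_injective hinj v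

/-- `z⋆(x)`, the solution of `∇²₂₂g z = ∇₂f` at `(x, y⋆(x))`. -/
noncomputable def auxSol (h : BilevelRegular f g L μ) (hμ : 0 < μ) (x : Vec d) : Vec p :=
  (h.exists_linear_solution hμ x (lowerSol g x) (grad2 f x (lowerSol g x))).choose

theorem auxSol_spec (h : BilevelRegular f g L μ) (hμ : 0 < μ) (x : Vec d) :
    hess22 g x (lowerSol g x) (h.auxSol hμ x) = grad2 f x (lowerSol g x) :=
  (h.exists_linear_solution hμ x (lowerSol g x) (grad2 f x (lowerSol g x))).choose_spec

/-- The gradient of the upper-level objective. -/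
noncomputable def objGrad (h : BilevelRegular f g L μ) (hμ : 0 < μ) (x : Vec d) : Vec d :=
  grad1 f x (lowerSol g x) - hess12 g x (lowerSol g x) (h.auxSol hμ x)

theorem norm_le_of_coercive {z w : Vec p} (hμ : 0 < μ) (hzw : μ * ‖z‖ ^ 2 ≤ inner ℝ z w) :
    ‖z‖ ≤ ‖w‖ / μ := by
  rw [le_div_iff₀ hμ]
  rcases (norm_nonneg z).eq_or_lt with h0 | h0
  · rw [← h0, zero_mul]; exact norm_nonneg _
  · have := hzw.trans (real_inner_le_norm z w)
    refine le_of_mul_le_mul_left ?_ h0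
    linarith

theorem norm_auxSol_le (h : BilevelRegular f g L μ) (hμ : 0 < μ)
    (hb : ∀ x, ‖grad2 f x (lowerSol g x)‖ ≤ L) (x : Vec d) : ‖h.auxSol hμ x‖ ≤ L / μ := by
  refine (norm_le_of_coercive hμ (h.coercive x (lowerSol g x) _)).trans ?_
  rw [auxSol_spec]
  gcongr
  exact hb x

/-- Both lower-level gradients vanish, so strong monotonicity at x bounds the distance by ‖∇₂g(x',
y⋆(x')) - ∇₂g(x, y⋆(x'))‖/μ. -/
theorem lip_lowerSol (h : BilevelRegular f g L μ) (hμ : 0 < μ) (x x' : Vec d) :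
    ‖lowerSol g x - lowerSol g x'‖ ≤ L / μ * ‖x - x'‖ := by
  refine (norm_le_of_coercive hμ (h.mono x _ _)).trans ?_
  rw [h.grad2_lowerSol hμ x, ← h.grad2_lowerSol hμ x', div_mul_eq_mul_div]
  gcongr
  refine ((norm_grad2_sub_le h.diff_g _ _ _ _).trans (h.lip_grad_g _ _)).trans_eq ?_
  rw [pt_sub, sub_self, norm_sub_rev x x']
  congr 1
  simp

theorem norm_graph_sub_sq_le (h : BilevelRegular f g L μ) (hμ : 0 < μ) (hκ : 1 ≤ L / μ)
    (x x' : Vec d) :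
    ‖pt x (lowerSol g x) - pt x' (lowerSol g x')‖ ^ 2 ≤ 2 * (L / μ) ^ 2 * ‖x - x'‖ ^ 2 := by
  rw [norm_pt_sub_sq]
  have h3 := pow_le_pow_left₀ (norm_nonneg _) (h.lip_lowerSol hμ x x') 2
  have h4 : 1 * ‖x - x'‖ ≤ L / μ * ‖x - x'‖ := by gcongr
  have h5 := pow_le_pow_left₀ (by positivity) h4 2
  rw [mul_pow] at h3 h5
  linarith

theorem norm_graph_sub_le (h : BilevelRegular f g L μ) (hμ : 0 < μ) (hκ : 1 ≤ L / μ)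
    (x x' : Vec d) :
    ‖pt x (lowerSol g x) - pt x' (lowerSol g x')‖ ≤ 2 * (L / μ) * ‖x - x'‖ := by
  refine le_of_sq_le_sq ((h.norm_graph_sub_sq_le hμ hκ x x').trans ?_) (by positivity)
  nlinarith [sq_nonneg (L / μ * ‖x - x'‖)]

/-- Perturbation of a linear system: the residual of z⋆(x') in the equation at x is the change of
∇₂f minus the change of ∇²₂₂g applied to z⋆(x'), whose norm is at most κ. Hence the residual is at
most 2LκD with D ≤ 2κ‖x - x'‖, and inverting the operator costs 1/μ. -/
theorem lip_auxSol (h : BilevelRegular f g L μ) (hμ : 0 < μ) (hκ : 1 ≤ L / μ)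
    (hb : ∀ x, ‖grad2 f x (lowerSol g x)‖ ≤ L) (x x' : Vec d) :
    ‖h.auxSol hμ x - h.auxSol hμ x'‖ ≤ 4 * (L / μ) ^ 3 * ‖x - x'‖ := by
  have hL : 0 ≤ L := (norm_nonneg _).trans (hb x)
  refine (norm_le_of_coercive hμ (h.coercive x (lowerSol g x) _)).trans ?_
  rw [map_sub, auxSol_spec]
  set D := ‖pt x (lowerSol g x) - pt x' (lowerSol g x')‖
  have hD : D ≤ 2 * (L / μ) * ‖x - x'‖ := h.norm_graph_sub_le hμ hκ x x'
  have e : grad2 f x (lowerSol g x) - hess22 g x (lowerSol g x) (h.auxSol hμ x') =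
      (grad2 f x (lowerSol g x) - grad2 f x' (lowerSol g x')) -
        (hess22 g x (lowerSol g x) - hess22 g x' (lowerSol g x')) (h.auxSol hμ x') := by
    rw [sub_apply, auxSol_spec]; abel
  have h1 : ‖grad2 f x (lowerSol g x) - grad2 f x' (lowerSol g x')‖ ≤ L * D :=
    (norm_grad2_sub_le h.diff_f _ _ _ _).trans (h.lip_grad_f _ _)
  have h2 : ‖(hess22 g x (lowerSol g x) - hess22 g x' (lowerSol g x')) (h.auxSol hμ x')‖ ≤
      L * D * (L / μ) := by
    refine (ContinuousLinearMap.le_opNorm _ _).trans ?_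
    gcongr
    · exact (norm_hess22_sub_le h.diff_g h.diff_grad_g _ _ _ _).trans (h.lip_hess_g _ _)
    · exact h.norm_auxSol_le hμ hb x'
  have h3 : ‖grad2 f x (lowerSol g x) - hess22 g x (lowerSol g x) (h.auxSol hμ x')‖ ≤
      4 * L * (L / μ) ^ 2 * ‖x - x'‖ := by
    rw [e]
    refine (norm_sub_le _ _).trans ((add_le_add h1 h2).trans ?_)
    have hD0 : 0 ≤ D := norm_nonneg _
    calc L * D + L * D * (L / μ) ≤ L * D * (L / μ) + L * D * (L / μ) := by
          have : L * D ≤ L * D * (L / μ) := le_mul_of_one_le_right (by positivity) hκ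
          linarith
      _ = 2 * L * (L / μ) * D := by ring
      _ ≤ 2 * L * (L / μ) * (2 * (L / μ) * ‖x - x'‖) := by gcongr
      _ = _ := by ring
  calc _ ≤ 4 * L * (L / μ) ^ 2 * ‖x - x'‖ / μ := by gcongr
    _ = _ := by ring

theorem lip_objGrad (h : BilevelRegular f g L μ) (hμ : 0 < μ) (hκ : 1 ≤ L / μ)
    (hb : ∀ x, ‖grad2 f x (lowerSol g x)‖ ≤ L) (x x' : Vec d) :
    ‖h.objGrad hμ x - h.objGrad hμ x'‖ ≤ 8 * L * (L / μ) ^ 3 * ‖x - x'‖ := by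
  have hL : 0 ≤ L := (norm_nonneg _).trans (hb x)
  set D := ‖pt x (lowerSol g x) - pt x' (lowerSol g x')‖
  have hD : D ≤ 2 * (L / μ) * ‖x - x'‖ := h.norm_graph_sub_le hμ hκ x x'
  have e : h.objGrad hμ x - h.objGrad hμ x' =
      (grad1 f x (lowerSol g x) - grad1 f x' (lowerSol g x')) -
        hess12 g x (lowerSol g x) (h.auxSol hμ x - h.auxSol hμ x') -
        (hess12 g x (lowerSol g x) - hess12 g x' (lowerSol g x')) (h.auxSol hμ x') := by
    simp only [objGrad, sub_apply, map_sub]; abel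
  have h1 : ‖grad1 f x (lowerSol g x) - grad1 f x' (lowerSol g x')‖ ≤ L * D :=
    (norm_grad1_sub_le h.diff_f _ _ _ _).trans (h.lip_grad_f _ _)
  have h2 : ‖(hess12 g x (lowerSol g x) - hess12 g x' (lowerSol g x')) (h.auxSol hμ x')‖ ≤
      L * D * (L / μ) := by
    refine (ContinuousLinearMap.le_opNorm _ _).trans ?_
    gcongr
    · exact (norm_hess12_sub_le h.diff_g h.diff_grad_g _ _ _ _).trans (h.lip_hess_g _ _)
    · exact h.norm_auxSol_le hμ hb x'
  have h3 : ‖hess12 g x (lowerSol g x) (h.auxSol hμ x - h.auxSol hμ x')‖ ≤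
      L * (4 * (L / μ) ^ 3 * ‖x - x'‖) := by
    refine (ContinuousLinearMap.le_opNorm _ _).trans ?_
    gcongr
    · rw [hess12_eq h.diff_g h.diff_grad_g]
      exact (norm_fst_comp_inrL_le _).trans (norm_fullHess_le hL h.lip_grad_g _)
    · exact h.lip_auxSol hμ hκ hb x x'
  rw [e]
  refine (norm_sub_le _ _).trans ((add_le_add ((norm_sub_le _ _).trans (add_le_add h1 h3)) h2).trans
    ?_)
  set κ := L / μ
  have hκ2 : κ ≤ κ ^ 2 := by nlinarith
  have hκ3 : κ ^ 2 ≤ κ ^ 3 := by nlinarith [sq_nonneg κ]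
  have hx := norm_nonneg (x - x')
  calc L * D + L * (4 * κ ^ 3 * ‖x - x'‖) + L * D * κ
      ≤ L * (2 * κ * ‖x - x'‖) + L * (4 * κ ^ 3 * ‖x - x'‖) + L * (2 * κ * ‖x - x'‖) * κ := by
        gcongr
    _ = L * ‖x - x'‖ * (2 * κ + 4 * κ ^ 3 + 2 * κ ^ 2) := by ring
    _ ≤ L * ‖x - x'‖ * (8 * κ ^ 3) := by gcongr; linarith
    _ = _ := by ring

/-- Differentiability of y⋆ is not needed. The expansion of f along the graph of y⋆ contains ⟨∇₂f,
y' - y⟩. Since ∇₂g vanishes at both graph points, the expansion of ∇g tested against (0, z⋆), with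
symmetry of the Hessian, shows that ⟨∇²₁₂g z⋆, x' - x⟩ + ⟨∇²₂₂g z⋆, y' - y⟩ is of second order. As
∇²₂₂g z⋆ = ∇₂f, this trades the y-term for an x-term. The remainders are at most 2LκD² with D² ≤
2κ²‖x' - x‖². -/
theorem descent (h : BilevelRegular f g L μ) (hμ : 0 < μ) (hκ : 1 ≤ L / μ)
    (hb : ∀ x, ‖grad2 f x (lowerSol g x)‖ ≤ L) (x x' : Vec d) :
    hyperObj f g x' ≤ hyperObj f g x + inner ℝ (h.objGrad hμ x) (x' - x) +
      4 * L * (L / μ) ^ 3 * ‖x' - x‖ ^ 2 := by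
  have hL : 0 ≤ L := (norm_nonneg _).trans (hb x)
  set y := lowerSol g x with hy
  set y' := lowerSol g x' with hy'
  set z := h.auxSol hμ x
  have hD : ‖pt x' y' - pt x y‖ ^ 2 ≤ 2 * (L / μ) ^ 2 * ‖x' - x‖ ^ 2 :=
    h.norm_graph_sub_sq_le hμ hκ x' x
  set D := ‖pt x' y' - pt x y‖
  have hf : f x' y' - f x y - (inner ℝ (grad1 f x y) (x' - x) + inner ℝ (grad2 f x y) (y' - y)) ≤
      L * D ^ 2 := by
    have h1 := norm_taylor_le hL (fun u => (hasGradientAt_joint h.diff_f u).hasFDerivAt)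
      (fun u v => by rw [← map_sub, LinearIsometryEquiv.norm_map]; exact h.lip_grad_f u v)
      (pt x y) (pt x' y')
    rw [← inner_pt, pt_grad h.diff_f]
    exact (Real.le_norm_self _).trans h1
  have hg : inner ℝ (hess12 g x y z) (x' - x) + inner ℝ (hess22 g x y z) (y' - y) ≤
      L / μ * (L * D ^ 2) := by
    have h1 := norm_taylor_le hL (fun u => (h.diff_grad_g u).hasFDerivAt) h.lip_hess_g
      (pt x y) (pt x' y')
    change ‖_ - _ - fullHess g (pt x y) _‖ ≤ L * D ^ 2 at h1
    have h2 : inner ℝ (pt 0 z) (fullGrad g (pt x' y') - fullGrad g (pt x y)) = 0 := by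
      rw [← pt_grad h.diff_g, ← pt_grad h.diff_g, pt_sub, inner_pt, h.grad2_lowerSol hμ x,
        h.grad2_lowerSol hμ x']
      simp
    have h3 : inner ℝ (hess12 g x y z) (x' - x) + inner ℝ (hess22 g x y z) (y' - y) =
        -inner ℝ (pt 0 z) (fullGrad g (pt x' y') - fullGrad g (pt x y) -
          fullHess g (pt x y) (pt x' y' - pt x y)) := by
      rw [inner_sub_right (pt (0 : Vec d) z) (_ - _) _, h2, zero_sub, neg_neg, ← fullHess_symm h.diff_g h.diff_grad_g,
        fullHess_inrL h.diff_g h.diff_grad_g, pt_sub x' x y' y, inner_pt]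
    rw [h3, ← inner_neg_left]
    refine (real_inner_le_norm _ _).trans ?_
    rw [norm_neg]
    have h4 : ‖pt (0 : Vec d) z‖ = ‖z‖ := norm_inrL_apply (d := d) z
    rw [h4]
    gcongr
    exact h.norm_auxSol_le hμ hb x
  have hs : hess22 g x y z = grad2 f x y := h.auxSol_spec hμ x
  rw [hs] at hg
  have hDD : L / μ * (L * D ^ 2) + L * D ^ 2 ≤ 4 * L * (L / μ) ^ 3 * ‖x' - x‖ ^ 2 := by
    have h1 : L * D ^ 2 ≤ L / μ * (L * D ^ 2) := le_mul_of_one_le_left (by positivity) hκ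
    calc L / μ * (L * D ^ 2) + L * D ^ 2 ≤ 2 * L * (L / μ) * D ^ 2 := by linarith
      _ ≤ 2 * L * (L / μ) * (2 * (L / μ) ^ 2 * ‖x' - x‖ ^ 2) := by gcongr
      _ = _ := by ring
  have e : inner ℝ (h.objGrad hμ x) (x' - x) =
      inner ℝ (grad1 f x y) (x' - x) - inner ℝ (hess12 g x y z) (x' - x) := inner_sub_left _ _ _
  rw [e]
  change f x' y' ≤ f x y + _ + _
  linarith

theorem continuous_lowerSol (h : BilevelRegular f g L μ) (hL : 0 ≤ L) (hμ : 0 < μ) :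
    Continuous (lowerSol g) :=
  (LipschitzWith.of_dist_le_mul (K := (L / μ).toNNReal) fun x x' => by
    rw [Real.coe_toNNReal _ (by positivity), dist_eq_norm, dist_eq_norm]
    exact h.lip_lowerSol hμ x x').continuous

theorem continuous_hyperObj (h : BilevelRegular f g L μ) (hL : 0 ≤ L) (hμ : 0 < μ) :
    Continuous (hyperObj f g) := by
  have h1 : Continuous fun x => pt x (lowerSol g x) :=
    (WithLp.prod_continuous_toLp 2 (Vec d) (Vec p)).comp
      (continuous_id.prodMk (h.continuous_lowerSol hL hμ))
  exact (continuous_of_differentiable h.diff_f).comp h1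

end BilevelRegular

end Bilevel

/-! ### Derivatives of the averaged losses -/

section Average

variable {N d p : ℕ}

theorem norm_nodeAvg_le {V : Type*} [NormedAddCommGroup V] [NormedSpace ℝ V] (v : Fin N → V) :
    ‖nodeAvg v‖ ≤ nodeAvg fun i => ‖v i‖ := by
  unfold nodeAvg
  rw [norm_smul, Real.norm_of_nonneg (by positivity), smul_eq_mul]
  gcongr
  exact norm_sum_le _ _

theorem norm_nodeAvg_sub_le {V : Type*} [NormedAddCommGroup V] [NormedSpace ℝ V] (hN : 1 ≤ N)
    {v w : Fin N → V} {c : ℝ} (h : ∀ i, ‖v i - w i‖ ≤ c) : ‖nodeAvg v - nodeAvg w‖ ≤ c := by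
  rw [← nodeAvg_sub]
  exact (norm_nodeAvg_le _).trans (nodeAvg_le_const hN h)

theorem hasFDerivAt_nodeAvg {E F : Type*} [NormedAddCommGroup E] [NormedSpace ℝ E]
    [NormedAddCommGroup F] [NormedSpace ℝ F] {k : Fin N → E → F} {k' : Fin N → E →L[ℝ] F} {u : E}
    (h : ∀ i, HasFDerivAt (k i) (k' i) u) :
    HasFDerivAt (fun u => nodeAvg fun i => k i u) (nodeAvg k') u :=
  (HasFDerivAt.fun_sum fun i _ => h i).const_smul (N : ℝ)⁻¹

/-- `HasFDerivAt.fderiv`, stated for normed spaces for the same reason as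
`continuous_of_differentiable`. -/
theorem fderiv_eq_of_hasFDerivAt {E F : Type*} [NormedAddCommGroup E] [NormedSpace ℝ E]
    [NormedAddCommGroup F] [NormedSpace ℝ F] {k : E → F} {k' : E →L[ℝ] F} {u : E}
    (h : HasFDerivAt k k' u) : fderiv ℝ k u = k' := h.fderiv

theorem hasGradientAt_nodeAvg {E : Type*} [NormedAddCommGroup E] [InnerProductSpace ℝ E]
    [CompleteSpace E] {k : Fin N → E → ℝ} {g : Fin N → E} {u : E}
    (h : ∀ i, HasGradientAt (k i) (g i) u) :
    HasGradientAt (fun u => nodeAvg fun i => k i u) (nodeAvg g) u := by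
  rw [hasGradientAt_iff_hasFDerivAt]
  refine (hasFDerivAt_nodeAvg fun i => (h i).hasFDerivAt).congr_fderiv ?_
  simp [nodeAvg, map_sum, map_smul]

variable {f : Fin N → Vec d → Vec p → ℝ}

theorem differentiable_joint_globalLoss (hf : ∀ i, Differentiable ℝ (joint (f i))) :
    Differentiable ℝ (joint (globalLoss f)) := fun u =>
  (hasGradientAt_nodeAvg fun i => hasGradientAt_joint (hf i) u).differentiableAt

theorem fullGrad_globalLoss (hf : ∀ i, Differentiable ℝ (joint (f i))) :
    fullGrad (globalLoss f) = fun u => nodeAvg fun i => fullGrad (f i) u :=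
  funext fun u => (hasGradientAt_nodeAvg fun i => hasGradientAt_joint (hf i) u).gradient

theorem grad2_globalLoss (hf : ∀ i, Differentiable ℝ (joint (f i))) (x : Vec d) (y : Vec p) :
    grad2 (globalLoss f) x y = nodeAvg fun i => grad2 (f i) x y := by
  simp only [grad2_eq (hf _)]
  exact (hasGradientAt_nodeAvg fun i => hasGradientAt_snd (hf i) x y).gradient

theorem grad1_globalLoss (hf : ∀ i, Differentiable ℝ (joint (f i))) (x : Vec d) (y : Vec p) :
    grad1 (globalLoss f) x y = nodeAvg fun i => grad1 (f i) x y := by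
  simp only [grad1_eq (hf _)]
  exact (hasGradientAt_nodeAvg fun i => hasGradientAt_fst (hf i) x y).gradient

theorem hasFDerivAt_fullGrad_globalLoss (hf : ∀ i, Differentiable ℝ (joint (f i)))
    (hf' : ∀ i, Differentiable ℝ (fullGrad (f i))) (u : WithLp 2 (Vec d × Vec p)) :
    HasFDerivAt (fullGrad (globalLoss f)) (nodeAvg fun i => fullHess (f i) u) u := by
  rw [fullGrad_globalLoss hf]
  exact hasFDerivAt_nodeAvg fun i => (hf' i u).hasFDerivAt

theorem fullHess_globalLoss (hf : ∀ i, Differentiable ℝ (joint (f i)))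
    (hf' : ∀ i, Differentiable ℝ (fullGrad (f i))) (u : WithLp 2 (Vec d × Vec p)) :
    fullHess (globalLoss f) u = nodeAvg fun i => fullHess (f i) u :=
  fderiv_eq_of_hasFDerivAt (hasFDerivAt_fullGrad_globalLoss hf hf' u)

theorem hess12_globalLoss (hf : ∀ i, Differentiable ℝ (joint (f i)))
    (hf' : ∀ i, Differentiable ℝ (fullGrad (f i))) (x : Vec d) (y : Vec p) :
    hess12 (globalLoss f) x y = nodeAvg fun i => hess12 (f i) x y := by
  have e : grad1 (globalLoss f) x = fun y => nodeAvg fun i => grad1 (f i) x y :=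
    funext fun y => grad1_globalLoss hf x y
  simp only [hess12_eq (hf _) (hf' _)]
  change fderiv ℝ (grad1 (globalLoss f) x) y = _
  rw [e]
  exact (hasFDerivAt_nodeAvg fun i => hasFDerivAt_grad1 (hf i) (hf' i) x y).fderiv

theorem hess22_globalLoss (hf : ∀ i, Differentiable ℝ (joint (f i)))
    (hf' : ∀ i, Differentiable ℝ (fullGrad (f i))) (x : Vec d) (y : Vec p) :
    hess22 (globalLoss f) x y = nodeAvg fun i => hess22 (f i) x y := by
  have e : grad2 (globalLoss f) x = fun y => nodeAvg fun i => grad2 (f i) x y :=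
    funext fun y => grad2_globalLoss hf x y
  simp only [hess22_eq (hf _) (hf' _)]
  change fderiv ℝ (grad2 (globalLoss f) x) y = _
  rw [e]
  exact (hasFDerivAt_nodeAvg fun i => hasFDerivAt_grad2 (hf i) (hf' i) x y).fderiv

theorem strongConvexOn_globalLoss (hN : 1 ≤ N) {μ : ℝ} {x : Vec d}
    (h : ∀ i, StrongConvexOn Set.univ μ (f i x)) :
    StrongConvexOn Set.univ μ (globalLoss f x) := by
  refine ⟨convex_univ, fun y hy y' hy' a b ha hb hab => ?_⟩
  refine (nodeAvg_mono fun i => (h i).2 hy hy' ha hb hab).trans_eq ?_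
  rw [nodeAvg_sub, nodeAvg_const hN, nodeAvg_add, nodeAvg_smul, nodeAvg_smul]
  rfl

end Average

/-! ### The landscape of the given problem -/

section Construction

variable {N d p : ℕ} {f g : Fin N → Vec d → Vec p → ℝ} {Lgf Lgg Lhg Lf μ L κ b b₁ b₂ : ℝ}

theorem Smoothness.mono (h : Smoothness f g Lgf Lgg Lhg Lf μ) (h1 : Lgf ≤ L) (h2 : Lgg ≤ L)
    (h3 : Lhg ≤ L) (h4 : Lf ≤ L) : Smoothness f g L L L L μ where
  diff_f := h.diff_f
  diff_g := h.diff_g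
  diff_grad_g := h.diff_grad_g
  lip_grad_f i u v := (h.lip_grad_f i u v).trans (by gcongr)
  lip_grad_g i u v := (h.lip_grad_g i u v).trans (by gcongr)
  lip_hess_g i u v := (h.lip_hess_g i u v).trans (by gcongr)
  bound_grad2_f i x := (h.bound_grad2_f i x).trans h4
  strong_convex := h.strong_convex

theorem Smoothness.local (h : Smoothness f g L L L L μ) (i : Fin N) :
    BilevelRegular (f i) (g i) L μ where
  diff_f := h.diff_f i
  diff_g := h.diff_g i
  diff_grad_g := h.diff_grad_g i
  lip_grad_f := h.lip_grad_f i
  lip_grad_g := h.lip_grad_g i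
  lip_hess_g := h.lip_hess_g i
  strong_convex := h.strong_convex i

theorem Smoothness.global (hN : 1 ≤ N) (h : Smoothness f g L L L L μ) :
    BilevelRegular (globalLoss f) (globalLoss g) L μ where
  diff_f := differentiable_joint_globalLoss h.diff_f
  diff_g := differentiable_joint_globalLoss h.diff_g
  diff_grad_g u := (hasFDerivAt_fullGrad_globalLoss h.diff_g h.diff_grad_g u).differentiableAt
  lip_grad_f u v := by
    rw [fullGrad_globalLoss h.diff_f]
    exact norm_nodeAvg_sub_le hN fun i => h.lip_grad_f i u v
  lip_grad_g u v := by
    rw [fullGrad_globalLoss h.diff_g]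
    exact norm_nodeAvg_sub_le hN fun i => h.lip_grad_g i u v
  lip_hess_g u v := by
    rw [fullHess_globalLoss h.diff_g h.diff_grad_g, fullHess_globalLoss h.diff_g h.diff_grad_g]
    exact norm_nodeAvg_sub_le hN fun i => h.lip_hess_g i u v
  strong_convex x := strongConvexOn_globalLoss hN fun i => h.strong_convex i x

theorem Smoothness.norm_grad2_globalLoss_le (hN : 1 ≤ N) (h : Smoothness f g L L L L μ)
    (x : Vec d) : ‖grad2 (globalLoss f) x (lowerSol (globalLoss g) x)‖ ≤ L := by
  rw [grad2_globalLoss h.diff_f]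
  exact (norm_nodeAvg_le _).trans (nodeAvg_le_const hN fun i => h.bound_grad2_f i x)

theorem nodeAvg_norm_apply_sub_sq_le {V : Type*} [NormedAddCommGroup V] [InnerProductSpace ℝ V]
    (hκ : 1 ≤ κ) {K : Fin N → Vec p →L[ℝ] V} {K' : Vec p →L[ℝ] V} {a : Fin N → V} {a' : V}
    {z : Vec p} (hz : ‖z‖ ≤ κ) (hK : nodeAvg (fun i => ‖K i - K'‖ ^ 2) ≤ b ^ 2)
    (ha : nodeAvg (fun i => ‖a i - a'‖ ^ 2) ≤ b ^ 2) :
    nodeAvg (fun i => ‖K i z - a i - (K' z - a')‖ ^ 2) ≤ 4 * κ ^ 2 * b ^ 2 := by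
  have h : ∀ i, ‖K i z - a i - (K' z - a')‖ ^ 2 ≤
      2 * κ ^ 2 * ‖K i - K'‖ ^ 2 + 2 * ‖a i - a'‖ ^ 2 := fun i => by
    have e : K i z - a i - (K' z - a') = (K i - K') z - (a i - a') := by
      rw [sub_apply]; abel
    rw [e]
    have h1 : ‖(K i - K') z‖ ^ 2 ≤ κ ^ 2 * ‖K i - K'‖ ^ 2 := by
      rw [← mul_pow, mul_comm κ]
      gcongr
      exact ((K i - K').le_opNorm z).trans (by gcongr)
    linarith [norm_sub_sq_le_two ((K i - K') z) (a i - a')]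
  refine (nodeAvg_mono h).trans ?_
  rw [nodeAvg_add, nodeAvg_mul, nodeAvg_mul]
  have h2 : b ^ 2 ≤ κ ^ 2 * b ^ 2 := le_mul_of_one_le_left (sq_nonneg b) (one_le_pow₀ hκ)
  have h3 := mul_le_mul_of_nonneg_left hK (sq_nonneg κ)
  linarith

/-- The bilevel problem of the averaged losses, as seen by the analysis of the algorithm. -/
noncomputable def Smoothness.landscape (hN : 1 ≤ N) (hμ : 0 < μ) (hκ : κ = L / μ) (hκ1 : 1 ≤ κ)
    (h : Smoothness f g L L L L μ) (hd : Dissimilarity f g b₁ b₂) (hb₁ : 0 ≤ b₁) (hb₂ : 0 ≤ b₂)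
    (hb : b = max b₁ b₂) : Landscape N d p L κ b :=
  have hκ' : 1 ≤ L / μ := hκ ▸ hκ1
  have hL : 0 < L := by
    have := (le_div_iff₀ hμ).1 hκ'
    linarith
  have hLκ : L / κ = μ := by rw [hκ]; field_simp
  have hG := h.global hN
  have hbd := h.norm_grad2_globalLoss_le hN
  have hbb₁ : b₁ ^ 2 ≤ b ^ 2 := pow_le_pow_left₀ hb₁ (hb ▸ le_max_left _ _) 2
  have hbb₂ : b₂ ^ 2 ≤ b ^ 2 := pow_le_pow_left₀ hb₂ (hb ▸ le_max_right _ _) 2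
  have hz : ∀ x, ‖hG.auxSol hμ x‖ ≤ κ := fun x => hκ ▸ hG.norm_auxSol_le hμ hbd x
  { a₁ := fun i => grad1 (f i)
    a₂ := fun i => grad2 (f i)
    g₂ := fun i => grad2 (g i)
    J := fun i => hess12 (g i)
    H := fun i => hess22 (g i)
    yStar := lowerSol (globalLoss g)
    zStar := hG.auxSol hμ
    obj := hyperObj (globalLoss f) (globalLoss g)
    objGrad := hG.objGrad hμ
    lip_a₁ := fun i x y x' y' => sq_le_of_le_mul_norm_pt (norm_nonneg _)
      ((norm_grad1_sub_le (h.diff_f i) _ _ _ _).trans (h.lip_grad_f i _ _))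
    lip_a₂ := fun i x y x' y' => sq_le_of_le_mul_norm_pt (norm_nonneg _)
      ((norm_grad2_sub_le (h.diff_f i) _ _ _ _).trans (h.lip_grad_f i _ _))
    lip_g₂ := fun i x y x' y' => sq_le_of_le_mul_norm_pt (norm_nonneg _)
      ((norm_grad2_sub_le (h.diff_g i) _ _ _ _).trans (h.lip_grad_g i _ _))
    lip_J := fun i x y x' y' => sq_le_of_le_mul_norm_pt (norm_nonneg _)
      ((norm_hess12_sub_le (h.diff_g i) (h.diff_grad_g i) _ _ _ _).trans (h.lip_hess_g i _ _))
    lip_H := fun i x y x' y' => sq_le_of_le_mul_norm_pt (norm_nonneg _)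
      ((norm_hess22_sub_le (h.diff_g i) (h.diff_grad_g i) _ _ _ _).trans (h.lip_hess_g i _ _))
    norm_J := fun i x y => by
      rw [hess12_eq (h.diff_g i) (h.diff_grad_g i)]
      exact (norm_fst_comp_inrL_le _).trans (norm_fullHess_le hL.le (h.lip_grad_g i) _)
    norm_H := fun i x y => by
      rw [hess22_eq (h.diff_g i) (h.diff_grad_g i)]
      exact (norm_snd_comp_inrL_le _).trans (norm_fullHess_le hL.le (h.lip_grad_g i) _)
    coercive_H := fun i x y z => hLκ.symm ▸ (h.local i).coercive x y z
    mono_g₂ := fun i x y y' => hLκ.symm ▸ (h.local i).mono x y y'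
    g₂_yStar := fun x => by
      rw [← grad2_globalLoss h.diff_g]; exact hG.grad2_lowerSol hμ x
    H_zStar := fun x => by
      have h1 := hG.auxSol_spec hμ x
      rw [grad2_globalLoss h.diff_f, hess22_globalLoss h.diff_g h.diff_grad_g] at h1
      rw [nodeAvg_sub, ← h1, sub_eq_zero]
      exact (map_nodeAvg (ContinuousLinearMap.apply ℝ (Vec p) (hG.auxSol hμ x)).toLinearMap
        (fun i => hess22 (g i) x (lowerSol (globalLoss g) x))).symm
    objGrad_eq := fun x => by
      rw [BilevelRegular.objGrad, grad1_globalLoss h.diff_f,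
        hess12_globalLoss h.diff_g h.diff_grad_g, nodeAvg_sub]
      congr 1
      exact map_nodeAvg (ContinuousLinearMap.apply ℝ (Vec d) (hG.auxSol hμ x)).toLinearMap
        (fun i => hess12 (g i) x (lowerSol (globalLoss g) x))
    norm_zStar := hz
    lip_yStar := fun x x' => hκ ▸ hG.lip_lowerSol hμ x x'
    lip_zStar := fun x x' => hκ ▸ hG.lip_auxSol hμ hκ' hbd x x'
    lip_objGrad := fun x x' => hκ ▸ hG.lip_objGrad hμ hκ' hbd x x'
    descent := fun x x' => hκ ▸ hG.descent hμ hκ' hbd x x'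
    cont_obj := hG.continuous_hyperObj hL.le hμ
    het_g₂ := fun x => by
      have h1 := hd.grad2_g x (lowerSol (globalLoss g) x)
      rw [hG.grad2_lowerSol hμ] at h1
      simp only [sub_zero] at h1
      exact h1.trans hbb₂
    het_aux := fun x => by
      have h1 := nodeAvg_norm_apply_sub_sq_le hκ1 (hz x)
        ((hd.hess22_g x (lowerSol (globalLoss g) x)).trans hbb₂)
        ((hd.grad2_f x (lowerSol (globalLoss g) x)).trans hbb₁)
      rw [hG.auxSol_spec, sub_self] at h1
      simpa only [sub_zero] using h1
    het_obj := fun x => by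
      have h1 := nodeAvg_norm_apply_sub_sq_le hκ1 (hz x)
        ((hd.hess12_g x (lowerSol (globalLoss g) x)).trans hbb₂)
        ((hd.grad1_f x (lowerSol (globalLoss g) x)).trans hbb₁)
      refine le_trans (le_of_eq ?_) h1
      congr 1
      funext i
      rw [← norm_neg, BilevelRegular.objGrad]
      congr 2
      abel }

end Construction

/-! ### Oracles for Hessian-vector products -/

section Oracles

variable {Z : Type*} [MeasurableSpace Z] {D : Measure Z} [IsProbabilityMeasure D] {n p : ℕ}

theorem UnbiasedOracle.hasMeanVar {o : Z → Vec n} {v : Vec n} {σ : ℝ}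
    (h : UnbiasedOracle D o v σ) : HasMeanVar D o v (σ ^ 2) := ⟨h.1, h.2.1, h.2.2.1, h.2.2.2⟩

theorem UnbiasedOracle.hasMeanVar_apply {o : Z → Vec p →L[ℝ] Vec n} {v : Vec p →L[ℝ] Vec n}
    {σ : ℝ} (h : UnbiasedOracle D o v σ) (z : Vec p) :
    HasMeanVar D (fun s => o s z) (v z) (σ ^ 2 * ‖z‖ ^ 2) := by
  have hi : Integrable (fun s => o s z) D := h.1.apply_continuousLinearMap z
  have hb : ∀ s, ‖o s z - v z‖ ^ 2 ≤ ‖o s - v‖ ^ 2 * ‖z‖ ^ 2 := fun s => by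
    rw [← mul_pow, ← sub_apply]
    gcongr
    exact (o s - v).le_opNorm z
  have hsq : Integrable (fun s => ‖o s z - v z‖ ^ 2) D := by
    refine (h.2.2.1.mul_const (‖z‖ ^ 2)).mono'
      ((hi.aestronglyMeasurable.sub aestronglyMeasurable_const).norm.pow 2)
      (Filter.Eventually.of_forall fun s => ?_)
    rw [Real.norm_of_nonneg (by positivity)]
    exact hb s
  refine ⟨hi, ?_, hsq, ?_⟩
  · rw [← ContinuousLinearMap.integral_apply h.1, h.2.1]
  · refine (integral_mono hsq (h.2.2.1.mul_const (‖z‖ ^ 2)) hb).trans ?_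
    rw [integral_mul_const]
    exact mul_le_mul_of_nonneg_right h.2.2.2 (sq_nonneg _)

theorem norm_integral_sq_le {X : Z → Vec n} (hX : Integrable X D)
    (hX2 : Integrable (fun s => ‖X s‖ ^ 2) D) : ‖∫ s, X s ∂D‖ ^ 2 ≤ ∫ s, ‖X s‖ ^ 2 ∂D := by
  have hsq : Integrable (fun s => ‖X s - ∫ s, X s ∂D‖ ^ 2) D := by
    refine ((hX2.const_mul 2).add (integrable_const (2 * ‖∫ s, X s ∂D‖ ^ 2))).mono'
      ((hX.aestronglyMeasurable.sub aestronglyMeasurable_const).norm.pow 2)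
      (Filter.Eventually.of_forall fun s => ?_)
    rw [Real.norm_of_nonneg (by positivity)]
    exact norm_sub_sq_le_two _ _
  have h : HasMeanVar D X (∫ s, X s ∂D) _ := ⟨hX, rfl, hsq, le_rfl⟩
  rw [h.norm_sq_eq.2]
  exact le_add_of_nonneg_right (integral_nonneg fun s => by positivity)

/-- A central difference quotient of `k` is the average of its derivative along a segment, so that
it inherits the variance of an oracle for the derivative. -/
theorem hasMeanVar_centralDiff {k : Z → Vec p → Vec n} {K : Z → Vec p → Vec p →L[ℝ] Vec n}
    {K' : Vec p → Vec p →L[ℝ] Vec n} {σ Lh : ℝ} (hLh : 0 ≤ Lh)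
    (hk : ∀ s y, HasFDerivAt (k s) (K s y) y)
    (hmeas : Measurable fun q : Z × Vec p => K q.1 q.2)
    (ho : ∀ y, UnbiasedOracle D (fun s => K s y) (K' y) σ)
    (hlip : ∀ y y', ‖K' y - K' y'‖ ≤ Lh * ‖y - y'‖) (y z : Vec p) {δ : ℝ} (hδ : 0 < δ) :
    ∃ m, ‖m - K' y z‖ ≤ Lh * δ * ‖z‖ ^ 2 ∧
      HasMeanVar D (fun s => (2 * δ)⁻¹ • (k s (y + δ • z) - k s (y - δ • z))) m
        (σ ^ 2 * ‖z‖ ^ 2) := by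
  -- The position on the segment from y - δz to y + δz is treated as a uniform random variable r, so
  -- that bias and variance become statements about the product of `D` and `ν`.
  set ν : Measure ℝ := volume.restrict (Set.Ioc 0 1) with hν
  have : IsProbabilityMeasure ν := ⟨by simp [hν]⟩
  set c : ℝ → Vec p := fun r => y + ((2 * r - 1) * δ) • z with hc
  have hcc : Continuous c := by fun_prop
  have hK' : Continuous K' := by
    refine (LipschitzWith.of_dist_le_mul (K := Lh.toNNReal) fun u v => ?_).continuous
    rw [Real.coe_toNNReal _ hLh, dist_eq_norm, dist_eq_norm]
    exact hlip u v
  set m : ℝ → Vec n := fun r => K' (c r) z with hm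
  have hmc : Continuous m := (hK'.comp hcc).clm_apply continuous_const
  set Y : Z × ℝ → Vec n := fun q => K q.1 (c q.2) z with hY
  have hYm : Measurable Y :=
    (ContinuousLinearMap.apply ℝ (Vec n) z).continuous.measurable.comp
      (hmeas.comp (measurable_fst.prodMk (hcc.measurable.comp measurable_snd)))
  have hslice : ∀ r, HasMeanVar D (fun s => Y (s, r)) (m r) (σ ^ 2 * ‖z‖ ^ 2) :=
    fun r => (ho (c r)).hasMeanVar_apply z
  set B : Z × ℝ → ℝ := fun q => ‖Y q - m q.2‖ ^ 2 with hB
  have hBm : Measurable B :=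
    ((hYm.sub (hmc.measurable.comp measurable_snd)).norm.pow_const 2)
  have hBint : Integrable B (D.prod ν) := by
    rw [integrable_prod_iff' hBm.aestronglyMeasurable]
    refine ⟨Filter.Eventually.of_forall fun r => (hslice r).int_sq, ?_⟩
    refine Integrable.of_bound (C := σ ^ 2 * ‖z‖ ^ 2)
      (hBm.norm.stronglyMeasurable.integral_prod_left').aestronglyMeasurable
      (Filter.Eventually.of_forall fun r => ?_)
    rw [Real.norm_of_nonneg (integral_nonneg fun s => norm_nonneg _)]
    refine le_trans (le_of_eq ?_) (hslice r).var_le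
    refine integral_congr_ae (Filter.Eventually.of_forall fun s => ?_)
    exact Real.norm_of_nonneg (sq_nonneg _)
  have hmint : Integrable m ν := hmc.integrableOn_Ioc
  have hmint2 : Integrable (fun q : Z × ℝ => m q.2) (D.prod ν) := hmint.comp_snd D
  -- Square integrability implies integrability, by t ≤ 1 + t².
  have hYmint : Integrable (fun q => Y q - m q.2) (D.prod ν) := by
    refine ((integrable_const (1 : ℝ)).add hBint).mono'
      (hYm.sub (hmc.measurable.comp measurable_snd)).aestronglyMeasurable
      (Filter.Eventually.of_forall fun q => ?_)
    change ‖Y q - m q.2‖ ≤ 1 + ‖Y q - m q.2‖ ^ 2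
    nlinarith [sq_nonneg (‖Y q - m q.2‖ - 1)]
  have hYint : Integrable Y (D.prod ν) := by
    exact (hYmint.add hmint2).congr (Filter.Eventually.of_forall fun q => sub_add_cancel _ _)
  -- The derivative of `k s` need not be continuous. The fundamental theorem of calculus requires it
  -- to be integrable along the segment, which Fubini provides for almost every s.
  have hftc : ∀ᵐ s ∂D, (2 * δ)⁻¹ • (k s (y + δ • z) - k s (y - δ • z)) = ∫ r, Y (s, r) ∂ν := by
    filter_upwards [hYint.prod_right_ae] with s hs
    have hd : ∀ r ∈ Set.uIcc (0 : ℝ) 1,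
        HasDerivAt (fun r => k s (c r)) ((2 * δ) • Y (s, r)) r := fun r _ => by
      have h1 : HasDerivAt c ((2 * δ) • z) r := by
        have h0 : HasDerivAt (fun r : ℝ => (2 * r - 1) * δ) (2 * δ) r := by
          simpa using (((hasDerivAt_id r).const_mul 2).sub_const 1).mul_const δ
        exact (h0.smul_const z).const_add y
      have h2 := (hk s (c r)).comp_hasDerivAt r h1
      rwa [map_smul] at h2
    have hi : IntervalIntegrable (fun r => (2 * δ) • Y (s, r)) volume 0 1 :=
      (intervalIntegrable_iff_integrableOn_Ioc_of_le zero_le_one).2 (hs.smul (2 * δ))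
    have h3 := intervalIntegral.integral_eq_sub_of_hasDerivAt hd hi
    have h4 : c 1 = y + δ • z := by simp only [hc]; norm_num
    have h5 : c 0 = y - δ • z := by simp [hc, sub_eq_add_neg]
    rw [intervalIntegral.integral_of_le zero_le_one, integral_smul, h4, h5] at h3
    rw [← h3, smul_smul, inv_mul_cancel₀ (by positivity), one_smul]
  refine ⟨∫ r, m r ∂ν, ?_, ?_, ?_, ?_, ?_⟩
  · have h1 : (∫ r, m r ∂ν) - K' y z = ∫ r, (m r - K' y z) ∂ν := by
      rw [integral_sub hmint (integrable_const _)]; simp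
    rw [h1]
    have h2 := norm_integral_le_of_norm_le_const (μ := ν) (f := fun r => m r - K' y z)
      (C := Lh * δ * ‖z‖ ^ 2) ?_
    · simpa using h2
    · refine (ae_restrict_mem measurableSet_Ioc).mono fun r hr => ?_
      change ‖K' (c r) z - K' y z‖ ≤ _
      rw [← sub_apply]
      refine ((K' (c r) - K' y).le_opNorm z).trans ?_
      have h3 := hlip (c r) y
      have h4 : ‖c r - y‖ ≤ δ * ‖z‖ := by
        simp only [hc, add_sub_cancel_left, norm_smul, norm_mul, Real.norm_of_nonneg hδ.le]
        have h6 : ‖2 * r - 1‖ ≤ 1 := by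
          rw [Real.norm_eq_abs, abs_le]; constructor <;> linarith [hr.1, hr.2]
        calc ‖2 * r - 1‖ * δ * ‖z‖ ≤ 1 * δ * ‖z‖ := by gcongr
          _ = δ * ‖z‖ := by ring
      calc ‖K' (c r) - K' y‖ * ‖z‖ ≤ Lh * (δ * ‖z‖) * ‖z‖ := by
            gcongr; exact h3.trans (by gcongr)
        _ = Lh * δ * ‖z‖ ^ 2 := by ring
  · exact hYint.integral_prod_left.congr (hftc.mono fun s hs => hs.symm)
  · rw [integral_congr_ae hftc, integral_integral_swap (f := fun s r => Y (s, r)) hYint]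
    exact integral_congr_ae (Filter.Eventually.of_forall fun r => (hslice r).mean)
  all_goals
    -- Jensen in r for fixed s. Integrating over s and exchanging the integrals leaves the variance
    -- of the derivative oracle at each point of the segment.
    have hpt : ∀ᵐ s ∂D, ‖(2 * δ)⁻¹ • (k s (y + δ • z) - k s (y - δ • z)) - ∫ r, m r ∂ν‖ ^ 2 ≤
        ∫ r, B (s, r) ∂ν := by
      filter_upwards [hftc, hYmint.prod_right_ae, hBint.prod_right_ae, hYint.prod_right_ae]
        with s h1 h2 h3 h4
      rw [h1, ← integral_sub h4 hmint]
      exact norm_integral_sq_le h2 h3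
    have hint : Integrable
        (fun s => ‖(2 * δ)⁻¹ • (k s (y + δ • z) - k s (y - δ • z)) - ∫ r, m r ∂ν‖ ^ 2) D := by
      refine hBint.integral_prod_left.mono' ?_ (hpt.mono fun s hs => ?_)
      · exact (((hYint.integral_prod_left.congr (hftc.mono fun s hs => hs.symm)
          ).aestronglyMeasurable.sub aestronglyMeasurable_const).norm.pow 2)
      · rw [Real.norm_of_nonneg (by positivity)]; exact hs
  · exact hint
  · refine (integral_mono_ae hint hBint.integral_prod_left hpt).trans ?_
    rw [integral_integral_swap (f := fun s r => B (s, r)) hBint]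
    have h1 : ∫ r, ∫ s, B (s, r) ∂D ∂ν ≤ ∫ _, σ ^ 2 * ‖z‖ ^ 2 ∂ν :=
      integral_mono hBint.integral_prod_right (integrable_const _) fun r => (hslice r).var_le
    simpa using h1

end Oracles

/-! ### Change of probability space and conditioning on an independent variable -/

section Transport

variable {Ω Z : Type*} [MeasurableSpace Ω] [MeasurableSpace Z] {n : ℕ}

theorem HasMeanVar.comp_measurePreserving {Q : Measure Ω} {D : Measure Z} {φ : Ω → Z}
    (hφ : MeasurePreserving φ Q D) {X : Z → Vec n} {m : Vec n} {v : ℝ} (h : HasMeanVar D X m v) :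
    HasMeanVar Q (fun ω => X (φ ω)) m v where
  int := hφ.integrable_comp_of_integrable h.int
  mean := by
    rw [← h.mean, ← hφ.map_eq, integral_map hφ.measurable.aemeasurable]
    rw [hφ.map_eq]; exact h.int.aestronglyMeasurable
  int_sq := hφ.integrable_comp_of_integrable h.int_sq
  var_le := by
    refine le_trans (le_of_eq ?_) h.var_le
    rw [← hφ.map_eq, integral_map hφ.measurable.aemeasurable]
    rw [hφ.map_eq]; exact h.int_sq.aestronglyMeasurable

/-- Integration of a nonnegative function of two independent random variables, in terms of a bound
on its conditional expectations. -/
theorem integral_le_of_indepFun {𝒳 E : Type*} [MeasurableSpace 𝒳] [MeasurableSpace E]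
    {P : Measure Ω} [IsProbabilityMeasure P] {X : Ω → 𝒳} {w : Ω → E} (hX : Measurable X)
    (hw : Measurable w) (hind : IndepFun X w P) {φ : 𝒳 × E → ℝ} (hφ : Measurable φ)
    (hφ0 : ∀ q, 0 ≤ φ q) {r : Ω → ℝ} (hr : Integrable r P)
    (h : ∀ᵐ ω ∂P, Integrable (fun e => φ (X ω, e)) (P.map w) ∧
      ∫ e, φ (X ω, e) ∂(P.map w) ≤ r ω) :
    Integrable (fun ω => φ (X ω, w ω)) P ∧ ∫ ω, φ (X ω, w ω) ∂P ≤ ∫ ω, r ω ∂P := by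
  have : IsProbabilityMeasure (P.map w) := Measure.isProbabilityMeasure_map hw.aemeasurable
  have : IsProbabilityMeasure (P.map X) := Measure.isProbabilityMeasure_map hX.aemeasurable
  have hmap := (indepFun_iff_map_prod_eq_prod_map_map hX.aemeasurable hw.aemeasurable).1 hind
  have hsm : StronglyMeasurable fun x => ∫ e, φ (x, e) ∂(P.map w) :=
    hφ.stronglyMeasurable.integral_prod_right'
  have hint : Integrable (fun ω => ∫ e, φ (X ω, e) ∂(P.map w)) P := by
    refine hr.mono' (hsm.measurable.comp hX).aestronglyMeasurable (h.mono fun ω hω => ?_)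
    rw [Real.norm_of_nonneg (integral_nonneg fun e => hφ0 _)]
    exact hω.2
  have hprod : Integrable φ ((P.map X).prod (P.map w)) := by
    rw [integrable_prod_iff hφ.aestronglyMeasurable]
    constructor
    · rw [ae_map_iff hX.aemeasurable (measurableSet_integrable (f := fun x e => φ (x, e))
        hφ.stronglyMeasurable)]
      exact h.mono fun ω hω => hω.1
    · simp only [Real.norm_of_nonneg (hφ0 _)]
      rw [integrable_map_measure hsm.aestronglyMeasurable hX.aemeasurable]
      exact hint
  have hXw : AEMeasurable (fun ω => (X ω, w ω)) P := (hX.prodMk hw).aemeasurable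
  constructor
  · rw [← hmap, integrable_map_measure hφ.aestronglyMeasurable hXw] at hprod
    exact hprod
  · rw [← integral_map hXw (f := φ) hφ.aestronglyMeasurable, hmap, integral_prod _ hprod,
      integral_map hX.aemeasurable hsm.aestronglyMeasurable]
    exact integral_mono_ae hint hr (h.mono fun ω hω => hω.2)

end Transport

/-! ### Measurability of the iteration -/

section Measurability

variable {N d p : ℕ} {S Z : Type*} [MeasurableSpace S] [MeasurableSpace Z]

instance : MeasurableSpace (State N d p) :=
  MeasurableSpace.comap (fun s => (s.x, s.y, s.z, s.h)) inferInstance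

theorem measurable_state_tuple :
    Measurable fun s : State N d p => (s.x, s.y, s.z, s.h) := comap_measurable _

@[fun_prop] theorem measurable_state_x : Measurable fun s : State N d p => s.x :=
  measurable_fst.comp measurable_state_tuple

@[fun_prop] theorem measurable_state_y : Measurable fun s : State N d p => s.y :=
  measurable_fst.comp (measurable_snd.comp measurable_state_tuple)

@[fun_prop] theorem measurable_state_z : Measurable fun s : State N d p => s.z :=
  measurable_fst.comp (measurable_snd.comp (measurable_snd.comp measurable_state_tuple))

@[fun_prop] theorem measurable_state_h : Measurable fun s : State N d p => s.h :=
  measurable_snd.comp (measurable_snd.comp (measurable_snd.comp measurable_state_tuple))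

theorem measurable_state_mk {Ω : Type*} {m : MeasurableSpace Ω} {s : Ω → State N d p}
    (hx : ∀ i, Measurable fun ω => (s ω).x i) (hy : ∀ i, Measurable fun ω => (s ω).y i)
    (hz : ∀ i, Measurable fun ω => (s ω).z i) (hh : ∀ i, Measurable fun ω => (s ω).h i) :
    Measurable s :=
  measurable_comap_iff.2 ((measurable_pi_iff.2 hx).prodMk ((measurable_pi_iff.2 hy).prodMk
    ((measurable_pi_iff.2 hz).prodMk (measurable_pi_iff.2 hh))))

theorem measurable_clm_apply {Ω : Type*} {m : MeasurableSpace Ω} {n q : ℕ}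
    {K : Ω → Vec q →L[ℝ] Vec n} {z : Ω → Vec q} (hK : Measurable K) (hz : Measurable z) :
    Measurable fun ω => K ω (z ω) := by
  have h : Continuous fun q : (Vec q →L[ℝ] Vec n) × Vec q => q.1 q.2 :=
    continuous_fst.clm_apply continuous_snd
  -- Makes the product σ-algebra on operators and vectors the Borel one, so that continuity of
  -- evaluation gives measurability.
  have : SecondCountableTopology (Vec q →L[ℝ] Vec n) :=
    secondCountable_of_proper
  exact h.measurable.comp (hK.prodMk hz)

variable {Df : Fin N → Measure S} {Dg : Fin N → Measure Z} {F : S → Vec d → Vec p → ℝ}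
  {G : Z → Vec d → Vec p → ℝ} {σ : ℝ}

theorem Stochasticity.measurable_pH (h : Stochasticity Df Dg F G σ) (v : Variant) {Ω : Type*}
    {m : MeasurableSpace Ω} {ζ : Ω → Z} {δ : Ω → ℝ} {x : Ω → Vec d} {y z : Ω → Vec p}
    (hζ : Measurable ζ) (hδ : Measurable δ) (hx : Measurable x) (hy : Measurable y)
    (hz : Measurable z) : Measurable fun ω => pH v (G (ζ ω)) (δ ω) (x ω) (y ω) (z ω) := by
  cases v with
  | SO => exact measurable_clm_apply (h.meas_hess22_G.comp (hζ.prodMk (hx.prodMk hy))) hz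
  | FO =>
    have h1 := h.meas_grad2_G.comp (hζ.prodMk (hx.prodMk (hy.add (hδ.smul hz))))
    have h2 := h.meas_grad2_G.comp (hζ.prodMk (hx.prodMk (hy.sub (hδ.smul hz))))
    exact ((hδ.const_mul 2).inv).smul (h1.sub h2)

theorem Stochasticity.measurable_pJ (h : Stochasticity Df Dg F G σ) (v : Variant) {Ω : Type*}
    {m : MeasurableSpace Ω} {ζ : Ω → Z} {δ : Ω → ℝ} {x : Ω → Vec d} {y z : Ω → Vec p}
    (hζ : Measurable ζ) (hδ : Measurable δ) (hx : Measurable x) (hy : Measurable y)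
    (hz : Measurable z) : Measurable fun ω => pJ v (G (ζ ω)) (δ ω) (x ω) (y ω) (z ω) := by
  cases v with
  | SO => exact measurable_clm_apply (h.meas_hess12_G.comp (hζ.prodMk (hx.prodMk hy))) hz
  | FO =>
    have h1 := h.meas_grad1_G.comp (hζ.prodMk (hx.prodMk (hy.add (hδ.smul hz))))
    have h2 := h.meas_grad1_G.comp (hζ.prodMk (hx.prodMk (hy.sub (hδ.smul hz))))
    exact ((hδ.const_mul 2).inv).smul (h1.sub h2)

theorem Stochasticity.measurable_step (h : Stochasticity Df Dg F G σ) (v : Variant)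
    (W : Matrix (Fin N) (Fin N) ℝ) (α β γ θ τ : ℝ) {Ω : Type*} {m : MeasurableSpace Ω}
    {δ : Ω → ℝ} {ξ : Ω → Fin N → S} {ζ : Ω → Fin N → Z} {s : Ω → State N d p}
    (hδ : Measurable δ) (hξ : ∀ i, Measurable fun ω => ξ ω i) (hζ : ∀ i, Measurable fun ω => ζ ω i)
    (hs : Measurable s) :
    Measurable fun ω => step v F G W α β γ θ τ (δ ω) (ξ ω) (ζ ω) (s ω) := by
  have hx : ∀ i, Measurable fun ω => (s ω).x i := fun i =>
    (measurable_pi_apply i).comp (measurable_state_x.comp hs)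
  have hy : ∀ i, Measurable fun ω => (s ω).y i := fun i =>
    (measurable_pi_apply i).comp (measurable_state_y.comp hs)
  have hz : ∀ i, Measurable fun ω => (s ω).z i := fun i =>
    (measurable_pi_apply i).comp (measurable_state_z.comp hs)
  have hh : ∀ i, Measurable fun ω => (s ω).h i := fun i =>
    (measurable_pi_apply i).comp (measurable_state_h.comp hs)
  have h1 : ∀ i, Measurable fun ω => grad1 (F (ξ ω i)) ((s ω).x i) ((s ω).y i) := fun i =>
    h.meas_grad1_F.comp ((hξ i).prodMk ((hx i).prodMk (hy i)))
  have h2 : ∀ i, Measurable fun ω => grad2 (F (ξ ω i)) ((s ω).x i) ((s ω).y i) := fun i =>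
    h.meas_grad2_F.comp ((hξ i).prodMk ((hx i).prodMk (hy i)))
  have h3 : ∀ i, Measurable fun ω => grad2 (G (ζ ω i)) ((s ω).x i) ((s ω).y i) := fun i =>
    h.meas_grad2_G.comp ((hζ i).prodMk ((hx i).prodMk (hy i)))
  have h4 := fun i => h.measurable_pH v (hζ i) hδ (hx i) (hy i) (hz i)
  have h5 := fun i => h.measurable_pJ v (hζ i) hδ (hx i) (hy i) (hz i)
  refine measurable_state_mk (fun i => ?_) (fun i => ?_) (fun i => ?_) fun i => ?_ <;>
    simp only [step] <;> fun_prop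

end Measurability

/-! ### The past and the fresh samples -/

section Sampling

variable {N d p T : ℕ} {Ω S Z : Type*} [MeasurableSpace Ω] [mS : MeasurableSpace S]
  [mZ : MeasurableSpace Z] {P : Measure Ω} {Df : Fin N → Measure S} {Dg : Fin N → Measure Z}
  {ξ : ℕ → Fin N → Ω → S} {ζ : ℕ → Fin N → Ω → Z}

theorem past_le (h : Sampling P T Df Dg ξ ζ) (t : ℕ) : past ξ ζ t ≤ (inferInstance :
    MeasurableSpace Ω) :=
  iSup_le fun s => iSup_le fun i =>
    sup_le (h.meas_ξ s i).comap_le (h.meas_ζ s i).comap_le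

theorem past_mono (ξ : ℕ → Fin N → Ω → S) (ζ : ℕ → Fin N → Ω → Z) {t u : ℕ} (htu : t ≤ u) :
    past ξ ζ t ≤ past ξ ζ u :=
  iSup_le fun s => le_iSup (fun s : Fin u => ⨆ i : Fin N, mS.comap (ξ s i) ⊔ mZ.comap (ζ s i))
    ⟨s, s.2.trans_le htu⟩

theorem comap_le_past (ξ : ℕ → Fin N → Ω → S) (ζ : ℕ → Fin N → Ω → Z) (t : ℕ) (i : Fin N) :
    mS.comap (ξ t i) ⊔ mZ.comap (ζ t i) ≤ past ξ ζ (t + 1) :=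
  (le_iSup (fun i : Fin N => mS.comap (ξ t i) ⊔ mZ.comap (ζ t i)) i).trans
    (le_iSup (fun s : Fin (t + 1) => ⨆ i : Fin N, mS.comap (ξ s i) ⊔ mZ.comap (ζ s i))
      ⟨t, Nat.lt_succ_self t⟩)

/-- The samples of iteration `t` are independent of everything before. -/
theorem indep_past (h : Sampling P T Df Dg ξ ζ) {t : ℕ} (ht : t < T) :
    Indep (past ξ ζ t)
      (MeasurableSpace.comap (fun ω i => (ξ t i ω, ζ t i ω)) MeasurableSpace.pi) P := by
  have hle : ∀ q : Fin T × Fin N,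
      MeasurableSpace.comap (fun ω => (ξ q.1 q.2 ω, ζ q.1 q.2 ω)) Prod.instMeasurableSpace ≤
        (inferInstance : MeasurableSpace Ω) := fun q =>
    ((h.meas_ξ q.1 q.2).prodMk (h.meas_ζ q.1 q.2)).comap_le
  have hdisj : Disjoint {q : Fin T × Fin N | (q.1 : ℕ) < t} {q : Fin T × Fin N | (q.1 : ℕ) = t} :=
    Set.disjoint_left.2 fun q hq hq' => by
      simp only [Set.mem_ofPred_eq] at hq hq'
      omega
  have key := indep_iSup_of_disjoint hle h.indep hdisj
  refine indep_of_indep_of_le_left (indep_of_indep_of_le_right key ?_) ?_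
  · rw [MeasurableSpace.pi, MeasurableSpace.comap_iSup]
    refine iSup_le fun i => ?_
    rw [MeasurableSpace.comap_comp]
    exact le_iSup₂_of_le (f := fun (q : Fin T × Fin N) (_ : q ∈ {q : Fin T × Fin N | (q.1 : ℕ) = t})
      => MeasurableSpace.comap (fun ω => (ξ q.1 q.2 ω, ζ q.1 q.2 ω)) Prod.instMeasurableSpace)
      (⟨t, ht⟩, i) rfl le_rfl
  · refine iSup_le fun r => iSup_le fun i => ?_
    refine le_trans (le_of_eq ?_) (le_iSup₂_of_le
      (f := fun (q : Fin T × Fin N) (_ : q ∈ {q : Fin T × Fin N | (q.1 : ℕ) < t})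
      => MeasurableSpace.comap (fun ω => (ξ q.1 q.2 ω, ζ q.1 q.2 ω)) Prod.instMeasurableSpace)
      (⟨r, r.2.trans ht⟩, i) r.2 le_rfl)
    exact (MeasurableSpace.comap_prodMk _ _).symm

/-- The joint law of the samples of iteration `t`. -/
noncomputable def blockLaw (P : Measure Ω) (ξ : ℕ → Fin N → Ω → S) (ζ : ℕ → Fin N → Ω → Z)
    (t : ℕ) : Measure (Fin N → S × Z) := P.map fun ω i => (ξ t i ω, ζ t i ω)

theorem measurable_block (h : Sampling P T Df Dg ξ ζ) (t : ℕ) :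
    Measurable fun ω i => (ξ t i ω, ζ t i ω) :=
  measurable_pi_iff.2 fun i => (h.meas_ξ t i).prodMk (h.meas_ζ t i)

theorem isProbabilityMeasure_blockLaw [IsProbabilityMeasure P] (h : Sampling P T Df Dg ξ ζ)
    (t : ℕ) : IsProbabilityMeasure (blockLaw P ξ ζ t) :=
  Measure.isProbabilityMeasure_map (measurable_block h t).aemeasurable

theorem measurePreserving_block (h : Sampling P T Df Dg ξ ζ) {t : ℕ} (ht : t < T) (i : Fin N) :
    MeasurePreserving (fun w : Fin N → S × Z => w i) (blockLaw P ξ ζ t) ((Df i).prod (Dg i)) :=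
  ⟨measurable_pi_apply i, by
    rw [blockLaw, Measure.map_map (measurable_pi_apply i) (measurable_block h t)]
    exact h.law t ht i⟩

end Sampling

/-! ### The oracles of one iteration at a fixed state -/

section StepOracles

variable {N d p : ℕ} {S Z : Type*} [MeasurableSpace S] [MeasurableSpace Z]
  {Df : Fin N → Measure S} {Dg : Fin N → Measure Z} {F : S → Vec d → Vec p → ℝ}
  {G : Z → Vec d → Vec p → ℝ} {σ L κ b Lhg ι : ℝ}

/-- The second-order product is unbiased. In the first-order variant the mean is the average of the
Hessian of the local loss over the segment, applied to z, so it is the Lipschitz constant of that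
expected Hessian, not of the sampled one, that bounds the bias. -/
theorem Stochasticity.exists_mean_pH (h : Stochasticity Df Dg F G σ) (v : Variant) (i : Fin N)
    (hLhg : 0 ≤ Lhg) (hι : 0 ≤ ι) (hdg : Differentiable ℝ (joint (localLoss Dg G i)))
    (hdg' : Differentiable ℝ (fullGrad (localLoss Dg G i)))
    (hlip : ∀ u w, ‖fullHess (localLoss Dg G i) u - fullHess (localLoss Dg G i) w‖ ≤
      Lhg * ‖u - w‖) (x : Vec d) (y z : Vec p) {δ : ℝ}
    (hδ : v = Variant.FO → 0 < δ ∧ Lhg * δ * ‖z‖ ^ 2 ≤ ι) :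
    ∃ m, ‖m - hess22 (localLoss Dg G i) x y z‖ ≤ ι ∧
      HasMeanVar (Dg i) (fun s => pH v (G s) δ x y z) m (σ ^ 2 * ‖z‖ ^ 2) := by
  have := h.prob_g i
  cases v with
  | SO =>
    exact ⟨hess22 (localLoss Dg G i) x y z, by simpa using hι,
      (h.hess22_G i x y).hasMeanVar_apply z⟩
  | FO =>
    obtain ⟨hδ0, hδι⟩ := hδ rfl
    obtain ⟨m, hm, hmv⟩ := hasMeanVar_centralDiff (D := Dg i) (k := fun s y => grad2 (G s) x y)
      (K := fun s y => hess22 (G s) x y) (K' := fun y => hess22 (localLoss Dg G i) x y) hLhg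
      (fun s y => by
        rw [hess22_eq (h.diff_G s) (h.diff_grad_G s)]
        exact hasFDerivAt_grad2 (h.diff_G s) (h.diff_grad_G s) x y)
      (h.meas_hess22_G.comp (measurable_fst.prodMk (measurable_const.prodMk measurable_snd)))
      (fun y => h.hess22_G i x y)
      (fun y y' => ((norm_hess22_sub_le hdg hdg' x x y y').trans (hlip _ _)).trans_eq (by
        rw [pt_sub, sub_self]; simp)) y z hδ0
    exact ⟨m, hm.trans hδι, hmv⟩

theorem Stochasticity.exists_mean_pJ (h : Stochasticity Df Dg F G σ) (v : Variant) (i : Fin N)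
    (hLhg : 0 ≤ Lhg) (hι : 0 ≤ ι) (hdg : Differentiable ℝ (joint (localLoss Dg G i)))
    (hdg' : Differentiable ℝ (fullGrad (localLoss Dg G i)))
    (hlip : ∀ u w, ‖fullHess (localLoss Dg G i) u - fullHess (localLoss Dg G i) w‖ ≤
      Lhg * ‖u - w‖) (x : Vec d) (y z : Vec p) {δ : ℝ}
    (hδ : v = Variant.FO → 0 < δ ∧ Lhg * δ * ‖z‖ ^ 2 ≤ ι) :
    ∃ m, ‖m - hess12 (localLoss Dg G i) x y z‖ ≤ ι ∧
      HasMeanVar (Dg i) (fun s => pJ v (G s) δ x y z) m (σ ^ 2 * ‖z‖ ^ 2) := by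
  have := h.prob_g i
  cases v with
  | SO =>
    exact ⟨hess12 (localLoss Dg G i) x y z, by simpa using hι,
      (h.hess12_G i x y).hasMeanVar_apply z⟩
  | FO =>
    obtain ⟨hδ0, hδι⟩ := hδ rfl
    obtain ⟨m, hm, hmv⟩ := hasMeanVar_centralDiff (D := Dg i) (k := fun s y => grad1 (G s) x y)
      (K := fun s y => hess12 (G s) x y) (K' := fun y => hess12 (localLoss Dg G i) x y) hLhg
      (fun s y => by
        rw [hess12_eq (h.diff_G s) (h.diff_grad_G s)]
        exact hasFDerivAt_grad1 (h.diff_G s) (h.diff_grad_G s) x y)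
      (h.meas_hess12_G.comp (measurable_fst.prodMk (measurable_const.prodMk measurable_snd)))
      (fun y => h.hess12_G i x y)
      (fun y y' => ((norm_hess12_sub_le hdg hdg' x x y y').trans (hlip _ _)).trans_eq (by
        rw [pt_sub, sub_self]; simp)) y z hδ0
    exact ⟨m, hm.trans hδι, hmv⟩

/-- The oracles of one iteration at a fixed state. -/
theorem Stochasticity.noisyOracles (h : Stochasticity Df Dg F G σ) (v : Variant)
    {M : Landscape N d p L κ b} (ha₁ : M.a₁ = fun i => grad1 (localLoss Df F i))
    (ha₂ : M.a₂ = fun i => grad2 (localLoss Df F i))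
    (hg₂ : M.g₂ = fun i => grad2 (localLoss Dg G i))
    (hJ : M.J = fun i => hess12 (localLoss Dg G i)) (hH : M.H = fun i => hess22 (localLoss Dg G i))
    (hLhg : 0 ≤ Lhg) (hι : 0 ≤ ι) (hdg : ∀ i, Differentiable ℝ (joint (localLoss Dg G i)))
    (hdg' : ∀ i, Differentiable ℝ (fullGrad (localLoss Dg G i)))
    (hlip : ∀ i u w, ‖fullHess (localLoss Dg G i) u - fullHess (localLoss Dg G i) w‖ ≤
      Lhg * ‖u - w‖) {Q : Measure (Fin N → S × Z)}
    (hQ : ∀ i, MeasurePreserving (fun w : Fin N → S × Z => w i) Q ((Df i).prod (Dg i)))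
    (s : State N d p) {δ : ℝ}
    (hδ : v = Variant.FO → 0 < δ ∧ ∀ i, Lhg * δ * ‖s.z i‖ ^ 2 ≤ ι) :
    M.NoisyOracles s σ ι Q (fun i w => grad1 (F (w i).1) (s.x i) (s.y i))
      (fun i w => grad2 (F (w i).1) (s.x i) (s.y i)) (fun i w => grad2 (G (w i).2) (s.x i) (s.y i))
      (fun i w => pH v (G (w i).2) δ (s.x i) (s.y i) (s.z i))
      (fun i w => pJ v (G (w i).2) δ (s.x i) (s.y i) (s.z i)) := by
  have := h.prob_f
  have := h.prob_g
  have hf : ∀ i, MeasurePreserving (fun w : Fin N → S × Z => (w i).1) Q (Df i) := fun i =>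
    measurePreserving_fst.comp (hQ i)
  have hg : ∀ i, MeasurePreserving (fun w : Fin N → S × Z => (w i).2) Q (Dg i) := fun i =>
    measurePreserving_snd.comp (hQ i)
  refine ⟨fun i => ?_, fun i => ?_, fun i => ?_, fun i => ?_, fun i => ?_⟩
  · rw [ha₁]; exact (h.grad1_F i _ _).hasMeanVar.comp_measurePreserving (hf i)
  · rw [ha₂]; exact (h.grad2_F i _ _).hasMeanVar.comp_measurePreserving (hf i)
  · rw [hg₂]; exact (h.grad2_G i _ _).hasMeanVar.comp_measurePreserving (hg i)
  · obtain ⟨m, hm, hmv⟩ := h.exists_mean_pH v i hLhg hι (hdg i) (hdg' i) (hlip i) (s.x i) (s.y i)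
      (s.z i) fun hv => ⟨(hδ hv).1, (hδ hv).2 i⟩
    exact ⟨m, by rw [hH]; exact hm, hmv.comp_measurePreserving (hg i)⟩
  · obtain ⟨m, hm, hmv⟩ := h.exists_mean_pJ v i hLhg hι (hdg i) (hdg' i) (hlip i) (s.x i) (s.y i)
      (s.z i) fun hv => ⟨(hδ hv).1, (hδ hv).2 i⟩
    exact ⟨m, by rw [hJ]; exact hm, hmv.comp_measurePreserving (hg i)⟩

end StepOracles

/-! ### Measurability of the error quantities -/

section Measurability

variable {N d p : ℕ} {L κ b : ℝ} {Ω : Type*} {m : MeasurableSpace Ω} {s : Ω → State N d p}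

theorem measurable_nodeAvg {n : ℕ} {v : Ω → Fin N → Vec n} (hv : Measurable v) :
    Measurable fun ω => nodeAvg (v ω) := by
  unfold nodeAvg; fun_prop

theorem measurable_spread {n : ℕ} {v : Ω → Fin N → Vec n} (hv : Measurable v) :
    Measurable fun ω => spread (v ω) := by
  have := measurable_nodeAvg hv
  simp only [spread, nodeAvg, smul_eq_mul]
  simp only [nodeAvg] at this
  fun_prop

theorem measurable_consensusError : Measurable (consensusError : State N d p → ℝ) := by
  rw [funext consensusError_eq]
  exact ((measurable_spread measurable_state_x).add (measurable_spread measurable_state_y)).add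
    (measurable_spread measurable_state_z)

theorem continuous_of_norm_sub_le {V V' : Type*} [NormedAddCommGroup V] [NormedAddCommGroup V']
    {f : V → V'} {c : ℝ} (h : ∀ x x', ‖f x - f x'‖ ≤ c * ‖x - x'‖) : Continuous f :=
  (LipschitzWith.of_dist_le_mul (K := c.toNNReal) fun x x' => by
    rw [dist_eq_norm, dist_eq_norm]
    exact (h x x').trans (mul_le_mul_of_nonneg_right (Real.le_coe_toNNReal c)
      (norm_nonneg _))).continuous

variable (M : Landscape N d p L κ b)

theorem Landscape.measurable_errY : Measurable M.errY :=
  ((measurable_nodeAvg measurable_state_y).sub ((continuous_of_norm_sub_le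
    M.lip_yStar).measurable.comp (measurable_nodeAvg measurable_state_x))).norm.pow_const 2

theorem Landscape.measurable_errZ : Measurable M.errZ :=
  ((measurable_nodeAvg measurable_state_z).sub ((continuous_of_norm_sub_le
    M.lip_zStar).measurable.comp (measurable_nodeAvg measurable_state_x))).norm.pow_const 2

theorem Landscape.measurable_errH : Measurable M.errH :=
  ((measurable_nodeAvg measurable_state_h).sub ((continuous_of_norm_sub_le
    M.lip_objGrad).measurable.comp (measurable_nodeAvg measurable_state_x))).norm.pow_const 2

end Measurability

/-! ### From conditional bounds to expectations -/

section Trajectory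

variable {N d p T : ℕ} {Ω S Z : Type*} [MeasurableSpace Ω] [mS : MeasurableSpace S]
  [mZ : MeasurableSpace Z] {P : Measure Ω} {Df : Fin N → Measure S}
  {Dg : Fin N → Measure Z} {F : S → Vec d → Vec p → ℝ} {G : Z → Vec d → Vec p → ℝ}
  {L κ b σ Lhg ι α β γ θ τ : ℝ} {W : Matrix (Fin N) (Fin N) ℝ} {v : Variant}
  {ξ : ℕ → Fin N → Ω → S} {ζ : ℕ → Fin N → Ω → Z} {δ : ℕ → Ω → ℝ} {s : ℕ → Ω → State N d p}
  {s₀ : State N d p}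

/-- The landscape of the problem with oracles `F`, `G`. -/
structure Landscape.IsModelOf (M : Landscape N d p L κ b) (Df : Fin N → Measure S)
    (Dg : Fin N → Measure Z) (F : S → Vec d → Vec p → ℝ) (G : Z → Vec d → Vec p → ℝ)
    (Lhg : ℝ) : Prop where
  a₁ : M.a₁ = fun i => grad1 (localLoss Df F i)
  a₂ : M.a₂ = fun i => grad2 (localLoss Df F i)
  g₂ : M.g₂ = fun i => grad2 (localLoss Dg G i)
  J : M.J = fun i => hess12 (localLoss Dg G i)
  H : M.H = fun i => hess22 (localLoss Dg G i)
  nonneg : 0 ≤ Lhg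
  diff_g : ∀ i, Differentiable ℝ (joint (localLoss Dg G i))
  diff_grad_g : ∀ i, Differentiable ℝ (fullGrad (localLoss Dg G i))
  lip_hess : ∀ i u w, ‖fullHess (localLoss Dg G i) u - fullHess (localLoss Dg G i) w‖ ≤
    Lhg * ‖u - w‖

/-- `s` is a run of the algorithm with perturbations `δ` that depend on the past only and are
small enough for the finite differences to have bias at most `ι`. -/
structure IsRun (v : Variant) (F : S → Vec d → Vec p → ℝ) (G : Z → Vec d → Vec p → ℝ)
    (W : Matrix (Fin N) (Fin N) ℝ) (α β γ θ τ Lhg ι : ℝ) (P : Measure Ω) (T : ℕ)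
    (ξ : ℕ → Fin N → Ω → S) (ζ : ℕ → Fin N → Ω → Z) (δ : ℕ → Ω → ℝ) (s₀ : State N d p)
    (s : ℕ → Ω → State N d p) : Prop where
  init : ∀ ω, s 0 ω = s₀
  step_eq : ∀ t ω, s (t + 1) ω =
    step v F G W α β γ θ τ (δ t ω) (fun i => ξ t i ω) (fun i => ζ t i ω) (s t ω)
  meas_δ : ∀ t < T, Measurable[past ξ ζ t] (δ t)
  small : v = Variant.FO → ∀ t < T, ∀ᵐ ω ∂P, 0 < δ t ω ∧ ∀ i, Lhg * δ t ω * ‖(s t ω).z i‖ ^ 2 ≤ ι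

theorem IsRun.measurable_past (hs : IsRun v F G W α β γ θ τ Lhg ι P T ξ ζ δ s₀ s)
    (hF : Stochasticity Df Dg F G σ) : ∀ t ≤ T, Measurable[past ξ ζ t] (s t)
  | 0, _ => by
    rw [funext hs.init]
    exact measurable_const
  | t + 1, ht => by
    rw [funext (hs.step_eq t)]
    have hle := past_mono ξ ζ (Nat.le_succ t)
    have hξ : ∀ i, Measurable[past ξ ζ (t + 1)] (ξ t i) := fun i =>
      measurable_iff_comap_le.2 (le_sup_left.trans (comap_le_past ξ ζ t i))
    have hζ : ∀ i, Measurable[past ξ ζ (t + 1)] (ζ t i) := fun i =>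
      measurable_iff_comap_le.2 (le_sup_right.trans (comap_le_past ξ ζ t i))
    exact hF.measurable_step v W α β γ θ τ ((hs.meas_δ t ht).mono hle le_rfl) hξ hζ
      ((hs.measurable_past hF t (Nat.le_of_succ_le ht)).mono hle le_rfl)

/-- Integration of one step, given bounds on its conditional expectations. -/
theorem IsRun.integral_succ_le [IsProbabilityMeasure P]
    (hs : IsRun v F G W α β γ θ τ Lhg ι P T ξ ζ δ s₀ s)
    (hF : Stochasticity Df Dg F G σ) (hP : Sampling P T Df Dg ξ ζ)
    {M : Landscape N d p L κ b} (hM : M.IsModelOf Df Dg F G Lhg) (hι : 0 ≤ ι)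
    {q r : State N d p → ℝ} (hq : Measurable q) (hq0 : ∀ s, 0 ≤ q s)
    (hqr : ∀ (Q : Measure (Fin N → S × Z)) [IsProbabilityMeasure Q] (s : State N d p)
      (A₁ : Fin N → (Fin N → S × Z) → Vec d) (A₂ G₂ PH : Fin N → (Fin N → S × Z) → Vec p)
      (PJ : Fin N → (Fin N → S × Z) → Vec d), M.NoisyOracles s σ ι Q A₁ A₂ G₂ PH PJ →
      Integrable (fun w => q (update W α β γ θ τ s (A₁ · w) (A₂ · w) (G₂ · w) (PH · w)
        (PJ · w))) Q ∧
      ∫ w, q (update W α β γ θ τ s (A₁ · w) (A₂ · w) (G₂ · w) (PH · w) (PJ · w)) ∂Q ≤ r s)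
    {t : ℕ} (ht : t < T) (hr : Integrable (fun ω => r (s t ω)) P) :
    Integrable (fun ω => q (s (t + 1) ω)) P ∧
      ∫ ω, q (s (t + 1) ω) ∂P ≤ ∫ ω, r (s t ω) ∂P := by
  have hX' : Measurable[past ξ ζ t] fun ω => (s t ω, δ t ω) :=
    (hs.measurable_past hF t ht.le).prodMk (hs.meas_δ t ht)
  have hX : Measurable fun ω => (s t ω, δ t ω) := hX'.mono (past_le hP t) le_rfl
  have hw := measurable_block hP t
  -- State and perturbation depend on the past only, so they can be frozen while the samples of
  -- iteration t are integrated out.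
  have hind : IndepFun (fun ω => (s t ω, δ t ω)) (fun ω i => (ξ t i ω, ζ t i ω)) P :=
    (IndepFun_iff_Indep _ _ _).2 (indep_of_indep_of_le_left (indep_past hP ht) hX'.comap_le)
  have hφ : Measurable fun u : (State N d p × ℝ) × (Fin N → S × Z) =>
      q (step v F G W α β γ θ τ u.1.2 (fun i => (u.2 i).1) (fun i => (u.2 i).2) u.1.1) :=
    hq.comp (hF.measurable_step v W α β γ θ τ (by fun_prop) (by fun_prop) (by fun_prop)
      (by fun_prop))
  have := isProbabilityMeasure_blockLaw hP t
  have key := integral_le_of_indepFun hX hw hind hφ (fun u => hq0 _) hr ?_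
  · simpa only [hs.step_eq] using key
  · have hsm : ∀ᵐ ω ∂P, v = Variant.FO →
        0 < δ t ω ∧ ∀ i, Lhg * δ t ω * ‖(s t ω).z i‖ ^ 2 ≤ ι := by
      by_cases hv : v = Variant.FO
      · filter_upwards [hs.small hv t ht] with ω hω _ using hω
      · exact Filter.Eventually.of_forall fun ω h => absurd h hv
    filter_upwards [hsm] with ω hω
    exact hqr (blockLaw P ξ ζ t) (s t ω) _ _ _ _ _ (hF.noisyOracles v hM.a₁ hM.a₂ hM.g₂ hM.J hM.H
      hM.nonneg hι hM.diff_g hM.diff_grad_g hM.lip_hess (fun i => measurePreserving_block hP ht i) (s t ω) hω)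

/-- The error quantities whose expectations satisfy a system of linear recursions. -/
noncomputable def Landscape.errors (M : Landscape N d p L κ b) (s : State N d p) : Fin 6 → ℝ :=
  ![M.errY s, M.errZ s, M.errH s, spread s.h, consensusError s, ‖nodeAvg s.h‖ ^ 2]

theorem integral_affine [IsProbabilityMeasure P] {n : ℕ} {f : Ω → Fin n → ℝ}
    (hf : ∀ i, Integrable (fun ω => f ω i) P) (c : Fin n → ℝ) (e : ℝ) :
    Integrable (fun ω => ∑ i, c i * f ω i + e) P ∧
      ∫ ω, (∑ i, c i * f ω i + e) ∂P = ∑ i, c i * ∫ ω, f ω i ∂P + e := by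
  have h : Integrable (fun ω => ∑ i, c i * f ω i) P :=
    integrable_finsetSum _ fun i _ => (hf i).const_mul _
  refine ⟨h.add (integrable_const _), ?_⟩
  rw [integral_add h (integrable_const _), integral_finsetSum _ fun i _ => (hf i).const_mul _,
    integral_const, probReal_univ, one_smul]
  simp only [integral_const_mul]

/-- A system of recursions for the errors of `ȳ`, `z̄`, `h̄`, the spread of `h`, the consensus error
and the square norm of `h̄`, together with the sum of the descent inequalities of the objective. -/
structure ErrorRecursion (L κ b σ ι ρ R α β γ θ τ : ℝ) (T : ℕ) (Y Z H S D B : ℕ → ℝ) :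
    Prop where
  Y_nonneg : ∀ t, 0 ≤ Y t
  Z_nonneg : ∀ t, 0 ≤ Z t
  H_nonneg : ∀ t, 0 ≤ H t
  S_nonneg : ∀ t, 0 ≤ S t
  D_nonneg : ∀ t, 0 ≤ D t
  B_nonneg : ∀ t, 0 ≤ B t
  Y_succ : ∀ t < T, Y (t + 1) ≤ (1 - β * (L / κ) / 2) * Y t + 6 * β * L ^ 2 / (L / κ) * D t +
    6 * κ ^ 2 * (τ * α) ^ 2 / (β * (L / κ)) * B t + β ^ 2 * σ ^ 2
  Z_succ : ∀ t < T, Z (t + 1) ≤ (1 - γ * (L / κ) / 2) * Z t +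
    18 * γ / (L / κ) * (4 * L ^ 2 * κ ^ 2 * (D t + Y t) + ι ^ 2) +
    96 * κ ^ 6 * (τ * α) ^ 2 / (γ * (L / κ)) * B t +
    γ ^ 2 * (2 * σ ^ 2 * (1 + 2 * κ ^ 2 + 2 * (D t + Z t)))
  H_succ : ∀ t < T, H (t + 1) ≤ (1 - θ) * H t +
    6 * θ * (4 * L ^ 2 * κ ^ 2 * (D t + Y t) + L ^ 2 * Z t + ι ^ 2) +
    128 * L ^ 2 * κ ^ 6 * (τ * α) ^ 2 / θ * B t +
    θ ^ 2 * (2 * σ ^ 2 * (1 + 2 * κ ^ 2 + 2 * (D t + Z t)))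
  S_succ : ∀ t < T, S (t + 1) ≤ (1 - θ) * S t +
    θ * (6 * (4 * L ^ 2 * κ ^ 2 * (D t + Y t) + L ^ 2 * Z t + ι ^ 2) + 8 * κ ^ 2 * b ^ 2) +
    θ ^ 2 * (2 * σ ^ 2 * (1 + 2 * κ ^ 2 + 2 * (D t + Z t)))
  D_succ : ∀ t < T, D (t + 1) ≤ ρ * D t + (1 - ρ)⁻¹ * ((τ * α) ^ 2 * S t +
    β ^ 2 * (2 * L ^ 2 * (D t + Y t) + 2 * b ^ 2) +
    γ ^ 2 * (6 * (4 * L ^ 2 * κ ^ 2 * (D t + Y t) + L ^ 2 * Z t + ι ^ 2) + 8 * κ ^ 2 * b ^ 2)) +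
    β ^ 2 * σ ^ 2 + γ ^ 2 * (2 * σ ^ 2 * (1 + 2 * κ ^ 2 + 2 * (D t + Z t)))
  B_sum : τ * α / 4 * ∑ t ∈ Finset.range T, B t ≤ R + τ * α / 2 * ∑ t ∈ Finset.range T, H t

section Recursion

variable [IsProbabilityMeasure P] {M : Landscape N d p L κ b}

/-- All conditional bounds are affine in the six quantities of `errors`, so taking expectations only
replaces these quantities by their means. -/
theorem IsRun.integral_succ_le_affine (hs : IsRun v F G W α β γ θ τ Lhg ι P T ξ ζ δ s₀ s)
    (hF : Stochasticity Df Dg F G σ) (hP : Sampling P T Df Dg ξ ζ)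
    (hM : M.IsModelOf Df Dg F G Lhg) (hι : 0 ≤ ι) {q r : State N d p → ℝ} (hq : Measurable q)
    (hq0 : ∀ s, 0 ≤ q s)
    (hqr : ∀ (Q : Measure (Fin N → S × Z)) [IsProbabilityMeasure Q] (s : State N d p)
      (A₁ : Fin N → (Fin N → S × Z) → Vec d) (A₂ G₂ PH : Fin N → (Fin N → S × Z) → Vec p)
      (PJ : Fin N → (Fin N → S × Z) → Vec d), M.NoisyOracles s σ ι Q A₁ A₂ G₂ PH PJ →
      Integrable (fun w => q (update W α β γ θ τ s (A₁ · w) (A₂ · w) (G₂ · w) (PH · w)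
        (PJ · w))) Q ∧
      ∫ w, q (update W α β γ θ τ s (A₁ · w) (A₂ · w) (G₂ · w) (PH · w) (PJ · w)) ∂Q ≤ r s)
    (c : Fin 6 → ℝ) (e : ℝ) (hr : ∀ s, r s = ∑ i, c i * M.errors s i + e) {t : ℕ} (ht : t < T)
    (hint : ∀ i, Integrable (fun ω => M.errors (s t ω) i) P) :
    Integrable (fun ω => q (s (t + 1) ω)) P ∧
      ∫ ω, q (s (t + 1) ω) ∂P ≤ ∑ i, c i * ∫ ω, M.errors (s t ω) i ∂P + e := by
  have h := integral_affine hint c e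
  have h' := hs.integral_succ_le hF hP hM hι hq hq0 hqr ht (by simpa only [hr] using h.1)
  simp only [hr] at h'
  exact ⟨h'.1, h'.2.trans_eq h.2⟩

end Recursion

end Trajectory

/-! ### Integrability and the recursions along a run -/

section Recursion

variable {N d p T : ℕ} {Ω S Z : Type*} [MeasurableSpace Ω] [mS : MeasurableSpace S]
  [mZ : MeasurableSpace Z] {P : Measure Ω} {Df : Fin N → Measure S}
  {Dg : Fin N → Measure Z} {F : S → Vec d → Vec p → ℝ} {G : Z → Vec d → Vec p → ℝ}
  {L κ b σ Lhg ι R α β γ θ τ : ℝ} {W : Matrix (Fin N) (Fin N) ℝ} {v : Variant}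
  {ξ : ℕ → Fin N → Ω → S} {ζ : ℕ → Fin N → Ω → Z} {δ : ℕ → Ω → ℝ} {s : ℕ → Ω → State N d p}
  {s₀ : State N d p} [IsProbabilityMeasure P] {M : Landscape N d p L κ b}

theorem IsRun.measurable (hs : IsRun v F G W α β γ θ τ Lhg ι P T ξ ζ δ s₀ s)
    (hF : Stochasticity Df Dg F G σ) (hP : Sampling P T Df Dg ξ ζ) {t : ℕ} (ht : t ≤ T) :
    Measurable (s t) :=
  (hs.measurable_past hF t ht).mono (past_le hP t) le_rfl

theorem IsRun.obj_succ_le (hs : IsRun v F G W α β γ θ τ Lhg ι P T ξ ζ δ s₀ s)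
    (hW : Mixing W) (hτα : 0 ≤ τ * α) (hsmall : 16 * L * κ ^ 3 * (τ * α) ≤ 1) (t : ℕ) (ω : Ω) :
    M.obj (nodeAvg (s (t + 1) ω).x) ≤ M.obj (nodeAvg (s t ω).x) -
      τ * α / 4 * ‖nodeAvg (s t ω).h‖ ^ 2 + τ * α / 2 * M.errH (s t ω) := by
  rw [hs.step_eq]
  refine le_trans (le_of_eq ?_) (Landscape.obj_update_le hτα hsmall)
  exact congrArg M.obj (Landscape.nodeAvg_update_x (β := β) (γ := γ) (θ := θ) hW
    (a₁ := fun i => grad1 (F (ξ t i ω)) ((s t ω).x i) ((s t ω).y i))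
    (a₂ := fun i => grad2 (F (ξ t i ω)) ((s t ω).x i) ((s t ω).y i))
    (g₂ := fun i => grad2 (G (ζ t i ω)) ((s t ω).x i) ((s t ω).y i))
    (pH := fun i => pH v (G (ζ t i ω)) (δ t ω) ((s t ω).x i) ((s t ω).y i) ((s t ω).z i))
    (pJ := fun i => pJ v (G (ζ t i ω)) (δ t ω) ((s t ω).x i) ((s t ω).y i) ((s t ω).z i)))

theorem IsRun.measurable_obj (hs : IsRun v F G W α β γ θ τ Lhg ι P T ξ ζ δ s₀ s)
    (hF : Stochasticity Df Dg F G σ) (hP : Sampling P T Df Dg ξ ζ) {t : ℕ} (ht : t ≤ T) :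
    Measurable fun ω => M.obj (nodeAvg (s t ω).x) :=
  M.cont_obj.measurable.comp ((measurable_nodeAvg measurable_state_x).comp (hs.measurable hF hP ht))

/-- Integrability of the objective gap and of the square norm of `h̄` in one step. -/
theorem IsRun.integrable_gap_succ (hs : IsRun v F G W α β γ θ τ Lhg ι P T ξ ζ δ s₀ s)
    (hF : Stochasticity Df Dg F G σ) (hP : Sampling P T Df Dg ξ ζ) (hW : Mixing W)
    (hτα : 0 < τ * α) (hsmall : 16 * L * κ ^ 3 * (τ * α) ≤ 1) {m : ℝ} (hm : ∀ x, m ≤ M.obj x)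
    {t : ℕ} (ht : t < T) (hU : Integrable (fun ω => M.obj (nodeAvg (s t ω).x)) P)
    (hH : Integrable (fun ω => M.errH (s t ω)) P) :
    Integrable (fun ω => M.obj (nodeAvg (s (t + 1) ω).x)) P := by
  have h1 : Integrable (fun ω => M.obj (nodeAvg (s t ω).x) + τ * α / 2 * M.errH (s t ω) + |m|) P :=
    (hU.add (hH.const_mul _)).add (integrable_const _)
  have h2 : Integrable (fun ω => M.obj (nodeAvg (s t ω).x) + τ * α / 2 * M.errH (s t ω) + |m| + |m|)
    P := h1.add (integrable_const _)
  refine h2.mono' (hs.measurable_obj hF hP ht).aestronglyMeasurable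
    (Filter.Eventually.of_forall fun ω => ?_)
  have h3 := hs.obj_succ_le (M := M) hW hτα.le hsmall t ω
  have h4 := mul_nonneg hτα.le (sq_nonneg ‖nodeAvg (s t ω).h‖)
  have h5 := hm (nodeAvg (s (t + 1) ω).x)
  rw [Real.norm_eq_abs, abs_le]
  have := neg_abs_le m
  have := abs_nonneg m
  constructor <;> linarith

/-- The descent inequality dominates ‖h̄‖² by the objective gap and the error of h̄, because Φ is
bounded below. -/
theorem IsRun.integrable_norm_h (hs : IsRun v F G W α β γ θ τ Lhg ι P T ξ ζ δ s₀ s)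
    (hF : Stochasticity Df Dg F G σ) (hP : Sampling P T Df Dg ξ ζ) (hW : Mixing W)
    (hτα : 0 < τ * α) (hsmall : 16 * L * κ ^ 3 * (τ * α) ≤ 1) {m : ℝ} (hm : ∀ x, m ≤ M.obj x)
    {t : ℕ} (ht : t ≤ T) (hU : Integrable (fun ω => M.obj (nodeAvg (s t ω).x)) P)
    (hH : Integrable (fun ω => M.errH (s t ω)) P) :
    Integrable (fun ω => ‖nodeAvg (s t ω).h‖ ^ 2) P := by
  have h1 : Integrable (fun ω => (τ * α / 4)⁻¹ * (M.obj (nodeAvg (s t ω).x) +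
      τ * α / 2 * M.errH (s t ω) + -m)) P :=
    ((hU.add (hH.const_mul _)).add (integrable_const _)).const_mul _
  refine h1.mono' (((measurable_nodeAvg measurable_state_h).comp
    (hs.measurable hF hP ht)).norm.pow_const 2).aestronglyMeasurable
    (Filter.Eventually.of_forall fun ω => ?_)
  -- For t = T this involves iterate T + 1, but only pointwise and through the lower bound of Φ; its
  -- integrability is not needed.
  have h3 := hs.obj_succ_le (M := M) hW hτα.le hsmall t ω
  have h5 := hm (nodeAvg (s (t + 1) ω).x)
  rw [Real.norm_of_nonneg (sq_nonneg _), inv_mul_eq_div, le_div_iff₀ (by positivity)]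
  linarith

theorem IsRun.errorRecursion (hs : IsRun v F G W α β γ θ τ Lhg ι P T ξ ζ δ s₀ s)
    (hF : Stochasticity Df Dg F G σ) (hP : Sampling P T Df Dg ξ ζ)
    (hM : M.IsModelOf Df Dg F G Lhg) (hι : 0 ≤ ι) (hN : 1 ≤ N) (hL : 0 < L) (hκ : 1 ≤ κ)
    (hW : Mixing W) (hτα : 0 < τ * α) (hsmall : 16 * L * κ ^ 3 * (τ * α) ≤ 1) (hβ : 0 < β)
    (hβL : β * L ^ 2 ≤ L / κ) (hγ : 0 < γ) (hγL : γ * L ^ 2 ≤ L / κ) (hθ : 0 < θ) (hθ1 : θ ≤ 1)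
    (hR : ∀ x, M.obj (nodeAvg s₀.x) - M.obj x ≤ R) :
    (∀ t ≤ T, Integrable (fun ω => consensusError (s t ω)) P) ∧
    ErrorRecursion L κ b σ ι (mixRate W) R α β γ θ τ T (fun t => ∫ ω, M.errY (s t ω) ∂P)
      (fun t => ∫ ω, M.errZ (s t ω) ∂P) (fun t => ∫ ω, M.errH (s t ω) ∂P)
      (fun t => ∫ ω, spread (s t ω).h ∂P) (fun t => ∫ ω, consensusError (s t ω) ∂P)
      (fun t => ∫ ω, ‖nodeAvg (s t ω).h‖ ^ 2 ∂P) := by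
  have hCE : ∀ s : State N d p, 0 ≤ consensusError s := fun s => by
    rw [consensusError_eq]
    have := spread_nonneg s.x; have := spread_nonneg s.y; have := spread_nonneg s.z
    positivity
  -- In this and the next four facts, the vectors list the coefficients of the conditional bounds in
  -- the order of `Landscape.errors`: errors of ȳ, z̄, h̄, spread of h, consensus error, ‖h̄‖².
  have hY : ∀ t < T, (∀ i, Integrable (fun ω => M.errors (s t ω) i) P) → _ := fun t ht hint =>
    hs.integral_succ_le_affine hF hP hM hι (M.measurable_errY) M.errY_nonneg
      (fun Q _ s A₁ A₂ G₂ PH PJ hO => Landscape.errY_update_le (α := α) (γ := γ) (θ := θ) hN hL hκ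
        hW hβ hβL hτα.le hO)
      ![1 - β * (L / κ) / 2, 0, 0, 0, 6 * β * L ^ 2 / (L / κ),
        6 * κ ^ 2 * (τ * α) ^ 2 / (β * (L / κ))] (β ^ 2 * σ ^ 2)
      (fun s => by simp [Fin.sum_univ_succ, Landscape.errors]; ring) ht hint
  have hZ : ∀ t < T, (∀ i, Integrable (fun ω => M.errors (s t ω) i) P) → _ := fun t ht hint =>
    hs.integral_succ_le_affine hF hP hM hι (M.measurable_errZ) M.errZ_nonneg
      (fun Q _ s A₁ A₂ G₂ PH PJ hO => Landscape.errZ_update_le (α := α) (β := β) (θ := θ) hN hL hκ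
        hW hγ hγL hτα.le hO)
      ![18 * γ / (L / κ) * (4 * L ^ 2 * κ ^ 2), 1 - γ * (L / κ) / 2 + γ ^ 2 * (4 * σ ^ 2), 0, 0,
        18 * γ / (L / κ) * (4 * L ^ 2 * κ ^ 2) + γ ^ 2 * (4 * σ ^ 2),
        96 * κ ^ 6 * (τ * α) ^ 2 / (γ * (L / κ))]
      (18 * γ / (L / κ) * ι ^ 2 + γ ^ 2 * (2 * σ ^ 2 * (1 + 2 * κ ^ 2)))
      (fun s => by simp [Fin.sum_univ_succ, Landscape.errors, Landscape.noise]; ring) ht hint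
  have hH : ∀ t < T, (∀ i, Integrable (fun ω => M.errors (s t ω) i) P) → _ := fun t ht hint =>
    hs.integral_succ_le_affine hF hP hM hι (M.measurable_errH) M.errH_nonneg
      (fun Q _ s A₁ A₂ G₂ PH PJ hO => Landscape.errH_update_le (α := α) (β := β) (γ := γ) hN hκ
        hW hθ hθ1 hτα.le hO)
      ![6 * θ * (4 * L ^ 2 * κ ^ 2), 6 * θ * L ^ 2 + θ ^ 2 * (4 * σ ^ 2), 1 - θ, 0,
        6 * θ * (4 * L ^ 2 * κ ^ 2) + θ ^ 2 * (4 * σ ^ 2),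
        128 * L ^ 2 * κ ^ 6 * (τ * α) ^ 2 / θ]
      (6 * θ * ι ^ 2 + θ ^ 2 * (2 * σ ^ 2 * (1 + 2 * κ ^ 2)))
      (fun s => by
        simp [Fin.sum_univ_succ, Landscape.errors, Landscape.noise, Landscape.bias]; ring) ht hint
  have hS : ∀ t < T, (∀ i, Integrable (fun ω => M.errors (s t ω) i) P) → _ := fun t ht hint =>
    hs.integral_succ_le_affine hF hP hM hι (measurable_spread measurable_state_h)
      (fun s => spread_nonneg s.h)
      (fun Q _ s A₁ A₂ G₂ PH PJ hO => Landscape.spread_h_update_le (α := α) (β := β) (γ := γ)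
        (τ := τ) (W := W) hN hκ hθ hθ1 hO)
      ![6 * θ * (4 * L ^ 2 * κ ^ 2), 6 * θ * L ^ 2 + θ ^ 2 * (4 * σ ^ 2), 0, 1 - θ,
        6 * θ * (4 * L ^ 2 * κ ^ 2) + θ ^ 2 * (4 * σ ^ 2), 0]
      (6 * θ * ι ^ 2 + θ * (8 * κ ^ 2 * b ^ 2) + θ ^ 2 * (2 * σ ^ 2 * (1 + 2 * κ ^ 2)))
      (fun s => by
        simp [Fin.sum_univ_succ, Landscape.errors, Landscape.noise, Landscape.bias]; ring) ht hint
  have hD : ∀ t < T, (∀ i, Integrable (fun ω => M.errors (s t ω) i) P) → _ := fun t ht hint =>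
    hs.integral_succ_le_affine hF hP hM hι measurable_consensusError hCE
      (fun Q _ s A₁ A₂ G₂ PH PJ hO => Landscape.consensusError_update_le (α := α) (β := β) (γ := γ)
        (θ := θ) (τ := τ) hN hκ hW hO)
      ![(1 - mixRate W)⁻¹ * (β ^ 2 * (2 * L ^ 2) + γ ^ 2 * (24 * L ^ 2 * κ ^ 2)),
        (1 - mixRate W)⁻¹ * (γ ^ 2 * (6 * L ^ 2)) + γ ^ 2 * (4 * σ ^ 2), 0,
        (1 - mixRate W)⁻¹ * (τ * α) ^ 2,
        mixRate W + (1 - mixRate W)⁻¹ * (β ^ 2 * (2 * L ^ 2) + γ ^ 2 * (24 * L ^ 2 * κ ^ 2)) +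
          γ ^ 2 * (4 * σ ^ 2), 0]
      ((1 - mixRate W)⁻¹ * (β ^ 2 * (2 * b ^ 2) + γ ^ 2 * (6 * ι ^ 2 + 8 * κ ^ 2 * b ^ 2)) +
        β ^ 2 * σ ^ 2 + γ ^ 2 * (2 * σ ^ 2 * (1 + 2 * κ ^ 2)))
      (fun s => by
        simp [Fin.sum_univ_succ, Landscape.errors, Landscape.noise, Landscape.bias]; ring) ht hint
  have hm : ∀ x, M.obj (nodeAvg s₀.x) - R ≤ M.obj x := fun x => by linarith [hR x]
  -- Integrability of the objective belongs to the induction: together with that of the error of h̄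
  -- it yields integrability of ‖h̄‖², which the other bounds use in the next step.
  have hint : ∀ t ≤ T, (∀ i, Integrable (fun ω => M.errors (s t ω) i) P) ∧
      Integrable (fun ω => M.obj (nodeAvg (s t ω).x)) P := by
    intro t
    induction t with
    | zero =>
      intro _
      simp only [hs.init]
      exact ⟨fun _ => integrable_const _, integrable_const _⟩
    | succ t ih =>
      intro ht
      obtain ⟨h1, h2⟩ := ih (Nat.le_of_succ_le ht)
      have hU := hs.integrable_gap_succ hF hP hW hτα hsmall hm ht h2 (h1 2)
      refine ⟨fun i => ?_, hU⟩
      fin_cases i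
      · exact (hY t ht h1).1
      · exact (hZ t ht h1).1
      · exact (hH t ht h1).1
      · exact (hS t ht h1).1
      · exact (hD t ht h1).1
      · exact hs.integrable_norm_h hF hP hW hτα hsmall hm ht hU (hH t ht h1).1
  refine ⟨fun t ht => (hint t ht).1 4, ?_⟩
  constructor
  · exact fun t => integral_nonneg fun ω => M.errY_nonneg _
  · exact fun t => integral_nonneg fun ω => M.errZ_nonneg _
  · exact fun t => integral_nonneg fun ω => M.errH_nonneg _
  · exact fun t => integral_nonneg fun ω => spread_nonneg _
  · exact fun t => integral_nonneg fun ω => hCE _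
  · exact fun t => integral_nonneg fun ω => sq_nonneg _
  · intro t ht
    refine (hY t ht (hint t ht.le).1).2.trans_eq ?_
    simp [Fin.sum_univ_succ, Landscape.errors]; ring
  · intro t ht
    refine (hZ t ht (hint t ht.le).1).2.trans_eq ?_
    simp [Fin.sum_univ_succ, Landscape.errors]; ring
  · intro t ht
    refine (hH t ht (hint t ht.le).1).2.trans_eq ?_
    simp [Fin.sum_univ_succ, Landscape.errors]; ring
  · intro t ht
    refine (hS t ht (hint t ht.le).1).2.trans_eq ?_
    simp [Fin.sum_univ_succ, Landscape.errors]; ring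
  · intro t ht
    refine (hD t ht (hint t ht.le).1).2.trans_eq ?_
    simp [Fin.sum_univ_succ, Landscape.errors]; ring
  -- The descent inequalities telescope in expectation; the objective that is left over is at least
  -- its initial value minus `R`.
  · have key : ∀ t ≤ T, ∫ ω, M.obj (nodeAvg (s t ω).x) ∂P +
        τ * α / 4 * ∑ r ∈ Finset.range t, ∫ ω, ‖nodeAvg (s r ω).h‖ ^ 2 ∂P ≤
        M.obj (nodeAvg s₀.x) + τ * α / 2 * ∑ r ∈ Finset.range t, ∫ ω, M.errH (s r ω) ∂P := by
      intro t
      induction t with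
      | zero => intro _; simp [hs.init]
      | succ t ih =>
        intro ht
        obtain ⟨h1, h2⟩ := hint t (Nat.le_of_succ_le ht)
        have hb : Integrable (fun ω => ‖nodeAvg (s t ω).h‖ ^ 2) P := h1 5
        have hh : Integrable (fun ω => M.errH (s t ω)) P := h1 2
        have h3 := integral_mono (hint (t + 1) ht).2
          ((h2.sub (hb.const_mul (τ * α / 4))).add (hh.const_mul (τ * α / 2)))
          (hs.obj_succ_le hW hτα.le hsmall t)
        simp only [Pi.add_apply, Pi.sub_apply] at h3
        rw [integral_add (by exact h2.sub (hb.const_mul (τ * α / 4))) (hh.const_mul (τ * α / 2)),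
          integral_sub h2 (hb.const_mul (τ * α / 4)), integral_const_mul, integral_const_mul] at h3
        rw [Finset.sum_range_succ, Finset.sum_range_succ]
        linarith [ih (Nat.le_of_succ_le ht)]
    have h1 := key T le_rfl
    have h2 : M.obj (nodeAvg s₀.x) - R ≤ ∫ ω, M.obj (nodeAvg (s T ω).x) ∂P := by
      have := integral_mono (integrable_const (μ := P) (M.obj (nodeAvg s₀.x) - R))
        (hint T le_rfl).2 (fun ω => hm _)
      simpa using this
    linarith

end Recursion

/-! ### Summing the recursions over the iterations -/

theorem mul_sum_le_of_succ_le {a r : ℕ → ℝ} {q : ℝ} {T : ℕ} (ha : ∀ t, 0 ≤ a t)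
    (h : ∀ t < T, a (t + 1) ≤ (1 - q) * a t + r t) :
    q * ∑ t ∈ Finset.range T, a t ≤ a 0 + ∑ t ∈ Finset.range T, r t := by
  have key : ∀ n ≤ T, a n + q * ∑ t ∈ Finset.range n, a t ≤ a 0 + ∑ t ∈ Finset.range n, r t := by
    intro n
    induction n with
    | zero => simp
    | succ n ih =>
      intro hn
      rw [Finset.sum_range_succ, Finset.sum_range_succ]
      linarith [ih (Nat.le_of_succ_le hn), h n hn]
  linarith [key T le_rfl, ha T]

section Sums

variable {L κ b σ ι ρ R V α τ τ₁ c c' : ℝ} {T : ℕ} {Y Z H S D B : ℕ → ℝ}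

/-- The total noise in the updates of `z` and `h`. -/
noncomputable def totalNoise (σ κ : ℝ) (T : ℕ) (D Z : ℕ → ℝ) : ℝ :=
  2 * σ ^ 2 * ((1 + 2 * κ ^ 2) * T + 2 * (∑ t ∈ Finset.range T, D t + ∑ t ∈ Finset.range T, Z t))

/-- The total bias in the updates of `h`. -/
noncomputable def totalBias (L κ ι : ℝ) (T : ℕ) (D Y Z : ℕ → ℝ) : ℝ :=
  4 * L ^ 2 * κ ^ 2 * (∑ t ∈ Finset.range T, D t + ∑ t ∈ Finset.range T, Y t) +
    L ^ 2 * ∑ t ∈ Finset.range T, Z t + ι ^ 2 * T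

namespace ErrorRecursion

/-- Since β is proportional to α, division by the contraction rate leaves the initial error with
1/α, the bias and drift terms with coefficients free of α, and the noise with α. The drift
coefficient is proportional to (τ/c)², which a large c makes small. -/
theorem sum_Y_le (h : ErrorRecursion L κ b σ ι ρ R α (c * α) (c * α) (c' * α) τ T Y Z H S D B)
    (hL : 0 < L) (hκ : 0 < κ) (hc : 0 < c) (hα : 0 < α) :
    ∑ t ∈ Finset.range T, Y t ≤ 2 * κ / (c * L) * (Y 0 * α⁻¹) +
      12 * κ ^ 2 * ∑ t ∈ Finset.range T, D t +
      12 * κ ^ 4 * τ ^ 2 / (c ^ 2 * L ^ 2) * ∑ t ∈ Finset.range T, B t +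
      2 * κ * c * σ ^ 2 / L * (α * T) := by
  have h1 := mul_sum_le_of_succ_le h.Y_nonneg (q := c * α * (L / κ) / 2)
    (r := fun t => 6 * (c * α) * L ^ 2 / (L / κ) * D t +
      6 * κ ^ 2 * (τ * α) ^ 2 / (c * α * (L / κ)) * B t + (c * α) ^ 2 * σ ^ 2)
    fun t ht => (h.Y_succ t ht).trans_eq (by ring)
  rw [Finset.sum_add_distrib, Finset.sum_add_distrib, ← Finset.mul_sum, ← Finset.mul_sum,
    Finset.sum_const, Finset.card_range, nsmul_eq_mul] at h1
  refine le_of_mul_le_mul_left (h1.trans_eq ?_) (by positivity : 0 < c * α * (L / κ) / 2)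
  field_simp
  ring

theorem sum_Z_le (h : ErrorRecursion L κ b σ ι ρ R α (c * α) (c * α) (c' * α) τ T Y Z H S D B)
    (hL : 0 < L) (hκ : 0 < κ) (hc : 0 < c) (hα : 0 < α) :
    ∑ t ∈ Finset.range T, Z t ≤ 2 * κ / (c * L) * (Z 0 * α⁻¹) +
      36 * κ ^ 2 / L ^ 2 * (4 * L ^ 2 * κ ^ 2 * (∑ t ∈ Finset.range T, D t +
        ∑ t ∈ Finset.range T, Y t) + ι ^ 2 * T) +
      192 * κ ^ 8 * τ ^ 2 / (c ^ 2 * L ^ 2) * ∑ t ∈ Finset.range T, B t +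
      2 * κ * c / L * (α * totalNoise σ κ T D Z) := by
  have h1 := mul_sum_le_of_succ_le h.Z_nonneg (q := c * α * (L / κ) / 2)
    (r := fun t => 18 * (c * α) / (L / κ) * (4 * L ^ 2 * κ ^ 2) * D t +
      18 * (c * α) / (L / κ) * (4 * L ^ 2 * κ ^ 2) * Y t +
      96 * κ ^ 6 * (τ * α) ^ 2 / (c * α * (L / κ)) * B t +
      (c * α) ^ 2 * (4 * σ ^ 2) * D t + (c * α) ^ 2 * (4 * σ ^ 2) * Z t +
      (18 * (c * α) / (L / κ) * ι ^ 2 + (c * α) ^ 2 * (2 * σ ^ 2 * (1 + 2 * κ ^ 2))))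
    fun t ht => (h.Z_succ t ht).trans_eq (by ring)
  simp only [Finset.sum_add_distrib, ← Finset.mul_sum, Finset.sum_const, Finset.card_range,
    nsmul_eq_mul] at h1
  refine le_of_mul_le_mul_left (h1.trans_eq ?_) (by positivity : 0 < c * α * (L / κ) / 2)
  unfold totalNoise
  field_simp
  ring

theorem sum_H_le (h : ErrorRecursion L κ b σ ι ρ R α (c * α) (c * α) (c' * α) τ T Y Z H S D B)
    (hc : 0 < c') (hα : 0 < α) :
    ∑ t ∈ Finset.range T, H t ≤ 1 / c' * (H 0 * α⁻¹) + 6 * totalBias L κ ι T D Y Z +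
      128 * L ^ 2 * κ ^ 6 * τ ^ 2 / c' ^ 2 * ∑ t ∈ Finset.range T, B t +
      c' * (α * totalNoise σ κ T D Z) := by
  have h1 := mul_sum_le_of_succ_le h.H_nonneg (q := c' * α)
    (r := fun t => (6 * (c' * α) * (4 * L ^ 2 * κ ^ 2) + (c' * α) ^ 2 * (4 * σ ^ 2)) * D t +
      6 * (c' * α) * (4 * L ^ 2 * κ ^ 2) * Y t +
      (6 * (c' * α) * L ^ 2 + (c' * α) ^ 2 * (4 * σ ^ 2)) * Z t +
      128 * L ^ 2 * κ ^ 6 * (τ * α) ^ 2 / (c' * α) * B t +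
      (6 * (c' * α) * ι ^ 2 + (c' * α) ^ 2 * (2 * σ ^ 2 * (1 + 2 * κ ^ 2))))
    fun t ht => (h.H_succ t ht).trans_eq (by ring)
  simp only [Finset.sum_add_distrib, ← Finset.mul_sum, Finset.sum_const, Finset.card_range,
    nsmul_eq_mul] at h1
  refine le_of_mul_le_mul_left (h1.trans_eq ?_) (by positivity : 0 < c' * α)
  unfold totalNoise totalBias
  field_simp
  ring

theorem sum_S_le (h : ErrorRecursion L κ b σ ι ρ R α (c * α) (c * α) (c' * α) τ T Y Z H S D B)
    (hc : 0 < c') (hα : 0 < α) :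
    ∑ t ∈ Finset.range T, S t ≤ 1 / c' * (S 0 * α⁻¹) + 6 * totalBias L κ ι T D Y Z +
      8 * κ ^ 2 * (b ^ 2 * T) + c' * (α * totalNoise σ κ T D Z) := by
  have h1 := mul_sum_le_of_succ_le h.S_nonneg (q := c' * α)
    (r := fun t => (6 * (c' * α) * (4 * L ^ 2 * κ ^ 2) + (c' * α) ^ 2 * (4 * σ ^ 2)) * D t +
      6 * (c' * α) * (4 * L ^ 2 * κ ^ 2) * Y t +
      (6 * (c' * α) * L ^ 2 + (c' * α) ^ 2 * (4 * σ ^ 2)) * Z t +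
      (6 * (c' * α) * ι ^ 2 + (c' * α) * (8 * κ ^ 2 * b ^ 2) +
        (c' * α) ^ 2 * (2 * σ ^ 2 * (1 + 2 * κ ^ 2))))
    fun t ht => (h.S_succ t ht).trans_eq (by ring)
  simp only [Finset.sum_add_distrib, ← Finset.mul_sum, Finset.sum_const, Finset.card_range,
    nsmul_eq_mul] at h1
  refine le_of_mul_le_mul_left (h1.trans_eq ?_) (by positivity : 0 < c' * α)
  unfold totalNoise totalBias
  field_simp
  ring

theorem sum_D_le (h : ErrorRecursion L κ b σ ι ρ R α (c * α) (c * α) (c' * α) τ T Y Z H S D B) :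
    (1 - ρ) * ∑ t ∈ Finset.range T, D t ≤ D 0 + (1 - ρ)⁻¹ * α ^ 2 *
      (τ ^ 2 * ∑ t ∈ Finset.range T, S t + c ^ 2 * (2 * L ^ 2 * (∑ t ∈ Finset.range T, D t +
        ∑ t ∈ Finset.range T, Y t) + 6 * totalBias L κ ι T D Y Z +
        (2 + 8 * κ ^ 2) * (b ^ 2 * T))) +
      c ^ 2 * α ^ 2 * (σ ^ 2 * T + totalNoise σ κ T D Z) := by
  have h1 := mul_sum_le_of_succ_le h.D_nonneg (q := 1 - ρ)
    (r := fun t => (1 - ρ)⁻¹ * ((τ * α) ^ 2) * S t +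
      ((1 - ρ)⁻¹ * (c * α) ^ 2 * (2 * L ^ 2 + 24 * L ^ 2 * κ ^ 2) +
        (c * α) ^ 2 * (4 * σ ^ 2)) * D t +
      (1 - ρ)⁻¹ * (c * α) ^ 2 * (2 * L ^ 2 + 24 * L ^ 2 * κ ^ 2) * Y t +
      ((1 - ρ)⁻¹ * (c * α) ^ 2 * (6 * L ^ 2) + (c * α) ^ 2 * (4 * σ ^ 2)) * Z t +
      ((1 - ρ)⁻¹ * (c * α) ^ 2 * (2 * b ^ 2 + 6 * ι ^ 2 + 8 * κ ^ 2 * b ^ 2) +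
        (c * α) ^ 2 * σ ^ 2 + (c * α) ^ 2 * (2 * σ ^ 2 * (1 + 2 * κ ^ 2))))
    fun t ht => (h.D_succ t ht).trans_eq (by ring)
  simp only [Finset.sum_add_distrib, ← Finset.mul_sum, Finset.sum_const, Finset.card_range,
    nsmul_eq_mul] at h1
  refine h1.trans_eq ?_
  unfold totalNoise totalBias
  ring

/-- The lower bound τ ≥ τ₁κ⁻⁴ enters here: it bounds 4/τ independently of τ. -/
theorem sum_B_le (h : ErrorRecursion L κ b σ ι ρ R α (c * α) (c * α) (c' * α) τ T Y Z H S D B)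
    (hτ₁ : 0 < τ₁) (hκ : 0 < κ) (hα : 0 < α) (hR : 0 ≤ R) (hτ : τ₁ ≤ κ ^ 4 * τ) :
    ∑ t ∈ Finset.range T, B t ≤ 4 * κ ^ 4 / τ₁ * (R * α⁻¹) + 2 * ∑ t ∈ Finset.range T, H t := by
  have h0 := h.B_sum
  have hτ0 : 0 < τ := pos_of_mul_pos_right (hτ₁.trans_le hτ) (by positivity)
  have h1 : ∑ t ∈ Finset.range T, B t ≤ 4 / τ * (R * α⁻¹) + 2 * ∑ t ∈ Finset.range T, H t := by
    refine le_of_mul_le_mul_left (h0.trans_eq ?_) (by positivity : 0 < τ * α / 4)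
    field_simp
    ring
  have h2 : 4 / τ ≤ 4 * κ ^ 4 / τ₁ := by
    rw [div_le_div_iff₀ hτ0 hτ₁]; linarith
  have h3 := mul_le_mul_of_nonneg_right h2 (by positivity : 0 ≤ R * α⁻¹)
  linarith

end ErrorRecursion

end Sums

/-! ### Closing the loop between the errors and the motion of x̄ -/

section Absorption

variable {L κ σ V τ₁ τ₂ : ℝ}

/-- The total errors are controlled by the total consensus error. -/
theorem exists_sum_le_consensus (hL : 0 < L) (hκ : 1 ≤ κ) (hτ₁ : 0 < τ₁) (hτ₂ : 0 < τ₂)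
    (hV : 0 ≤ V) :
    ∃ a m : ℝ, 0 < a ∧ 0 ≤ m ∧ ∀ (b ι ρ α τ : ℝ) (T : ℕ) (Y Z H S D B : ℕ → ℝ),
      ErrorRecursion L κ b σ ι ρ V α (480 * τ₂ * α) (480 * τ₂ * α) (64 * τ₂ * L * α) τ T
        Y Z H S D B → Y 0 ≤ V → Z 0 ≤ V → H 0 ≤ V → S 0 ≤ V → 0 < α → α ≤ a →
      τ₁ ≤ κ ^ 4 * τ → κ ^ 4 * τ ≤ τ₂ →
      ∑ t ∈ Finset.range T, Y t ≤
        m * (α⁻¹ + ∑ t ∈ Finset.range T, D t + ι ^ 2 * T + α * T) ∧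
      ∑ t ∈ Finset.range T, Z t ≤
        m * (α⁻¹ + ∑ t ∈ Finset.range T, D t + ι ^ 2 * T + α * T) ∧
      ∑ t ∈ Finset.range T, S t ≤
        m * (α⁻¹ + ∑ t ∈ Finset.range T, D t + ι ^ 2 * T + α * T) + 8 * κ ^ 2 * (b ^ 2 * T) := by
  have hκ0 : 0 < κ := one_pos.trans_le hκ
  obtain ⟨c, hc⟩ : ∃ c, c = 480 * τ₂ := ⟨_, rfl⟩
  obtain ⟨c', hc'⟩ : ∃ c', c' = 64 * τ₂ * L := ⟨_, rfl⟩
  have hc0 : 0 < c := hc ▸ by positivity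
  have hc0' : 0 < c' := hc' ▸ by positivity
  obtain ⟨w, hw⟩ : ∃ w, w = 2 * κ / (c * L) := ⟨_, rfl⟩
  have hw0 : 0 < w := hw ▸ by positivity
  obtain ⟨n, hn⟩ : ∃ n, n = 2 * σ ^ 2 * (3 + 2 * κ ^ 2) := ⟨_, rfl⟩
  have hn0 : 0 ≤ n := hn ▸ by positivity
  obtain ⟨m₁, hm₁⟩ : ∃ m, m = w * V + 12 * κ ^ 2 + 2 * κ * c * σ ^ 2 / L := ⟨_, rfl⟩
  obtain ⟨m₂, hm₂⟩ : ∃ m, m = w * V + 144 * κ ^ 4 + 36 * κ ^ 2 / L ^ 2 + 2 * κ * c / L * n :=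
    ⟨_, rfl⟩
  obtain ⟨m₃, hm₃⟩ : ∃ m, m = 2 * m₂ + 288 * κ ^ 4 * m₁ := ⟨_, rfl⟩
  obtain ⟨m₄, hm₄⟩ : ∃ m, m = 1 / c' * V + 24 * L ^ 2 * κ ^ 2 + 6 + c' * n := ⟨_, rfl⟩
  obtain ⟨m₅, hm₅⟩ : ∃ m, m = m₄ + 24 * L ^ 2 * κ ^ 2 * m₁ + 7 * L ^ 2 * m₃ := ⟨_, rfl⟩
  obtain ⟨m₆, hm₆⟩ : ∃ m, m = 2 * (4 * κ ^ 4 / τ₁ * V + 2 * m₅) := ⟨_, rfl⟩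
  have hm₁0 : 0 ≤ m₁ := hm₁ ▸ by positivity
  have hm₂0 : 0 ≤ m₂ := hm₂ ▸ by positivity
  have hm₃0 : 0 ≤ m₃ := hm₃ ▸ by positivity
  have hm₄0 : 0 ≤ m₄ := hm₄ ▸ by positivity
  have hm₅0 : 0 ≤ m₅ := hm₅ ▸ by positivity
  have hm₆0 : 0 ≤ m₆ := hm₆ ▸ by positivity
  -- The two fractions make the feedback of ΣZ through the noise small, in its own bound and in
  -- those of ΣH and ΣS. The summands 1 in the denominators cover σ = 0.
  refine ⟨min 1 (min (L / (16 * κ * c * σ ^ 2 + 1)) (L ^ 2 / (4 * c' * σ ^ 2 + 1))),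
    m₁ + m₃ + m₅ + (1 / (19200 * L ^ 2 * κ ^ 4) + 1 / (60 * L ^ 2) + 1 / 4) * m₆,
    by positivity, by positivity, ?_⟩
  intro b ι ρ α τ T Y Z H S D B h hY hZ hH hS hα hαa hτ₁' hτ₂'
  rw [← hc, ← hc'] at h
  have hα1 : α ≤ 1 := hαa.trans (min_le_left _ _)
  have hα2 : α * (16 * κ * c * σ ^ 2) ≤ L := by
    have := hαa.trans ((min_le_right _ _).trans (min_le_left _ _))
    rw [le_div_iff₀ (by positivity)] at this
    linarith
  have hα3 : α * (4 * c' * σ ^ 2) ≤ L ^ 2 := by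
    have := hαa.trans ((min_le_right _ _).trans (min_le_right _ _))
    rw [le_div_iff₀ (by positivity)] at this
    linarith
  have hτ0 : 0 < κ ^ 4 * τ := hτ₁.trans_le hτ₁'
  have kY := h.sum_Y_le hL hκ0 hc0 hα
  have kZ := h.sum_Z_le hL hκ0 hc0 hα
  have kH := h.sum_H_le hc0' hα
  have kS := h.sum_S_le hc0' hα
  have kB := h.sum_B_le hτ₁ hκ0 hα hV hτ₁'
  unfold totalBias at kH kS
  unfold totalNoise at kZ kH kS
  have hSY : 0 ≤ ∑ t ∈ Finset.range T, Y t := Finset.sum_nonneg fun t _ => h.Y_nonneg t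
  have hSZ : 0 ≤ ∑ t ∈ Finset.range T, Z t := Finset.sum_nonneg fun t _ => h.Z_nonneg t
  have hSD : 0 ≤ ∑ t ∈ Finset.range T, D t := Finset.sum_nonneg fun t _ => h.D_nonneg t
  have hSB : 0 ≤ ∑ t ∈ Finset.range T, B t := Finset.sum_nonneg fun t _ => h.B_nonneg t
  -- From here on the sums are plain nonnegative numbers and the argument is a small-gain
  -- computation.
  generalize ∑ t ∈ Finset.range T, Y t = SY at *
  generalize ∑ t ∈ Finset.range T, Z t = SZ at *
  generalize ∑ t ∈ Finset.range T, D t = SD at *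
  generalize ∑ t ∈ Finset.range T, B t = SB at *
  generalize ∑ t ∈ Finset.range T, H t = SH at *
  generalize ∑ t ∈ Finset.range T, S t = SS at *
  have hX : 0 < α⁻¹ := inv_pos.2 hα
  generalize α⁻¹ = X at *
  have hI : 0 ≤ ι ^ 2 * T := by positivity
  generalize ι ^ 2 * (T : ℝ) = I at *
  have hA : 0 ≤ α * T := by positivity
  have hαSD : α * SD ≤ SD := mul_le_of_le_one_left hSD hα1
  obtain ⟨E, hE⟩ : ∃ E, E = X + SD + I + α * T := ⟨_, rfl⟩
  rw [← hE]
  have hE0 : 0 ≤ E := by linarith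
  have hbound : ∀ {x k : ℝ}, 0 ≤ k → x ≤ E → k * x ≤ k * E := fun hk hx =>
    mul_le_mul_of_nonneg_left hx hk
  have hVX : ∀ {x : ℝ}, x ≤ V → x * X ≤ V * E := fun hx =>
    mul_le_mul hx (by linarith) hX.le hV
  have noise : α * (2 * σ ^ 2 * ((1 + 2 * κ ^ 2) * T + 2 * (SD + SZ))) ≤
      n * E + α * (4 * σ ^ 2) * SZ := by
    have h1 : 2 * σ ^ 2 * (1 + 2 * κ ^ 2) * (α * T) ≤ 2 * σ ^ 2 * (1 + 2 * κ ^ 2) * E :=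
      hbound (by positivity) (by linarith)
    have h2 : 4 * σ ^ 2 * (α * SD) ≤ 4 * σ ^ 2 * E := hbound (by positivity) (by linarith)
    rw [hn]
    linarith
  -- With κ⁴τ ≤ τ₂, the choices c = 480τ₂ and c' = 64τ₂L make the drift coefficients 12/480²,
  -- 192/480² and 128/64², up to powers of L and κ.
  have tY : 12 * κ ^ 4 * τ ^ 2 / (c ^ 2 * L ^ 2) ≤ 1 / (19200 * L ^ 2 * κ ^ 4) := by
    have : (κ ^ 4 * τ) ^ 2 ≤ τ₂ ^ 2 := by gcongr
    rw [hc, div_le_div_iff₀ (by positivity) (by positivity)]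
    have := mul_le_mul_of_nonneg_left this (by positivity : 0 ≤ 230400 * L ^ 2)
    linarith
  have tZ : 192 * κ ^ 8 * τ ^ 2 / (c ^ 2 * L ^ 2) ≤ 1 / (1200 * L ^ 2) := by
    have : (κ ^ 4 * τ) ^ 2 ≤ τ₂ ^ 2 := by gcongr
    rw [hc, div_le_div_iff₀ (by positivity) (by positivity)]
    have := mul_le_mul_of_nonneg_left this (by positivity : 0 ≤ 230400 * L ^ 2)
    linarith
  have tH : 128 * L ^ 2 * κ ^ 6 * τ ^ 2 / c' ^ 2 ≤ 1 / 32 := by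
    have h1 : (κ ^ 4 * τ) ^ 2 ≤ τ₂ ^ 2 := by gcongr
    have h2 : κ ^ 6 * τ ^ 2 ≤ (κ ^ 4 * τ) ^ 2 := by
      rw [mul_pow, ← pow_mul]
      gcongr
      norm_num
    rw [hc', div_le_div_iff₀ (by positivity) (by positivity)]
    have := mul_le_mul_of_nonneg_left (h2.trans h1) (by positivity : 0 ≤ 4096 * L ^ 2)
    linarith
  have bY : SY ≤ m₁ * E + 1 / (19200 * L ^ 2 * κ ^ 4) * SB := by
    have h1 : w * (Y 0 * X) ≤ w * (V * E) :=
      mul_le_mul_of_nonneg_left (hVX hY) (by positivity)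
    have h2 : 12 * κ ^ 2 * SD ≤ 12 * κ ^ 2 * E := hbound (by positivity) (by linarith)
    have h3 : 2 * κ * c * σ ^ 2 / L * (α * T) ≤ 2 * κ * c * σ ^ 2 / L * E :=
      hbound (by positivity) (by linarith)
    have h4 := mul_le_mul_of_nonneg_right tY hSB
    rw [← hw] at kY
    rw [hm₁]
    linarith
  -- `h7` moves half of ΣZ to the left, which doubles the rest: 2(144/19200 + 1/1200) = 1/60.
  have bZ : SZ ≤ m₃ * E + 1 / (60 * L ^ 2) * SB := by
    have h1 : w * (Z 0 * X) ≤ w * (V * E) :=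
      mul_le_mul_of_nonneg_left (hVX hZ) (by positivity)
    have h2 : 144 * κ ^ 4 * SD ≤ 144 * κ ^ 4 * E := hbound (by positivity) (by linarith)
    have h3 : 36 * κ ^ 2 / L ^ 2 * I ≤ 36 * κ ^ 2 / L ^ 2 * E := hbound (by positivity) (by linarith)
    have h4 := mul_le_mul_of_nonneg_right tZ hSB
    have h5 : 36 * κ ^ 2 / L ^ 2 * (4 * L ^ 2 * κ ^ 2 * (SD + SY) + I) =
        144 * κ ^ 4 * SD + 144 * κ ^ 4 * SY + 36 * κ ^ 2 / L ^ 2 * I := by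
      field_simp; ring
    have h6 := mul_le_mul_of_nonneg_left noise (by positivity : 0 ≤ 2 * κ * c / L)
    have h7 : 2 * κ * c / L * (α * (4 * σ ^ 2)) ≤ 1 / 2 := by
      rw [div_mul_eq_mul_div, div_le_iff₀ hL]; linarith
    have h8 := mul_le_mul_of_nonneg_right h7 hSZ
    have h9 := mul_le_mul_of_nonneg_left bY (by positivity : 0 ≤ 144 * κ ^ 4)
    have h10 : 144 * κ ^ 4 * (1 / (19200 * L ^ 2 * κ ^ 4) * SB) + 1 / (1200 * L ^ 2) * SB =
        1 / 2 * (1 / (60 * L ^ 2) * SB) := by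
      field_simp; ring
    rw [← hw, h5] at kZ
    rw [hm₃, hm₂]
    linarith
  have bZ' := mul_le_mul_of_nonneg_left bZ (by positivity : 0 ≤ 7 * L ^ 2)
  have bY' := mul_le_mul_of_nonneg_left bY (by positivity : 0 ≤ 24 * L ^ 2 * κ ^ 2)
  have e1 : 7 * L ^ 2 * (1 / (60 * L ^ 2) * SB) = 7 / 60 * SB := by field_simp
  have e2 : 24 * L ^ 2 * κ ^ 2 * (1 / (19200 * L ^ 2 * κ ^ 4) * SB) ≤ 1 / 800 * SB := by
    have : 24 * L ^ 2 * κ ^ 2 * (1 / (19200 * L ^ 2 * κ ^ 4) * SB) = 1 / 800 * SB / κ ^ 2 := by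
      field_simp; ring
    rw [this]
    exact div_le_self (by positivity) (one_le_pow₀ hκ)
  have h6 := mul_le_mul_of_nonneg_left noise hc0'.le
  have h8 : c' * (α * (4 * σ ^ 2) * SZ) ≤ L ^ 2 * SZ := by
    have := mul_le_mul_of_nonneg_right hα3 hSZ
    linarith
  have h2 : 24 * L ^ 2 * κ ^ 2 * SD ≤ 24 * L ^ 2 * κ ^ 2 * E :=
    hbound (by positivity) (by linarith)
  -- The weight of ΣB is 1/32 directly, at most 1/800 through ΣY and 7/60 through ΣZ, where 7L² is
  -- 6L² from the bias plus L² from the noise. The total is below 1/4.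
  have bH : SH ≤ m₅ * E + 1 / 4 * SB := by
    have h1 : 1 / c' * (H 0 * X) ≤ 1 / c' * (V * E) :=
      mul_le_mul_of_nonneg_left (hVX hH) (by positivity)
    have h4 := mul_le_mul_of_nonneg_right tH hSB
    rw [hm₅, hm₄]
    linarith
  have bS : SS ≤ m₅ * E + 1 / 4 * SB + 8 * κ ^ 2 * (b ^ 2 * T) := by
    have h1 : 1 / c' * (S 0 * X) ≤ 1 / c' * (V * E) :=
      mul_le_mul_of_nonneg_left (hVX hS) (by positivity)
    rw [hm₅, hm₄]
    linarith
  -- Since ΣB carries twice ΣH, the loop gain is 1/2; absorbing it explains the factor 2 in m₆.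
  have bB : SB ≤ m₆ * E := by
    have h1 : 4 * κ ^ 4 / τ₁ * (V * X) ≤ 4 * κ ^ 4 / τ₁ * (V * E) :=
      mul_le_mul_of_nonneg_left (hVX le_rfl) (by positivity)
    rw [hm₆]
    linarith
  have q1 := mul_nonneg hm₁0 hE0
  have q3 := mul_nonneg hm₃0 hE0
  have q5 := mul_nonneg hm₅0 hE0
  have q6 := mul_nonneg hm₆0 hE0
  have r1 := mul_le_mul_of_nonneg_left bB (by positivity : 0 ≤ 1 / (19200 * L ^ 2 * κ ^ 4))
  have r2 := mul_le_mul_of_nonneg_left bB (by positivity : 0 ≤ 1 / (60 * L ^ 2))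
  have p1 := mul_nonneg (by positivity : 0 ≤ 1 / (19200 * L ^ 2 * κ ^ 4)) q6
  have p2 := mul_nonneg (by positivity : 0 ≤ 1 / (60 * L ^ 2)) q6
  refine ⟨?_, ?_, ?_⟩ <;> linarith

end Absorption

/-! ### The rate of the consensus error -/

section Rate

variable {L κ σ V τ₁ τ₂ A K : ℝ}

theorem sqrt_div_div_eq {N T : ℝ} (hN : 0 ≤ N) (hT : 0 < T) :
    √(N / T) / T = N ^ (1 / 2 : ℝ) / T ^ (3 / 2 : ℝ) := by
  have h : T ^ (3 / 2 : ℝ) = √T * T := by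
    rw [show (3 / 2 : ℝ) = 1 / 2 + 1 by norm_num, Real.rpow_add hT, Real.rpow_one,
      Real.sqrt_eq_rpow]
  rw [h, ← Real.sqrt_eq_rpow, Real.sqrt_div hN, div_div]

/-- The consensus error decays at the claimed rate. -/
theorem exists_consensus_rate (hL : 0 < L) (hκ : 1 ≤ κ) (hτ₁ : 0 < τ₁) (hτ₂ : 0 < τ₂)
    (hV : 0 ≤ V) (hA : 0 < A) (hK : 0 < K) :
    ∃ α₀ C : ℝ, 0 < α₀ ∧ 0 < C ∧ ∀ (b ι ρ α τ : ℝ) (N T : ℕ) (Y Z H S D B : ℕ → ℝ),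
      ErrorRecursion L κ b σ ι ρ V α (480 * τ₂ * α) (480 * τ₂ * α) (64 * τ₂ * L * α) τ T
        Y Z H S D B → Y 0 ≤ V → Z 0 ≤ V → H 0 ≤ V → S 0 ≤ V → D 0 ≤ V / N → 1 ≤ N → 1 ≤ T →
      0 ≤ ρ → ρ < 1 → 0 < α → α ≤ A * √((N : ℝ) / T) → α ≤ α₀ * (1 - ρ) →
      τ₁ ≤ κ ^ 4 * τ → κ ^ 4 * τ ≤ τ₂ → α * ι ^ 2 ≤ K / (N * T) →
      (1 / (T : ℝ)) * ∑ t ∈ Finset.range T, D t ≤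
        C * ((N : ℝ) / T * (b ^ 2 / (1 - ρ) ^ 2 + 1 / (1 - ρ)) +
          (N : ℝ) ^ (1 / 2 : ℝ) / ((T : ℝ) ^ (3 / 2 : ℝ) * (1 - ρ) ^ 2) +
          1 / ((1 - ρ) * N * T)) := by
  have hκ0 : 0 < κ := one_pos.trans_le hκ
  obtain ⟨a, m, ha, hm, key⟩ := exists_sum_le_consensus (σ := σ) hL hκ hτ₁ hτ₂ hV
  obtain ⟨c, hc⟩ : ∃ c, c = 480 * τ₂ := ⟨_, rfl⟩
  -- k₁ collects the coefficients of E, k₂ those of the heterogeneity b²T, and k₃ those of the pure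
  -- noise, which carries no (1 - ρ)⁻¹.
  obtain ⟨k₁, hk₁⟩ : ∃ k, k = τ₂ ^ 2 * m + c ^ 2 * (2 * L ^ 2 * (1 + m) +
    6 * (4 * L ^ 2 * κ ^ 2 * (1 + m) + L ^ 2 * m + 1)) + c ^ 2 * (4 * σ ^ 2 * (1 + m)) := ⟨_, rfl⟩
  obtain ⟨k₂, hk₂⟩ : ∃ k, k = 8 * κ ^ 2 * τ₂ ^ 2 + c ^ 2 * (2 + 8 * κ ^ 2) := ⟨_, rfl⟩
  obtain ⟨k₃, hk₃⟩ : ∃ k, k = c ^ 2 * (σ ^ 2 + 2 * σ ^ 2 * (1 + 2 * κ ^ 2)) := ⟨_, rfl⟩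
  have hk₁0 : 0 ≤ k₁ := hk₁ ▸ by positivity
  have hk₂0 : 0 ≤ k₂ := hk₂ ▸ by positivity
  have hk₃0 : 0 ≤ k₃ := hk₃ ▸ by positivity
  -- These give α ≤ 1 - ρ, α ≤ a and k₁α ≤ (1 - ρ)/2. The last one absorbs the ΣD contained in E.
  refine ⟨min (min 1 a) (1 / (2 * k₁ + 1)),
    2 * (V + k₁ * K + k₁ * A + (k₁ + k₃) * A ^ 2 + k₂ * A ^ 2) + 1, by positivity, by positivity,
    ?_⟩
  intro b ι ρ α τ N T Y Z H S D B h hY hZ hH hS hD hN hT hρ0 hρ hα hαA hαa hτ₁' hτ₂' hι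
  have hN' : (0 : ℝ) < N := by exact_mod_cast hN
  have hT' : (0 : ℝ) < T := by exact_mod_cast hT
  obtain ⟨r, hr⟩ : ∃ r, r = 1 - ρ := ⟨_, rfl⟩
  have hr0 : 0 < r := by linarith
  have hr1 : r ≤ 1 := by linarith
  rw [← hr] at hαa ⊢
  have hα1 : α ≤ r := hαa.trans (mul_le_of_le_one_left hr0.le
    ((min_le_left _ _).trans (min_le_left _ _)))
  have hα2 : α ≤ a := (hαa.trans (mul_le_of_le_one_right (by positivity) hr1)).trans
    ((min_le_left _ _).trans (min_le_right _ _))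
  have hα3 : k₁ * α ≤ r / 2 := by
    have h1 : α ≤ 1 / (2 * k₁ + 1) * r := hαa.trans (by gcongr; exact min_le_right _ _)
    rw [div_mul_eq_mul_div, one_mul, le_div_iff₀ (by positivity)] at h1
    linarith
  obtain ⟨bY, bZ, bS⟩ := key b ι ρ α τ T Y Z H S D B h hY hZ hH hS hα hα2 hτ₁' hτ₂'
  rw [← hc] at h
  have kD := h.sum_D_le
  rw [← hr] at kD
  have hSD : 0 ≤ ∑ t ∈ Finset.range T, D t := Finset.sum_nonneg fun t _ => h.D_nonneg t
  unfold totalBias totalNoise at kD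
  generalize ∑ t ∈ Finset.range T, Y t = SY at *
  generalize ∑ t ∈ Finset.range T, Z t = SZ at *
  generalize ∑ t ∈ Finset.range T, D t = SD at *
  generalize ∑ t ∈ Finset.range T, S t = SS at *
  obtain ⟨E, hE⟩ : ∃ E, E = α⁻¹ + SD + ι ^ 2 * T + α * T := ⟨_, rfl⟩
  rw [← hE] at bY bZ bS
  have hX : 0 < α⁻¹ := inv_pos.2 hα
  have hI : 0 ≤ ι ^ 2 * T := by positivity
  have hA' : 0 ≤ α * T := by positivity
  have hE0 : 0 ≤ E := by linarith
  have hτ0 : 0 < τ := pos_of_mul_pos_right (hτ₁.trans_le hτ₁') (by positivity)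
  have hττ : τ ≤ τ₂ := (le_mul_of_one_le_left hτ0.le (one_le_pow₀ hκ)).trans hτ₂'
  have hri : 1 ≤ r⁻¹ := (one_le_inv₀ hr0).2 hr1
  have s1 : r * SD ≤ V / N + r⁻¹ * α ^ 2 * (k₁ * E + k₂ * (b ^ 2 * T)) + k₃ * (α ^ 2 * T) := by
    have h1 : τ ^ 2 * SS ≤ τ₂ ^ 2 * (m * E + 8 * κ ^ 2 * (b ^ 2 * T)) := by
      calc τ ^ 2 * SS ≤ τ ^ 2 * (m * E + 8 * κ ^ 2 * (b ^ 2 * T)) := by gcongr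
        _ ≤ _ := by gcongr
    have h2 : 4 * L ^ 2 * κ ^ 2 * (SD + SY) + L ^ 2 * SZ + ι ^ 2 * T ≤
        4 * L ^ 2 * κ ^ 2 * (E + m * E) + L ^ 2 * (m * E) + E := by
      gcongr <;> linarith
    have h3 : 2 * L ^ 2 * (SD + SY) ≤ 2 * L ^ 2 * (E + m * E) := by gcongr; linarith
    have h4 : τ ^ 2 * SS + c ^ 2 * (2 * L ^ 2 * (SD + SY) + 6 * (4 * L ^ 2 * κ ^ 2 * (SD + SY) +
        L ^ 2 * SZ + ι ^ 2 * T) + (2 + 8 * κ ^ 2) * (b ^ 2 * T)) ≤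
        τ₂ ^ 2 * (m * E + 8 * κ ^ 2 * (b ^ 2 * T)) + c ^ 2 * (2 * L ^ 2 * (E + m * E) +
        6 * (4 * L ^ 2 * κ ^ 2 * (E + m * E) + L ^ 2 * (m * E) + E) +
        (2 + 8 * κ ^ 2) * (b ^ 2 * T)) := by gcongr
    have h5 := mul_le_mul_of_nonneg_left h4 (by positivity : 0 ≤ r⁻¹ * α ^ 2)
    have h6 : c ^ 2 * α ^ 2 * (σ ^ 2 * T + 2 * σ ^ 2 * ((1 + 2 * κ ^ 2) * T + 2 * (SD + SZ))) ≤
        c ^ 2 * α ^ 2 * (σ ^ 2 * T + 2 * σ ^ 2 * ((1 + 2 * κ ^ 2) * T + 2 * (E + m * E))) := by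
      gcongr; linarith
    -- The part of the noise proportional to E is enlarged by (1 - ρ)⁻¹ ≥ 1 so that it merges into
    -- k₁.
    have h7 : 1 * (c ^ 2 * α ^ 2 * (4 * σ ^ 2 * (1 + m) * E)) ≤
        r⁻¹ * (c ^ 2 * α ^ 2 * (4 * σ ^ 2 * (1 + m) * E)) := by gcongr
    rw [hk₁, hk₂, hk₃]
    linarith
  -- The four parts of E: 1/α gives the term with √(N/T), ΣD is absorbed, ι²T is at most of order
  -- 1/N after multiplication by α, and αT joins the noise.
  have e1 : r⁻¹ * α ^ 2 * (k₁ * E) = k₁ * (r⁻¹ * α) + r⁻¹ * α * (k₁ * α) * SD +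
      k₁ * (r⁻¹ * α * (α * ι ^ 2 * T)) + k₁ * (r⁻¹ * α * (α ^ 2 * T)) := by
    rw [hE]; field_simp
  have hrα : r⁻¹ * α ≤ 1 := by rw [inv_mul_le_iff₀ hr0]; linarith
  have s2 : r⁻¹ * α * (k₁ * α) * SD ≤ r / 2 * SD := by
    have : r⁻¹ * α * (k₁ * α) ≤ 1 * (r / 2) := by gcongr
    rw [one_mul] at this
    gcongr
  have s3 : r⁻¹ * α * (α * ι ^ 2 * T) ≤ K / N := by
    calc r⁻¹ * α * (α * ι ^ 2 * T) ≤ 1 * (K / (N * T) * T) := by gcongr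
      _ = K / N := by field_simp
  have s4 : r⁻¹ * α * (α ^ 2 * T) ≤ α ^ 2 * T := mul_le_of_le_one_left (by positivity) hrα
  have s5 : α ^ 2 * T ≤ A ^ 2 * N := by
    calc α ^ 2 * T ≤ (A * √((N : ℝ) / T)) ^ 2 * T := by gcongr
      _ = A ^ 2 * N := by
        rw [mul_pow, Real.sq_sqrt (by positivity)]; field_simp
  have s6 : r⁻¹ * α ^ 2 * (k₂ * (b ^ 2 * T)) ≤ r⁻¹ * (k₂ * b ^ 2 * (A ^ 2 * N)) := by
    calc r⁻¹ * α ^ 2 * (k₂ * (b ^ 2 * T)) = r⁻¹ * (k₂ * b ^ 2 * (α ^ 2 * T)) := by ring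
      _ ≤ _ := by gcongr
  have s7 : r⁻¹ * α ≤ r⁻¹ * (A * √((N : ℝ) / T)) := by gcongr
  have s8 : r * SD ≤ 2 * (V / N + k₁ * (r⁻¹ * (A * √((N : ℝ) / T))) + k₁ * (K / N) +
      (k₁ + k₃) * (A ^ 2 * N) + r⁻¹ * (k₂ * b ^ 2 * (A ^ 2 * N))) := by
    have t2 := mul_le_mul_of_nonneg_left s3 hk₁0
    have t3 := mul_le_mul_of_nonneg_left (s4.trans s5) hk₁0
    have t4 := mul_le_mul_of_nonneg_left s5 hk₃0
    have t5 := mul_le_mul_of_nonneg_left s7 hk₁0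
    rw [mul_add, e1] at s1
    linarith
  -- Dividing by (1 - ρ)T gives exactly the four terms of the rate.
  have s9 : 1 / (T : ℝ) * SD ≤ 2 * ((V + k₁ * K) * (1 / (r * N * T)) +
      k₁ * A * (√((N : ℝ) / T) / T / r ^ 2) + (k₁ + k₃) * A ^ 2 * ((N : ℝ) / T * (1 / r)) +
      k₂ * A ^ 2 * ((N : ℝ) / T * (b ^ 2 / r ^ 2))) := by
    refine le_of_mul_le_mul_left (le_trans (le_of_eq ?_) (s8.trans_eq ?_))
      (by positivity : 0 < r * T)
    · field_simp
    · field_simp; ring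
  rw [sqrt_div_div_eq hN'.le hT', div_div] at s9
  have f1 : 0 ≤ 1 / (r * N * T) := by positivity
  have f2 : 0 ≤ (N : ℝ) ^ (1 / 2 : ℝ) / ((T : ℝ) ^ (3 / 2 : ℝ) * r ^ 2) := by positivity
  have f3 : 0 ≤ (N : ℝ) / T * (1 / r) := by positivity
  have f4 : 0 ≤ (N : ℝ) / T * (b ^ 2 / r ^ 2) := by positivity
  generalize 1 / (r * N * T) = x₁ at *
  generalize (N : ℝ) ^ (1 / 2 : ℝ) / ((T : ℝ) ^ (3 / 2 : ℝ) * r ^ 2) = x₂ at *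
  rw [mul_add ((N : ℝ) / T)]
  generalize (N : ℝ) / T * (1 / r) = x₃ at *
  generalize (N : ℝ) / T * (b ^ 2 / r ^ 2) = x₄ at *
  have hsum : ∀ {k C x : ℝ}, k ≤ C → 0 ≤ x → k * x ≤ C * x := fun hk hx =>
    mul_le_mul_of_nonneg_right hk hx
  have p1 : 0 ≤ k₁ * K := by positivity
  have p2 : 0 ≤ k₁ * A := by positivity
  have p3 : 0 ≤ (k₁ + k₃) * A ^ 2 := by positivity
  have p4 : 0 ≤ k₂ * A ^ 2 := by positivity
  obtain ⟨C, hC⟩ : ∃ C, C = 2 * (V + k₁ * K + k₁ * A + (k₁ + k₃) * A ^ 2 + k₂ * A ^ 2) + 1 :=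
    ⟨_, rfl⟩
  rw [← hC]
  have g1 : 2 * (V + k₁ * K) * x₁ ≤ C * x₁ := hsum (by linarith) f1
  have g2 : 2 * (k₁ * A) * x₂ ≤ C * x₂ := hsum (by linarith) f2
  have g3 : 2 * ((k₁ + k₃) * A ^ 2) * x₃ ≤ C * x₃ := hsum (by linarith) f3
  have g4 : 2 * (k₂ * A ^ 2) * x₄ ≤ C * x₄ := hsum (by linarith) f4
  linarith

end Rate

/-- One gradient step of length 1/(8Lκ³) decreases Φ by at least ‖∇Φ‖²/(16Lκ³), which cannot exceed
the gap. This bounds the initial error of h̄ by the initial data. -/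
theorem Landscape.norm_objGrad_sq_le {N d p : ℕ} {L κ b R : ℝ} (M : Landscape N d p L κ b)
    (hL : 0 < L) (hκ : 0 < κ) {x : Vec d} (h : ∀ x', M.obj x - M.obj x' ≤ R) :
    ‖M.objGrad x‖ ^ 2 ≤ 16 * L * κ ^ 3 * R := by
  have h1 := M.descent x (x - (8 * L * κ ^ 3)⁻¹ • M.objGrad x)
  rw [sub_sub_cancel_left, inner_neg_right, inner_smul_right, real_inner_self_eq_norm_sq, norm_neg,
    norm_smul, mul_pow, Real.norm_eq_abs, sq_abs] at h1
  have h2 : 4 * L * κ ^ 3 * ((8 * L * κ ^ 3)⁻¹ ^ 2 * ‖M.objGrad x‖ ^ 2) =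
      (16 * L * κ ^ 3)⁻¹ * ‖M.objGrad x‖ ^ 2 := by field_simp; ring
  have h3 : (8 * L * κ ^ 3)⁻¹ * ‖M.objGrad x‖ ^ 2 =
      2 * ((16 * L * κ ^ 3)⁻¹ * ‖M.objGrad x‖ ^ 2) := by field_simp; ring
  have h4 := h (x - (8 * L * κ ^ 3)⁻¹ • M.objGrad x)
  have h5 : (16 * L * κ ^ 3)⁻¹ * ‖M.objGrad x‖ ^ 2 ≤ R := by linarith
  rwa [inv_mul_le_iff₀ (by positivity)] at h5

/-! ### Initial errors -/

section Initial

variable {N d p : ℕ} {L κ b R : ℝ} {f g : Vec d → Vec p → ℝ} {s₀ : State N d p}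
  {M : Landscape N d p L κ b}

theorem InitBound.errY_le (h : InitBound f g s₀ R) (hy : M.yStar = lowerSol g) :
    M.errY s₀ ≤ R := by
  rw [Landscape.errY, hy]; exact h.lower

theorem InitBound.errZ_le (h : InitBound f g s₀ R) : M.errZ s₀ ≤ 2 * R + 2 * κ ^ 2 := by
  have h1 := norm_sub_sq_le_two (nodeAvg s₀.z) (M.zStar (nodeAvg s₀.x))
  have h2 : ‖M.zStar (nodeAvg s₀.x)‖ ^ 2 ≤ κ ^ 2 := by gcongr; exact M.norm_zStar _
  unfold Landscape.errZ
  linarith [h.aux]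

theorem InitBound.errH_le (h : InitBound f g s₀ R) (hN : 1 ≤ N) (hL : 0 < L) (hκ : 0 < κ)
    (hobj : M.obj = hyperObj f g) : M.errH s₀ ≤ 2 * R + 32 * L * κ ^ 3 * R := by
  have h1 := norm_sub_sq_le_two (nodeAvg s₀.h) (M.objGrad (nodeAvg s₀.x))
  have h2 := M.norm_objGrad_sq_le hL hκ (x := nodeAvg s₀.x) (R := R) fun x' => hobj ▸ h.gap x'
  unfold Landscape.errH
  linarith [h.momentum, norm_nodeAvg_sq_le hN s₀.h]

theorem InitBound.spread_h_le (h : InitBound f g s₀ R) (hN : 1 ≤ N) : spread s₀.h ≤ R := by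
  have := spread_le hN s₀.h 0
  simp only [sub_zero] at this
  exact this.trans h.momentum

theorem InitBound.nonneg (h : InitBound f g s₀ R) : 0 ≤ R := (sq_nonneg _).trans h.lower

end Initial

/-- The perturbations are arbitrary in the second-order variant; this permits replacing them by a
constant, which is measurable with respect to every past. -/
theorem iterate_SO_eq {N d p : ℕ} {S Z : Type*} (F : S → Vec d → Vec p → ℝ)
    (G : Z → Vec d → Vec p → ℝ) (W : Matrix (Fin N) (Fin N) ℝ) (η : StepSizes)
    (s₀ : State N d p) (δ δ' : ℕ → ℝ) (ξ : ℕ → Fin N → S) (ζ : ℕ → Fin N → Z) (t : ℕ) :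
    iterate .SO F G W η s₀ δ ξ ζ t = iterate .SO F G W η s₀ δ' ξ ζ t := by
  induction t with
  | zero => rfl
  | succ t ih => rw [iterate, iterate, ih]; rfl

theorem isRun_of_iterate {N d p T : ℕ} {Ω S Z : Type*} [MeasurableSpace Ω] [MeasurableSpace S]
    [MeasurableSpace Z] {P : Measure Ω} {F : S → Vec d → Vec p → ℝ} {G : Z → Vec d → Vec p → ℝ}
    {W : Matrix (Fin N) (Fin N) ℝ} {η : StepSizes} {s₀ : State N d p} {v : Variant}
    {α β γ θ τ Lhg ι : ℝ} {δ : ℕ → Ω → ℝ} {ξ : ℕ → Fin N → Ω → S} {ζ : ℕ → Fin N → Ω → Z}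
    {s : ℕ → Ω → State N d p} (hα : ∀ t, η.α t = α) (hβ : ∀ t, η.β t = β) (hγ : ∀ t, η.γ t = γ)
    (hθ : ∀ t, η.θ t = θ) (hτ : η.τ = τ)
    (hs : ∀ t ω, s t ω = iterate v F G W η s₀ (fun r => δ r ω) (fun r i => ξ r i ω)
      (fun r i => ζ r i ω) t)
    (hδ : ∀ t < T, Measurable[past ξ ζ t] (δ t))
    (hsmall : v = Variant.FO → ∀ t < T, ∀ᵐ ω ∂P,
      0 < δ t ω ∧ ∀ i, Lhg * δ t ω * ‖(s t ω).z i‖ ^ 2 ≤ ι) :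
    IsRun v F G W α β γ θ τ Lhg ι P T ξ ζ δ s₀ s where
  init ω := hs 0 ω
  step_eq t ω := by rw [hs (t + 1) ω, iterate, ← hs t ω, hα, hβ, hγ, hθ, hτ]
  meas_δ := hδ
  small := hsmall

end DSOBA

/-! ### The main theorem -/

theorem corollary2
    (Lgf Lgg Lhg Lf : ℝ) (hLgf : 0 < Lgf) (hLgg : 0 < Lgg) (hLhg : 0 < Lhg) (hLf : 0 < Lf)
    (τ₁ τ₂ : ℝ) (hτ₁ : 0 < τ₁) (hτ₂ : τ₁ ≤ τ₂) :
    ∃ c₁ c₂ c₃ : ℝ, 0 < c₁ ∧ 0 < c₂ ∧ 0 < c₃ ∧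
    ∀ μ σ R A K κ : ℝ, 0 < μ → 0 ≤ σ → 0 < A → 0 < K →
      κ = max (max Lf Lgf) (max Lgg Lhg) / μ →
    ∃ α₀ C : ℝ, 0 < α₀ ∧ 0 < C ∧
    ∀ (N d p T : ℕ), 1 ≤ N → 1 ≤ d → 1 ≤ p → 1 ≤ T →
    ∀ (S Z Ω : Type*) [MeasurableSpace S] [MeasurableSpace Z] [MeasurableSpace Ω]
      (P : MeasureTheory.Measure Ω) [MeasureTheory.IsProbabilityMeasure P]
      (Df : Fin N → MeasureTheory.Measure S) (Dg : Fin N → MeasureTheory.Measure Z)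
      (F : S → DSOBA.Vec d → DSOBA.Vec p → ℝ) (G : Z → DSOBA.Vec d → DSOBA.Vec p → ℝ)
      (W : Matrix (Fin N) (Fin N) ℝ) (ξ : ℕ → Fin N → Ω → S) (ζ : ℕ → Fin N → Ω → Z)
      (s₀ : DSOBA.State N d p) (b₁ b₂ b ρ α τ ι : ℝ) (δ : ℕ → Ω → ℝ)
      (v : DSOBA.Variant) (η : DSOBA.StepSizes) (s : ℕ → Ω → DSOBA.State N d p),
    -- the standing assumptions
    DSOBA.Smoothness (DSOBA.localLoss Df F) (DSOBA.localLoss Dg G) Lgf Lgg Lhg Lf μ →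
    0 ≤ b₁ → 0 ≤ b₂ → b = max b₁ b₂ →
    DSOBA.Dissimilarity (DSOBA.localLoss Df F) (DSOBA.localLoss Dg G) b₁ b₂ →
    DSOBA.Stochasticity Df Dg F G σ →
    DSOBA.Mixing W → ρ = DSOBA.mixRate W →
    DSOBA.Sampling P T Df Dg ξ ζ →
    DSOBA.InitBound (DSOBA.globalLoss (DSOBA.localLoss Df F))
      (DSOBA.globalLoss (DSOBA.localLoss Dg G)) s₀ R →
    -- the hyperparameters
    0 < α → α ≤ A * √((N : ℝ) / T) → α ≤ α₀ * (1 - ρ) →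
    τ₁ * κ⁻¹ ^ 4 ≤ τ → τ ≤ τ₂ * κ⁻¹ ^ 4 →
    (∀ t, η.α t = α) → (∀ t, η.β t = c₁ * α) → (∀ t, η.γ t = c₂ * α) →
    (∀ t, η.θ t = c₃ * α) → η.τ = τ →
    -- the iterates
    (∀ t ω, s t ω =
      DSOBA.iterate v F G W η s₀ (fun r => δ r ω) (fun r i => ξ r i ω) (fun r i => ζ r i ω) t) →
    -- the finite-difference perturbation, in the first-order variant
    (v = DSOBA.Variant.FO →
      0 < ι ∧ α * ι ^ 2 + ρ ^ 2 * α ^ 2 * ι ^ 2 / (1 - ρ) ^ 2 ≤ K / (N * T) ∧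
      ∀ t < T, Measurable[DSOBA.past ξ ζ t] (δ t) ∧
        ∀ᵐ ω ∂P, 0 < δ t ω ∧ ∀ i, Lhg * δ t ω * ‖(s t ω).z i‖ ^ 2 ≤ √3 * ι) →
    (∀ t < T, MeasureTheory.Integrable (fun ω => DSOBA.consensusError (s t ω)) P) ∧
    (1 / (T : ℝ)) * ∑ t ∈ Finset.range T, ∫ ω, DSOBA.consensusError (s t ω) ∂P ≤
      C * ((N : ℝ) / T * (b ^ 2 / (1 - ρ) ^ 2 + 1 / (1 - ρ)) +
        (N : ℝ) ^ (1 / 2 : ℝ) / ((T : ℝ) ^ (3 / 2 : ℝ) * (1 - ρ) ^ 2) +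
        1 / ((1 - ρ) * N * T)) := by
  open DSOBA in
  obtain ⟨L, hLdef⟩ : ∃ L, L = max (max Lf Lgf) (max Lgg Lhg) := ⟨_, rfl⟩
  have hLf' : Lf ≤ L := hLdef ▸ (le_max_left _ _).trans (le_max_left _ _)
  have hLgf' : Lgf ≤ L := hLdef ▸ (le_max_right _ _).trans (le_max_left _ _)
  have hLgg' : Lgg ≤ L := hLdef ▸ (le_max_left _ _).trans (le_max_right _ _)
  have hLhg' : Lhg ≤ L := hLdef ▸ (le_max_right _ _).trans (le_max_right _ _)
  have hL : 0 < L := hLf.trans_le hLf'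
  have hτ₂0 : 0 < τ₂ := hτ₁.trans_le hτ₂
  refine ⟨480 * τ₂, 480 * τ₂, 64 * τ₂ * L, by positivity, by positivity, by positivity, ?_⟩
  intro μ σ R A K κ hμ hσ hA hK hκ
  rw [← hLdef] at hκ
  -- The constants are chosen before the problem. If κ < 1 or R < 0 no problem satisfies the
  -- hypotheses, so any constants do.
  by_cases hreg : 1 ≤ κ ∧ 0 ≤ R
  swap
  · refine ⟨1, 1, one_pos, one_pos, ?_⟩
    intro N d p T hN hd hp hT S Z Ω _ _ _ P _ Df Dg F G W ξ ζ s₀ b₁ b₂ b ρ α τ ι δ v η s hsm _ _ _ _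
      _ _ _ _ hinit
    refine absurd ⟨?_, hinit.nonneg⟩ hreg
    rw [hκ, le_div_iff₀ hμ, one_mul]
    exact ((hsm.mono hLgf' hLgg' hLhg' hLf').global hN).le_lip hp
  obtain ⟨hκ1, hR⟩ := hreg
  have hκ0 : 0 < κ := one_pos.trans_le hκ1
  -- One bound for all initial data: the objective gap, the errors of ȳ, z̄, h̄, the spread of h and
  -- the total dispersion.
  obtain ⟨V, hV⟩ : ∃ V, V = 2 * R + 2 * κ ^ 2 + 32 * L * κ ^ 3 * R := ⟨_, rfl⟩
  have hV1 : 0 ≤ 32 * L * κ ^ 3 * R := by positivity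
  have hV2 : 0 ≤ 2 * κ ^ 2 := by positivity
  have hRV : R ≤ V := by linarith
  -- The bias is bounded by √3 ι, so its square brings the factor 3 in front of K.
  obtain ⟨a, C, ha, hC, key⟩ := exists_consensus_rate (σ := σ) hL hκ1 hτ₁ hτ₂0 (hR.trans hRV) hA
    (by positivity : 0 < 3 * K)
  -- The second bound ensures all step size conditions at once: 16Lκ³τα ≤ 1 for descent, βL² ≤ L/κ
  -- and γL² ≤ L/κ for contraction, and θ ≤ 1.
  refine ⟨min a (1 / (480 * τ₂ * L * κ ^ 3)), C, by positivity, hC, ?_⟩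
  intro N d p T hN hd hp hT S Z Ω _ _ _ P _ Df Dg F G W ξ ζ s₀ b₁ b₂ b ρ α τ ι δ v η s hsm hb₁ hb₂ hb
    hdis hF hW hρ hP hinit hα hαA hαα hτl hτu hηα hηβ hηγ hηθ hητ hs hFO
  have hρ0 : 0 ≤ ρ := hρ ▸ mixRate_nonneg W
  have hρ1 : ρ < 1 := hρ ▸ hW.rate_lt_one
  have hτ1 : τ₁ ≤ κ ^ 4 * τ := by
    rw [inv_pow, ← div_eq_mul_inv, div_le_iff₀ (by positivity)] at hτl; linarith
  have hτ2 : κ ^ 4 * τ ≤ τ₂ := by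
    rw [inv_pow, ← div_eq_mul_inv, le_div_iff₀ (by positivity)] at hτu; linarith
  have hτ0 : 0 < τ := pos_of_mul_pos_right (hτ₁.trans_le hτ1) (by positivity)
  have hττ : τ ≤ τ₂ := (le_mul_of_one_le_left hτ0.le (one_le_pow₀ hκ1)).trans hτ2
  have hαa : α ≤ a * (1 - ρ) :=
    hαα.trans (mul_le_mul_of_nonneg_right (min_le_left _ _) (by linarith))
  have hαs : 480 * τ₂ * L * κ ^ 3 * α ≤ 1 := by
    have h1 : α ≤ 1 / (480 * τ₂ * L * κ ^ 3) :=
      (hαα.trans (mul_le_of_le_one_right (by positivity) (by linarith))).trans (min_le_right _ _)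
    rw [le_div_iff₀ (by positivity)] at h1
    linarith
  have hκ3 : κ ≤ κ ^ 3 := le_self_pow₀ hκ1 (by norm_num)
  have hsmall : 16 * L * κ ^ 3 * (τ * α) ≤ 1 := by
    have : 16 * L * κ ^ 3 * (τ * α) ≤ 16 * L * κ ^ 3 * (τ₂ * α) := by gcongr
    have : 0 ≤ L * κ ^ 3 * (τ₂ * α) := by positivity
    linarith
  have hβL : 480 * τ₂ * α * L ^ 2 ≤ L / κ := by
    rw [le_div_iff₀ hκ0]
    calc 480 * τ₂ * α * L ^ 2 * κ = L * (480 * τ₂ * L * κ * α) := by ring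
      _ ≤ L * (480 * τ₂ * L * κ ^ 3 * α) := by gcongr
      _ ≤ L * 1 := by gcongr
      _ = L := mul_one L
  have hθ1 : 64 * τ₂ * L * α ≤ 1 := by
    have h1 : 480 * τ₂ * L * 1 * α ≤ 480 * τ₂ * L * κ ^ 3 * α := by
      gcongr; exact one_le_pow₀ hκ1
    have : 0 ≤ τ₂ * L * α := by positivity
    linarith
  have hsmL := hsm.mono hLgf' hLgg' hLhg' hLf'
  obtain ⟨M, hM⟩ : ∃ M : Landscape N d p L κ b,
      M = hsmL.landscape hN hμ hκ hκ1 hdis hb₁ hb₂ hb := ⟨_, rfl⟩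
  have hMod : M.IsModelOf Df Dg F G Lhg := by
    subst hM
    exact ⟨rfl, rfl, rfl, rfl, rfl, hLhg.le, hsm.diff_g, hsm.diff_grad_g, hsm.lip_hess_g⟩
  have hMy : M.yStar = lowerSol (globalLoss (localLoss Dg G)) := by subst hM; rfl
  have hMo : M.obj = hyperObj (globalLoss (localLoss Df F)) (globalLoss (localLoss Dg G)) := by
    subst hM; rfl
  -- Both variants become a run with bias ι': zero in the second-order variant, with dummy
  -- perturbations 1, and √3 ι in the first-order one.
  obtain ⟨ι', δ', hι0, hι', hrun⟩ : ∃ (ι' : ℝ) (δ' : ℕ → Ω → ℝ), 0 ≤ ι' ∧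
      α * ι' ^ 2 ≤ 3 * K / (N * T) ∧
      IsRun v F G W α (480 * τ₂ * α) (480 * τ₂ * α) (64 * τ₂ * L * α) τ Lhg ι' P T ξ ζ δ' s₀ s := by
    cases v with
    | SO =>
      refine ⟨0, fun _ _ => 1, le_rfl, by simp; positivity,
        isRun_of_iterate hηα hηβ hηγ hηθ hητ (fun t ω => ?_) (fun t _ => measurable_const) nofun⟩
      rw [hs t ω]
      exact iterate_SO_eq F G W η s₀ _ _ _ _ t
    | FO =>
      obtain ⟨hι, hιK, hδ⟩ := hFO rfl
      refine ⟨√3 * ι, δ, by positivity, ?_, isRun_of_iterate hηα hηβ hηγ hηθ hητ hs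
        (fun t ht => (hδ t ht).1) fun _ t ht => (hδ t ht).2⟩
      have h1 : 0 ≤ ρ ^ 2 * α ^ 2 * ι ^ 2 / (1 - ρ) ^ 2 := by positivity
      rw [mul_pow, Real.sq_sqrt (by norm_num), mul_div_assoc]
      linarith
  obtain ⟨hint, hrec⟩ := hrun.errorRecursion (R := V) hF hP hMod hι0 hN hL hκ1 hW (by positivity)
    hsmall (by positivity) hβL (by positivity) hβL (by positivity) hθ1
    fun x => hMo ▸ (hinit.gap x).trans hRV
  refine ⟨fun t ht => hint t ht.le, ?_⟩
  rw [← hρ] at hrec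
  refine key b ι' ρ α τ N T _ _ _ _ _ _ hrec ?_ ?_ ?_ ?_ ?_ hN hT hρ0 hρ1 hα hαA hαa hτ1 hτ2 hι'
  · simp only [hrun.init, integral_const, probReal_univ, one_smul]
    exact (hinit.errY_le hMy).trans hRV
  · simp only [hrun.init, integral_const, probReal_univ, one_smul]
    linarith [hinit.errZ_le (M := M)]
  · simp only [hrun.init, integral_const, probReal_univ, one_smul]
    linarith [hinit.errH_le hN hL hκ0 hMo]
  · simp only [hrun.init, integral_const, probReal_univ, one_smul]
    exact (hinit.spread_h_le hN).trans hRV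
  · simp only [hrun.init, integral_const, probReal_univ, one_smul]
    exact div_le_div_of_nonneg_right (hinit.consensus.trans hRV) (Nat.cast_nonneg N)
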